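/- Let $(V,\omega)$ be a real symplectic vector space of dimension $2n$ and $\Lambda\subset V$ a lattice such that $\omega$ takes rational values on $\Lambda\times\Lambda$ (so $(V/\Lambda,\omega)$ is a rational symplectic torus). Let $\mathcal U(V)$ be the set of complex valued alternating $n$-forms $\Omega$ on $V$ that are primitive ($\Omega\wedge\omega=0$) and have non-zero pullback to every Lagrangian subspace of $V$. Let $\mathcal U_{\mathrm{geom}}(V)\subset\mathcal U(V)$ be the set of those which are of type $(n,0)$ for some complex structure $J$ on $V$ compatible with $\omega$ (that is, $\omega(Ju,Jv)=\omega(u,v)$ and $\omega(v,Jv)>0$ for $v\neq 0$), and let $\mathcal U_{\mathrm{ag}}(V)$, the set of almost geometric forms, be the orbit of $\mathcal U_{\mathrm{geom}}(V)$ under $\mathrm{GL}^+(2,\mathbb R)$ acting on the values in $\mathbb C=\mathbb R^2$. For $n>0$ let $\mathcal U^+(V)\subset\mathcal U(V)$ be the set of those $\Omega$ whose phase map $L\mapsto\mathrm{Arg}(\Omega|_L)\in\mathbb R/\pi\mathbb Z$ on the Lagrangian Grassmannian sends the canonical generator of its fundamental group (represented, for a symplectic basis $e_1,\dots,e_n,f_1,\dots,f_n$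 with $\omega(e_i,f_j)=\delta_{ij}$, by the loop $\theta\mapsto\mathrm{span}(\cos\theta\, e_1+\sin\theta\, f_1,e_2,\dots,e_n)$, $\theta\in\mathbb R/\pi\mathbb Z$) to a positive loop. Regard $\Omega$ as a constant form on $V/\Lambda$, orient $V/\Lambda$ by $\omega^n$, and put $$\mathrm{Vol}_\Omega=\int_{V/\Lambda}(-1)^{\frac{n(n-1)}{2}}\left(\tfrac i2\right)^n\Omega\wedge\overline\Omega,\qquad \mathrm{Sys}_\Omega=\inf_L\int_L|\Omega|,$$ where $L$ runs over the non-empty compact special Lagrangian submanifolds of $V/\Lambda$, i.e. compact embedded smooth Lagrangian submanifolds on which $\mathrm{Arg}(\Omega|_L)\in\mathbb R/\pi\mathbb Z$ is constant. **Theorem.** There is a constant $C>0$, depending only on $(V/\Lambda,\omega)$, such that for every $\Omega\in\mathcal U_{\mathrm{ag}}(V)$ the systole $\mathrm{Sys}_\Omega$ is finite and $$(\mathrm{Sys}_\Omega)^2\le C\cdot\mathrm{Vol}_\Omega .$$ In particular, if $\dim_{\mathbb R}V=4$, there is a constant $C>0$, depending only on $(V/\Lambda,\omega)$, such that $\mathrm{Sys}_\Omega$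 is finite and $(\mathrm{Sys}_\Omega)^2\le C\cdot\mathrm{Vol}_\Omega$ for every $\Omega\in\mathcal U^+(V)$. -/

import Mathlib

open scoped ENNReal

namespace SymplecticTorus

/-! ## Exterior algebra of alternating forms -/

section Forms

variable {V : Type*} [AddCommGroup V] [Module ℝ V]

/-- The wedge product of alternating forms with values in a commutative real algebra `A`
(sum over shuffles, so that `(a ∧ b)(u, v) = a u * b v - a v * b u` for 1-forms). -/
noncomputable def wedge {A : Type*} [CommRing A] [Algebra ℝ A] {k l : ℕ}
    (a : V [⋀^Fin k]→ₗ[ℝ] A) (b : V [⋀^Fin l]→ₗ[ℝ] A) : V [⋀^Fin (k + l)]→ₗ[ℝ] A :=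
  ((LinearMap.mul' ℝ A).compAlternatingMap (a.domCoprod b)).domDomCongr finSumFinEquiv

/-- The wedge power `ω ∧ ⋯ ∧ ω` (`n` factors) of a 2-form. -/
noncomputable def wedgePow (ω : V [⋀^Fin 2]→ₗ[ℝ] ℝ) : (n : ℕ) → V [⋀^Fin (2 * n)]→ₗ[ℝ] ℝ
  | 0 => AlternatingMap.constOfIsEmpty ℝ V (Fin 0) 1
  | n + 1 => wedge (wedgePow ω n) ω

/-- A real form regarded as a complex valued form. -/
noncomputable def complexify {k : ℕ} (a : V [⋀^Fin k]→ₗ[ℝ] ℝ) : V [⋀^Fin k]→ₗ[ℝ] ℂ :=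
  Complex.ofRealCLM.toLinearMap.compAlternatingMap a

/-- The complex conjugate of a complex valued form. -/
noncomputable def conjForm {k : ℕ} (Ω : V [⋀^Fin k]→ₗ[ℝ] ℂ) : V [⋀^Fin k]→ₗ[ℝ] ℂ :=
  Complex.conjAe.toLinearMap.compAlternatingMap Ω

/-- A symplectic form on a real vector space: a nondegenerate alternating bilinear form. -/
def IsSymplectic (ω : V [⋀^Fin 2]→ₗ[ℝ] ℝ) : Prop :=
  ∀ u : V, (∀ v : V, ω ![u, v] = 0) → u = 0

/-- A middle degree form is primitive if `Ω ∧ ω = 0`. -/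
def IsPrimitive {n : ℕ} (ω : V [⋀^Fin 2]→ₗ[ℝ] ℝ) (Ω : V [⋀^Fin n]→ₗ[ℝ] ℂ) : Prop :=
  wedge Ω (complexify ω) = 0

/-- A Lagrangian subspace of a symplectic vector space of dimension `2 n`. -/
def IsLagrangian (n : ℕ) (ω : V [⋀^Fin 2]→ₗ[ℝ] ℝ) (W : Submodule ℝ V) : Prop :=
  Module.finrank ℝ W = n ∧ ∀ u ∈ W, ∀ v ∈ W, ω ![u, v] = 0

/-- `𝒰(V)`: primitive complex valued `n`-forms on a `2 n`-dimensional symplectic vector space whose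
pullback to every Lagrangian subspace is non-zero. -/
def U (n : ℕ) (ω : V [⋀^Fin 2]→ₗ[ℝ] ℝ) : Set (V [⋀^Fin n]→ₗ[ℝ] ℂ) :=
  {Ω | IsPrimitive ω Ω ∧
    ∀ W : Submodule ℝ V, IsLagrangian n ω W → Ω.compLinearMap W.subtype ≠ 0}

/-- A complex structure `J` on `V` compatible with `ω`. -/
structure IsCompatible (ω : V [⋀^Fin 2]→ₗ[ℝ] ℝ) (J : V →ₗ[ℝ] V) : Prop where
  sq : ∀ v, J (J v) = -v
  invariant : ∀ u v, ω ![J u, J v] = ω ![u, v]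
  pos : ∀ v, v ≠ 0 → 0 < ω ![v, J v]

/-- `Ω` is of type `(n, 0)` for the complex structure `J`, i.e. complex multilinear. -/
def IsTypeN0 {n : ℕ} (J : V →ₗ[ℝ] V) (Ω : V [⋀^Fin n]→ₗ[ℝ] ℂ) : Prop :=
  ∀ (v : Fin n → V) (i : Fin n), Ω (Function.update v i (J (v i))) = Complex.I * Ω v

/-- `𝒰_geom(V)`: the forms in `𝒰(V)` of type `(n, 0)` for some compatible complex structure. -/
def Ugeom (n : ℕ) (ω : V [⋀^Fin 2]→ₗ[ℝ] ℝ) : Set (V [⋀^Fin n]→ₗ[ℝ] ℂ) :=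
  {Ω | Ω ∈ U n ω ∧ ∃ J : V →ₗ[ℝ] V, IsCompatible ω J ∧ IsTypeN0 J Ω}

/-- `𝒰_ag(V)`: the almost geometric forms, i.e. the orbit of `𝒰_geom(V)` under `GL⁺(2, ℝ)`, the
group of real linear automorphisms of `ℂ = ℝ²` of positive determinant, acting on values. -/
def Uag (n : ℕ) (ω : V [⋀^Fin 2]→ₗ[ℝ] ℝ) : Set (V [⋀^Fin n]→ₗ[ℝ] ℂ) :=
  {Ω | ∃ g : ℂ →ₗ[ℝ] ℂ, 0 < LinearMap.det g ∧ ∃ Ω₀ ∈ Ugeom n ω, Ω = g.compAlternatingMap Ω₀}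

/-- `e₁, …, eₙ, f₁, …, fₙ` is a symplectic family: `ω(e_i, f_j) = δ_ij` and the `e`'s as well as the
`f`'s are isotropic. If `dim V = 2 n` this is a symplectic basis of `V`. -/
structure IsSymplecticFamily {n : ℕ} (ω : V [⋀^Fin 2]→ₗ[ℝ] ℝ) (e f : Fin n → V) : Prop where
  ee : ∀ i j, ω ![e i, e j] = 0
  ff : ∀ i j, ω ![f i, f j] = 0
  ef : ∀ i j, ω ![e i, f j] = if i = j then 1 else 0

/-- The frame of the Lagrangian subspace spanned by `cos θ e_i + sin θ f_i` and the `e_j`, `j ≠ i`.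
As `θ` runs through `ℝ/πℤ` these subspaces form a loop representing the canonical generator of the
fundamental group of the Lagrangian Grassmannian. -/
noncomputable def loopFrame {n : ℕ} (e f : Fin n → V) (i : Fin n) (θ : ℝ) : Fin n → V :=
  Function.update e i (Real.cos θ • e i + Real.sin θ • f i)

/-- `𝒰⁺(V)` (for `n > 0`): the forms in `𝒰(V)` for which the phase map
`L ↦ Arg(Ω|_L) ∈ ℝ/πℤ` sends the canonical generator of the fundamental group of the Lagrangian
Grassmannian to a positive loop. Here `g` is a continuous lift to `ℝ` of the phase along the
standard loop for a symplectic basis; the lift is unique up to an additive constant in `πℤ`, and the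
homotopy class of the loop does not depend on the symplectic basis or on `i`. -/
def Uplus (n : ℕ) (ω : V [⋀^Fin 2]→ₗ[ℝ] ℝ) : Set (V [⋀^Fin n]→ₗ[ℝ] ℂ) :=
  {Ω | Ω ∈ U n ω ∧ ∃ e f : Fin n → V, IsSymplecticFamily ω e f ∧ ∃ i : Fin n, ∃ g : ℝ → ℝ,
    Continuous g ∧
    (∀ θ : ℝ, ∃ r : ℝ, Ω (loopFrame e f i θ) = r * Complex.exp (Complex.I * g θ)) ∧
    g 0 < g Real.pi}

/-- The top degree form `(-1)^(n(n-1)/2) (i/2)^n Ω ∧ Ω̄`. -/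
noncomputable def volForm {n : ℕ} (Ω : V [⋀^Fin n]→ₗ[ℝ] ℂ) : V [⋀^Fin (2 * n)]→ₗ[ℝ] ℂ :=
  (((-1 : ℂ) ^ (n * (n - 1) / 2) * (Complex.I / 2) ^ n) • wedge Ω (conjForm Ω)).domDomCongr
    (finCongr (two_mul n).symm)

end Forms

section Torus

variable {V : Type*} [NormedAddCommGroup V] [NormedSpace ℝ V] [FiniteDimensional ℝ V]

/-- `ω` takes rational values on `Λ × Λ`. -/
def IsRationalOn (Λ : Submodule ℤ V) (ω : V [⋀^Fin 2]→ₗ[ℝ] ℝ) : Prop :=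
  ∀ x ∈ Λ, ∀ y ∈ Λ, ∃ q : ℚ, ω ![x, y] = q

/-! ## The volume of a constant form on the torus -/

/-- A `ℤ`-basis of the lattice `Λ`. -/
noncomputable def latticeBasis {n : ℕ} (Λ : Submodule ℤ V) [DiscreteTopology Λ] [IsZLattice ℝ Λ]
    (hV : Module.finrank ℝ V = 2 * n) : Module.Basis (Fin (2 * n)) ℤ Λ :=
  haveI := ZLattice.module_finite ℝ Λ
  haveI := ZLattice.module_free ℝ Λ
  Module.finBasisOfFinrankEq ℤ Λ ((ZLattice.rank ℝ Λ).trans hV)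

/-- `Vol_Ω(V/Λ)`, the integral of the constant (real) top degree form
`(-1)^(n(n-1)/2) (i/2)^n Ω ∧ Ω̄` over `V/Λ`, which is oriented by `ω^n`. The integral of a constant
top degree form is its value on a `ℤ`-basis `b` of `Λ`, multiplied by `-1` if `b` is negatively
oriented; it does not depend on `b`. -/
noncomputable def vol {n : ℕ} (Λ : Submodule ℤ V) [DiscreteTopology Λ] [IsZLattice ℝ Λ]
    (hV : Module.finrank ℝ V = 2 * n) (ω : V [⋀^Fin 2]→ₗ[ℝ] ℝ) (Ω : V [⋀^Fin n]→ₗ[ℝ] ℂ) : ℝ :=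
  Real.sign (wedgePow ω n fun j => (latticeBasis Λ hV j : V)) *
    (volForm Ω fun j => (latticeBasis Λ hV j : V)).re

/-! ## Compact special Lagrangian submanifolds of the torus and the systole -/

/-- The map `ℝⁿ → V/Λ` obtained from `ψ : ℝⁿ → V`. -/
def toTorus {n : ℕ} (Λ : Submodule ℤ V) (ψ : (Fin n → ℝ) → V) (x : Fin n → ℝ) : V ⧸ Λ :=
  Submodule.Quotient.mk (ψ x)

/-- `ψ : O → V` is (a lift to `V` of) a smooth local parametrization of the `n`-dimensional
embedded submanifold `L ⊆ V/Λ`: a smooth immersion on the open set `O ⊆ ℝⁿ` whose composition with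
`V → V/Λ` is a homeomorphism from `O` to a relatively open subset of `L`. -/
structure IsLocalParam {n : ℕ} (Λ : Submodule ℤ V) (L : Set (V ⧸ Λ)) (O : Set (Fin n → ℝ))
    (ψ : (Fin n → ℝ) → V) : Prop where
  isOpen : IsOpen O
  smooth : ContDiffOn ℝ ((⊤ : ℕ∞) : WithTop ℕ∞) ψ O
  immersion : ∀ x ∈ O, Function.Injective (fderiv ℝ ψ x)
  injOn : Set.InjOn (toTorus Λ ψ) O
  relOpen : ∀ O' ⊆ O, IsOpen O' → ∃ T : Set (V ⧸ Λ), IsOpen T ∧ toTorus Λ ψ '' O' = L ∩ T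

/-- The frame `∂₁ψ, …, ∂ₙψ` of the tangent space at the point with parameter `x`. -/
noncomputable def tangentFrame {n : ℕ} (ψ : (Fin n → ℝ) → V) (x : Fin n → ℝ) : Fin n → V :=
  fun j => fderiv ℝ ψ x (Pi.single j 1)

/-- `L ⊆ V/Λ` is a compact special Lagrangian submanifold (non-empty, without boundary, not
necessarily connected): a compact embedded smooth `n`-dimensional submanifold whose tangent spaces
are Lagrangian and on which `Ω` has constant phase `Arg(Ω|_L) = φ ∈ ℝ/πℤ`. -/
def IsCompactSpecialLagrangian {n : ℕ} (Λ : Submodule ℤ V) (ω : V [⋀^Fin 2]→ₗ[ℝ] ℝ)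
    (Ω : V [⋀^Fin n]→ₗ[ℝ] ℂ) (L : Set (V ⧸ Λ)) : Prop :=
  IsCompact L ∧ L.Nonempty ∧ ∃ φ : ℝ, ∀ p ∈ L, ∃ (O : Set (Fin n → ℝ)) (ψ : (Fin n → ℝ) → V),
    IsLocalParam Λ L O ψ ∧ p ∈ toTorus Λ ψ '' O ∧
    ∀ x ∈ O, (∀ i j, ω ![tangentFrame ψ x i, tangentFrame ψ x j] = 0) ∧
      ∃ r : ℝ, r ≠ 0 ∧ Ω (tangentFrame ψ x) = r * Complex.exp (Complex.I * φ)

/-- A decomposition of `L` into finitely many disjoint Borel pieces, each contained in the image of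
a local parametrization. -/
structure Dissection (n : ℕ) (Λ : Submodule ℤ V) (L : Set (V ⧸ Λ)) where
  m : ℕ
  O : Fin m → Set (Fin n → ℝ)
  ψ : Fin m → (Fin n → ℝ) → V
  A : Fin m → Set (Fin n → ℝ)
  isLocalParam : ∀ k, IsLocalParam Λ L (O k) (ψ k)
  subset : ∀ k, A k ⊆ O k
  measurable : ∀ k, MeasurableSet (A k)
  disjoint : Pairwise fun k l => Disjoint (toTorus Λ (ψ k) '' A k) (toTorus Λ (ψ l) '' A l)
  cover : ⋃ k, toTorus Λ (ψ k) '' A k = L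

/-- The integral of the density `|Ω|` over `L`, computed piece by piece in the local
parametrizations of a dissection. -/
noncomputable def Dissection.integral {n : ℕ} {Λ : Submodule ℤ V} {L : Set (V ⧸ Λ)}
    (D : Dissection n Λ L) (Ω : V [⋀^Fin n]→ₗ[ℝ] ℂ) : ℝ≥0∞ :=
  ∑ k, ∫⁻ x in D.A k, ‖Ω (tangentFrame (D.ψ k) x)‖ₑ

/-- `∫_L |Ω|` for a compact submanifold `L`. By the change of variables formula all dissections of
`L` give the same value, and a dissection exists by compactness. -/
noncomputable def absIntegral {n : ℕ} (Λ : Submodule ℤ V) (Ω : V [⋀^Fin n]→ₗ[ℝ] ℂ)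
    (L : Set (V ⧸ Λ)) : ℝ≥0∞ :=
  ⨅ D : Dissection n Λ L, D.integral Ω

/-- The systole `Sys_Ω(V/Λ)`: the infimum of `∫_L |Ω|` over all compact special Lagrangian
submanifolds `L` (it is `∞` if there are none). -/
noncomputable def sys {n : ℕ} (Λ : Submodule ℤ V) (ω : V [⋀^Fin 2]→ₗ[ℝ] ℝ)
    (Ω : V [⋀^Fin n]→ₗ[ℝ] ℂ) : ℝ≥0∞ :=
  ⨅ (L : Set (V ⧸ Λ)) (_ : IsCompactSpecialLagrangian Λ ω Ω L), absIntegral Λ Ω L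

/-- A systolic bound holds on the set `S` of constant forms on `(V/Λ, ω)`: there is a constant `C`
with `Sys_Ω² ≤ C Vol_Ω` for all `Ω ∈ S`. -/
def SystolicBound {n : ℕ} (Λ : Submodule ℤ V) [DiscreteTopology Λ] [IsZLattice ℝ Λ]
    (hV : Module.finrank ℝ V = 2 * n) (ω : V [⋀^Fin 2]→ₗ[ℝ] ℝ)
    (S : Set (V [⋀^Fin n]→ₗ[ℝ] ℂ)) : Prop :=
  ∃ C : ℝ, 0 < C ∧ ∀ Ω ∈ S, sys Λ ω Ω ≠ ∞ ∧ (sys Λ ω Ω).toReal ^ 2 ≤ C * vol Λ hV ω Ω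

end Torus

end SymplecticTorus

/-! Let Ω = g ∘ Ω₀ with Ω₀ of type (n,0) for a compatible J and det g > 0. For any unitary frame u,
Ω₀ is Ω₀(u) times the complex determinant in the coordinates of u (`IsEigenform.eq_smul_detForm`).
Writing g z = A z + B z̄, the volume is |Pf ω| (|A|² + (-1)ⁿ|B|²) |Ω₀(u)|², with the Pfaffian taken
on Λ (`vol_eq`). This is at least |Pf ω| · det g · |Ω₀(u)|², since det g = |A|² - |B|². A linear
Lagrangian subtorus is special because Ω is constant and nonzero on it, so it suffices to find a
primitive Lagrangian family w in Λ with |Ω(w)|² bounded by a constant times det g · |Ω₀(u)|²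
(`PrimitiveUpTo.sys_bound`).

The family comes from a symplectic form of reduction theory. Its vectors are chosen one at a time by
Minkowski's theorem on linear forms, applied to coordinates in a symplectic basis made of the
vectors already found and a unitary completion (`exists_box_bound`). The determinant of these
coordinates on Λ is ±Pf ω for every symplectic basis, so the bounds do not depend on J. Rationality
enters because Nω is integral on Λ for some N: a sufficiently small pairing with an earlier vector
is zero. A minimal choice keeps the family primitive (`exists_primitive_extension`).
Orthogonalization then gives a unitary frame in which the family is triangular with bounded diagonal
(`exists_reducedUpTo`). The map g matters only for the last vector. There the complex line of the
last unitary vector gets a unimodular basis whose image under the remaining factor of Ω is conformal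
(`exists_conformal_frame`, `exists_last_vector`), so the eccentricity of g does no harm.

In dimension four, a real primitive 2-form α = ω(T·,·) satisfies T² = disc(α). If Ω vanishes on no
Lagrangian plane, disc is negative definite on the span of Re Ω and Im Ω (`formDisc_neg`). After a
change of values with positive determinant the two operators T, S square to -1 and anticommute, and
J = TS makes the form of type (2,0), with J or -J compatible (`exists_complexStructure`). If -J is
the compatible one, the standard loop has negative phase (`lift_le_of_conjugate_type`), so 𝒰⁺ lies
in 𝒰_ag. -/

namespace SymplecticTorus

/-! ## Two-forms as bilinear maps -/

section Bilinear

variable {V : Type*} [AddCommGroup V] [Module ℝ V] {F : Type*} [AddCommGroup F] [Module ℝ F]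

/-- The bilinear map `(u, v) ↦ a(u, v)` of a 2-form `a`. -/
noncomputable def bil (a : V [⋀^Fin 2]→ₗ[ℝ] F) : V →ₗ[ℝ] V →ₗ[ℝ] F :=
  LinearMap.mk₂ ℝ (fun u v => a ![u, v])
    (fun x y v => a.map_vecCons_add ![v] x y)
    (fun c x v => a.map_vecCons_smul ![v] c x)
    (fun u x y => by
      have h := a.map_update_add ![u, x] 1 x y
      have hu : ∀ y, Function.update ![u, x] 1 y = ![u, y] := fun y => by
        ext i; fin_cases i <;> rfl
      rwa [hu, hu, hu] at h)
    (fun c u x => by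
      have h := a.map_update_smul ![u, x] 1 c x
      have hu : ∀ y, Function.update ![u, x] 1 y = ![u, y] := fun y => by
        ext i; fin_cases i <;> rfl
      rwa [hu, hu] at h)

theorem bil_apply (a : V [⋀^Fin 2]→ₗ[ℝ] F) (u v : V) : bil a u v = a ![u, v] := rfl

@[simp] theorem bil_self (a : V [⋀^Fin 2]→ₗ[ℝ] F) (u : V) : bil a u u = 0 :=
  a.map_eq_zero_of_eq ![u, u] (i := 0) (j := 1) (by simp) (by decide)

theorem bil_swap (a : V [⋀^Fin 2]→ₗ[ℝ] F) (u v : V) : bil a u v = -bil a v u := by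
  have h := bil_self a (u + v)
  simp only [map_add, LinearMap.add_apply, bil_self, zero_add, add_zero] at h
  exact eq_neg_of_add_eq_zero_right h

end Bilinear

/-! ## Symplectic families -/

section Families

variable {V : Type*} [AddCommGroup V] [Module ℝ V] {n : ℕ} {ω : V [⋀^Fin 2]→ₗ[ℝ] ℝ}
  {e f : Fin n → V}

theorem IsSymplecticFamily.bil_ee (h : IsSymplecticFamily ω e f) (i j : Fin n) :
    bil ω (e i) (e j) = 0 := h.ee i j

theorem IsSymplecticFamily.bil_ff (h : IsSymplecticFamily ω e f) (i j : Fin n) :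
    bil ω (f i) (f j) = 0 := h.ff i j

theorem IsSymplecticFamily.bil_ef (h : IsSymplecticFamily ω e f) (i j : Fin n) :
    bil ω (e i) (f j) = if i = j then 1 else 0 := h.ef i j

theorem IsSymplecticFamily.bil_fe (h : IsSymplecticFamily ω e f) (i j : Fin n) :
    bil ω (f i) (e j) = if i = j then -1 else 0 := by
  rw [bil_swap, h.bil_ef]
  by_cases hij : i = j
  · simp [hij]
  · simp [hij, Ne.symm hij]

theorem IsSymplecticFamily.linearIndependent (h : IsSymplecticFamily ω e f) :
    LinearIndependent ℝ (Sum.elim e f) := by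
  rw [Fintype.linearIndependent_iff]
  intro c hc
  rw [Fintype.sum_sum_type] at hc
  simp only [Sum.elim_inl, Sum.elim_inr] at hc
  rintro (i | i)
  · have := congrArg (fun x => bil ω x (f i)) hc
    simpa [h.bil_ef, h.bil_ff] using this
  · have := congrArg (fun x => bil ω (e i) x) hc
    simpa [h.bil_ef, h.bil_ee] using this

variable [FiniteDimensional ℝ V]

/-- The basis of `V` given by a symplectic family of maximal size. -/
noncomputable def IsSymplecticFamily.basis (h : IsSymplecticFamily ω e f)
    (hV : Module.finrank ℝ V = 2 * n) : Module.Basis (Fin n ⊕ Fin n) ℝ V :=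
  Module.Basis.mk h.linearIndependent
    (h.linearIndependent.span_eq_top_of_card_eq_finrank' (by simp [hV, two_mul])).ge

@[simp] theorem IsSymplecticFamily.basis_inl (h : IsSymplecticFamily ω e f)
    (hV : Module.finrank ℝ V = 2 * n) (i : Fin n) : h.basis hV (Sum.inl i) = e i := by
  simp [IsSymplecticFamily.basis]

@[simp] theorem IsSymplecticFamily.basis_inr (h : IsSymplecticFamily ω e f)
    (hV : Module.finrank ℝ V = 2 * n) (i : Fin n) : h.basis hV (Sum.inr i) = f i := by
  simp [IsSymplecticFamily.basis]

theorem IsSymplecticFamily.expand (h : IsSymplecticFamily ω e f)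
    (hV : Module.finrank ℝ V = 2 * n) (x : V) :
    x = ∑ i, (bil ω x (f i) • e i + bil ω (e i) x • f i) := by
  have key : LinearMap.id = ∑ i, (((bil ω).flip (f i)).smulRight (e i) +
      (bil ω (e i)).smulRight (f i)) := by
    refine (h.basis hV).ext ?_
    rintro (j | j)
    · simp [h.bil_ef, h.bil_ee, ite_smul]
    · simp [h.bil_ef, h.bil_ff, ite_smul]
  simpa using LinearMap.congr_fun key x

theorem IsSymplecticFamily.bil_expand (h : IsSymplecticFamily ω e f)
    (hV : Module.finrank ℝ V = 2 * n) (x y : V) :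
    bil ω x y = ∑ i, (bil ω (e i) x * bil ω (f i) y
      - bil ω (f i) x * bil ω (e i) y) := by
  conv_lhs => rw [h.expand hV x]
  simp only [map_sum, map_add, map_smul, LinearMap.sum_apply, LinearMap.add_apply,
    LinearMap.smul_apply, smul_eq_mul]
  refine Finset.sum_congr rfl fun i _ => ?_
  rw [bil_swap ω x (f i)]
  ring

open Matrix in
/-- The matrix of the coordinate forms of a symplectic family evaluated on `2 n` vectors has a
determinant that does not depend on the family, up to sign. -/
theorem IsSymplecticFamily.det_sq (h : IsSymplecticFamily ω e f)
    (hV : Module.finrank ℝ V = 2 * n) (b : Fin n ⊕ Fin n → V) :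
    (Matrix.of fun (s t : Fin n ⊕ Fin n) => bil ω (Sum.elim e f s) (b t)).det ^ 2 =
      (Matrix.of fun s t => bil ω (b s) (b t)).det := by
  set A := Matrix.of fun (s t : Fin n ⊕ Fin n) => bil ω (Sum.elim e f s) (b t) with hA
  -- The Gram matrix of `b` does not involve the family. This independence makes all later Minkowski
  -- constants uniform in J.
  have hG : (Matrix.of fun s t => bil ω (b s) (b t)) = Aᵀ * (-Matrix.J (Fin n) ℝ) * A := by
    ext s t
    rw [Matrix.of_apply, h.bil_expand hV, Matrix.mul_apply, Fintype.sum_sum_type,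
      ← Finset.sum_add_distrib]
    refine Finset.sum_congr rfl fun i _ => ?_
    simp only [Matrix.mul_apply, Fintype.sum_sum_type, Matrix.transpose_apply, hA, Matrix.of_apply,
      Sum.elim_inl, Sum.elim_inr, Matrix.J, Matrix.neg_apply, Matrix.fromBlocks_apply₁₁,
      Matrix.fromBlocks_apply₁₂, Matrix.fromBlocks_apply₂₁, Matrix.fromBlocks_apply₂₂,
      Matrix.zero_apply, Matrix.one_apply]
    simp
    ring
  have hJ : (-Matrix.J (Fin n) ℝ).det = 1 := by
    have h1 : (-Matrix.J (Fin n) ℝ) ∈ Matrix.symplecticGroup (Fin n) ℝ :=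
      SymplecticGroup.neg_mem (SymplecticGroup.J_mem _ _)
    exact SymplecticGroup.det_eq_one h1
  rw [hG, Matrix.det_mul, Matrix.det_mul, Matrix.det_transpose, hJ]
  ring

end Families

/-! ## Minkowski's theorem on linear forms -/

-- The region is the preimage of a box under `A`, with volume 2^d ∏ c_i / |det A|. This exceeds 2^d
-- times the covolume of ℤ^d, so Minkowski's convex body theorem applies.
open MeasureTheory in
theorem exists_int_linearForms_lt {ι : Type*} [Fintype ι] [DecidableEq ι] (A : Matrix ι ι ℝ)
    (hA : A.det ≠ 0) (c : ι → ℝ) (hc : ∀ i, 0 < c i) (hAc : |A.det| < ∏ i, c i) :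
    ∃ x : ι → ℤ, x ≠ 0 ∧ ∀ i, |A.mulVec (fun j => (x j : ℝ)) i| < c i := by
  set b := Pi.basisFun ℝ ι
  set T : (ι → ℝ) →ₗ[ℝ] (ι → ℝ) := Matrix.toLin' A with hT
  have hdet : LinearMap.det T = A.det := LinearMap.det_toLin' A
  set s : Set (ι → ℝ) := T ⁻¹' Set.univ.pi fun i => Set.Ioo (-c i) (c i) with hs
  have hmem : ∀ x, x ∈ s ↔ ∀ i, |T x i| < c i := by
    intro x
    simp [hs, abs_lt]
  have hvol : volume s = ENNReal.ofReal |A.det⁻¹| * ∏ i, ENNReal.ofReal (2 * c i) := by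
    rw [hs, Measure.addHaar_preimage_linearMap volume (by rwa [hdet]), hdet, Real.volume_pi_Ioo]
    congr 2
    ext i
    congr 1
    ring
  have hfund := ZSpan.isAddFundamentalDomain b (volume : Measure (ι → ℝ))
  have h1 : volume (ZSpan.fundamentalDomain b) = 1 := by
    rw [ZSpan.volume_fundamentalDomain]
    have : (Matrix.of ⇑b) = 1 := by
      ext i j; simp [b, Matrix.one_apply, Pi.single_apply, eq_comm]
    rw [this]; simp
  have hlt : volume (ZSpan.fundamentalDomain b) * 2 ^ Module.finrank ℝ (ι → ℝ) < volume s := by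
    rw [h1, one_mul, hvol, ← ENNReal.ofReal_prod_of_nonneg (fun i _ => by have := hc i; positivity),
      ← ENNReal.ofReal_mul (abs_nonneg _), Finset.prod_mul_distrib, Finset.prod_const,
      Module.finrank_fintype_fun_eq_card]
    rw [show (2 : ℝ≥0∞) = ENNReal.ofReal 2 by simp, ← ENNReal.ofReal_pow (by norm_num)]
    rw [Finset.card_univ, ENNReal.ofReal_lt_ofReal_iff_of_nonneg (by positivity), abs_inv]
    have hp : 0 < |A.det| := abs_pos.2 hA
    rw [← div_eq_inv_mul, lt_div_iff₀ hp]
    have : (0 : ℝ) < 2 ^ Fintype.card ι := by positivity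
    exact mul_lt_mul_of_pos_left hAc this
  have : Countable (Submodule.span ℤ (Set.range b)).toAddSubgroup :=
    inferInstanceAs (Countable (Submodule.span ℤ (Set.range b)))
  obtain ⟨x, hx0, hxs⟩ := exists_ne_zero_mem_lattice_of_measure_mul_two_pow_lt_measure
    (L := (Submodule.span ℤ (Set.range b)).toAddSubgroup) hfund
    (s := s) (fun x hx => by
      rw [hmem] at hx ⊢
      intro i
      simpa using hx i)
    (Convex.linear_preimage (convex_pi fun i _ => convex_Ioo _ _) T) hlt
  have hxi : ∀ i, ∃ m : ℤ, (m : ℝ) = (x : ι → ℝ) i := by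
    intro i
    have h := (Module.Basis.mem_span_iff_repr_mem ℤ b (x : ι → ℝ)).1 x.2 i
    simpa [b] using h
  choose m hm using hxi
  have hmx : (fun j => (m j : ℝ)) = (x : ι → ℝ) := funext hm
  refine ⟨m, ?_, ?_⟩
  · rintro rfl
    apply hx0
    ext i
    rw [← hmx]; simp
  · rw [hmx]
    exact (hmem _).1 hxs

/-! ## Extending primitive isotropic families of lattice vectors -/

section Lattice

theorem isClosed_lattice {V : Type*} [NormedAddCommGroup V] (Λ : Submodule ℤ V) [DiscreteTopology Λ] : IsClosed (Λ : Set V) := by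
  have : DiscreteTopology Λ.toAddSubgroup := inferInstanceAs (DiscreteTopology Λ)
  exact AddSubgroup.isClosed_of_discrete (H := Λ.toAddSubgroup)

variable {V : Type*} [NormedAddCommGroup V] [NormedSpace ℝ V] {n : ℕ}

/-- The first `k` vectors of `v` generate the intersection of `Λ` with their real span (if they
lie in `Λ`), and are linearly independent. -/
def PrimitiveUpTo (Λ : Submodule ℤ V) (v : Fin n → V) (k : ℕ) : Prop :=
  ∀ c : Fin n → ℝ, (∀ i : Fin n, k ≤ i → c i = 0) → ∑ i, c i • v i ∈ Λ → ∀ i, ∃ m : ℤ, c i = m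

theorem IsRationalOn.exists_denominator {ι : Type*} [Fintype ι] {Λ : Submodule ℤ V}
    {ω : V [⋀^Fin 2]→ₗ[ℝ] ℝ} (b : Module.Basis ι ℤ Λ)
    (h : IsRationalOn Λ ω) : ∃ N : ℕ, 0 < N ∧ ∀ x ∈ Λ, ∀ y ∈ Λ, ∃ m : ℤ, N * bil ω x y = m := by
  classical
  have hb : ∀ i j, ∃ q : ℚ, bil ω (b i : V) (b j) = q := fun i j => h _ (b i).2 _ (b j).2
  choose q hq using hb
  refine ⟨∏ i, ∏ j, (q i j).den, Finset.prod_pos fun i _ => Finset.prod_pos fun j _ => (q i j).pos,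
    fun x hx y hy => ?_⟩
  have hbb : ∀ i j, ∃ m : ℤ, ((∏ i, ∏ j, (q i j).den : ℕ) : ℝ) * bil ω (b i : V) (b j) = m := by
    intro i j
    obtain ⟨d, hd⟩ : (q i j).den ∣ ∏ i, ∏ j, (q i j).den :=
      (Finset.dvd_prod_of_mem (fun j => (q i j).den) (Finset.mem_univ j)).trans
        (Finset.dvd_prod_of_mem (fun i => ∏ j, (q i j).den) (Finset.mem_univ i))
    refine ⟨d * (q i j).num, ?_⟩
    rw [hd, hq]
    have h1 : ((q i j).den : ℝ) * (q i j : ℝ) = (q i j).num := by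
      exact_mod_cast (q i j).den_mul_eq_num
    push_cast
    rw [← h1]; ring
  choose m hm using hbb
  have hexp : ∀ z ∈ Λ, ∃ a : ι → ℤ, z = ∑ i, (a i : ℝ) • (b i : V) := by
    intro z hz
    refine ⟨fun i => b.repr ⟨z, hz⟩ i, ?_⟩
    have h1 := congrArg (fun w : Λ => (w : V)) (b.sum_repr ⟨z, hz⟩)
    simp only [Submodule.coe_sum, Submodule.coe_smul] at h1
    exact h1.symm.trans (Finset.sum_congr rfl fun i _ => (Int.cast_smul_eq_zsmul ℝ _ _).symm)
  obtain ⟨a, rfl⟩ := hexp x hx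
  obtain ⟨c, rfl⟩ := hexp y hy
  refine ⟨∑ i, ∑ j, a j * (c i * m j i), ?_⟩
  simp only [map_sum, map_smul, LinearMap.sum_apply, LinearMap.smul_apply, smul_eq_mul]
  push_cast
  simp only [Finset.mul_sum, ← hm]
  refine Finset.sum_congr rfl fun i _ => Finset.sum_congr rfl fun j _ => ?_
  push_cast
  ring

variable [FiniteDimensional ℝ V]

theorem IsSymplecticFamily.det_ne_zero {ω : V [⋀^Fin 2]→ₗ[ℝ] ℝ} {e f : Fin n → V}
    (h : IsSymplecticFamily ω e f) (hV : Module.finrank ℝ V = 2 * n)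
    {b : Fin n ⊕ Fin n → V} (hb : LinearIndependent ℝ b) :
    (Matrix.of fun (s t : Fin n ⊕ Fin n) => bil ω (Sum.elim e f s) (b t)).det ≠ 0 := by
  intro h0
  obtain ⟨v, hv, hAv⟩ := Matrix.exists_mulVec_eq_zero_iff.2 h0
  have hz : ∀ s, bil ω (Sum.elim e f s) (∑ t, v t • b t) = 0 := by
    intro s
    have := congrFun hAv s
    simpa [Matrix.mulVec, dotProduct, mul_comm] using this
  have hx : ∑ t, v t • b t = 0 := by
    rw [h.expand hV (∑ t, v t • b t)]
    refine Finset.sum_eq_zero fun i _ => ?_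
    have h1 := hz (Sum.inl i)
    have h2 := hz (Sum.inr i)
    simp only [Sum.elim_inl, Sum.elim_inr] at h1 h2
    rw [bil_swap ω _ (f i), h1, h2]
    simp
  exact hv (funext (Fintype.linearIndependent_iff.1 hb v hx))

/-- Minkowski's theorem for the 2n coordinates of a symplectic family. If Nω is integral on Λ, the
bound |ω(e_i, x)| < 1/N for a lattice vector e_i forces ω(e_i, x) = 0. The price is a factor at most
Nⁿ in `r`. -/
theorem exists_box_bound {Λ : Submodule ℤ V} [DiscreteTopology Λ] [IsZLattice ℝ Λ]
    (hV : Module.finrank ℝ V = 2 * n) (b : Module.Basis (Fin n ⊕ Fin n) ℤ Λ)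
    {ω : V [⋀^Fin 2]→ₗ[ℝ] ℝ} (hrat : IsRationalOn Λ ω) :
    ∃ r : ℝ, 1 ≤ r ∧ ∀ e f : Fin n → V, IsSymplecticFamily ω e f → ∀ k < n,
      (∀ i : Fin n, i < k → e i ∈ Λ) → ∃ x ∈ Λ, x ≠ 0 ∧
        (∀ i : Fin n, i < k → bil ω (e i) x = 0 ∧ |bil ω x (f i)| < 1) ∧
        ∀ i : Fin n, k ≤ i → |bil ω (e i) x| < r ∧ |bil ω x (f i)| < r := by
  obtain ⟨N, hN0, hN⟩ := hrat.exists_denominator b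
  have hN1 : (1 : ℝ) ≤ N := by exact_mod_cast hN0
  have hNpos : (0 : ℝ) < N := by linarith
  set D := (Matrix.of fun s t => bil ω (b s : V) (b t)).det with hD
  have hbR : LinearIndependent ℝ (fun s => (b s : V)) := by
    have h1 := (b.ofZLatticeBasis ℝ Λ).linearIndependent
    rwa [show ⇑(b.ofZLatticeBasis ℝ Λ) = fun s => (b s : V) from
      funext fun s => b.ofZLatticeBasis_apply ℝ Λ s] at h1
  refine ⟨N ^ n * √D + 1, by
    -- The radius is chosen so that N⁻ⁿ r > √D = |det A|; the summand 1 gives strictness and r ≥ 1.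
    have : 0 ≤ (N : ℝ) ^ n * √D := by positivity
    linarith, fun e f h k hk he => ?_⟩
  set r : ℝ := N ^ n * √D + 1 with hr
  have hr1 : 1 ≤ r := by
    have : 0 ≤ (N : ℝ) ^ n * √D := by positivity
    linarith
  set A := Matrix.of fun (s t : Fin n ⊕ Fin n) => bil ω (Sum.elim e f s) (b t : V) with hA
  have hAD : |A.det| = √D := by
    rw [hD, ← h.det_sq hV, Real.sqrt_sq_eq_abs]
  set c : Fin n ⊕ Fin n → ℝ := Sum.elim (fun i => if (i : ℕ) < k then (N : ℝ)⁻¹ else r)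
    (fun i => if (i : ℕ) < k then 1 else r) with hc
  have hcpos : ∀ s, 0 < c s := by
    rintro (i | i) <;> simp only [hc, Sum.elim_inl, Sum.elim_inr] <;> split_ifs <;> positivity
  have hinv : (N : ℝ)⁻¹ ≤ 1 := inv_le_one_of_one_le₀ hN1
  have hprod : |A.det| < ∏ s, c s := by
    rw [Fintype.prod_sum_type, hAD]
    -- Each of these n factors is at least 1/N, and the one of index k, which exists because k < n,
    -- also supplies a factor r.
    have h1 : ∏ i : Fin n, ((N : ℝ)⁻¹ * if i = ⟨k, hk⟩ then r else 1) ≤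
        ∏ i : Fin n, c (Sum.inl i) := by
      refine Finset.prod_le_prod (fun i _ => by split_ifs <;> positivity) fun i _ => ?_
      simp only [hc, Sum.elim_inl]
      by_cases hik : (i : ℕ) < k
      · have : i ≠ ⟨k, hk⟩ := by rintro rfl; exact lt_irrefl _ hik
        simp [hik, this]
      · rw [if_neg hik]
        split_ifs
        · nlinarith
        · linarith
    rw [Finset.prod_mul_distrib, Finset.prod_ite_eq' Finset.univ, Finset.prod_const,
      Finset.card_univ, Fintype.card_fin, if_pos (Finset.mem_univ _)] at h1
    have h2 : 1 ≤ ∏ i : Fin n, c (Sum.inr i) := by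
      rw [← Finset.prod_const_one (s := Finset.univ (α := Fin n))]
      refine Finset.prod_le_prod (fun i _ => by norm_num) fun i _ => ?_
      simp only [hc, Sum.elim_inr]
      split_ifs <;> linarith
    have h3 : √D < (N : ℝ)⁻¹ ^ n * r := by
      rw [inv_pow, ← div_eq_inv_mul, lt_div_iff₀ (by positivity), hr]
      linarith [mul_comm (√D) ((N : ℝ) ^ n)]
    calc √D < (N : ℝ)⁻¹ ^ n * r := h3
      _ ≤ (∏ i : Fin n, c (Sum.inl i)) := h1
      _ ≤ _ := le_mul_of_one_le_right (Finset.prod_nonneg fun i _ => (hcpos _).le) h2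
  obtain ⟨m, hm0, hm⟩ := exists_int_linearForms_lt A (h.det_ne_zero hV hbR) c hcpos hprod
  set x : V := ∑ t, (m t : ℝ) • (b t : V) with hx
  have hxΛ : x ∈ Λ := Submodule.sum_mem _ fun t _ => by
    rw [Int.cast_smul_eq_zsmul]
    exact Λ.smul_mem _ (b t).2
  have hcoord : ∀ s, |bil ω (Sum.elim e f s) x| < c s := by
    intro s
    convert hm s using 2
    simp [hx, hA, Matrix.mulVec, dotProduct, mul_comm]
  refine ⟨x, hxΛ, fun h0 => hm0 ?_, fun i hi => ⟨?_, ?_⟩, fun i hi => ⟨?_, ?_⟩⟩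
  · ext t
    exact_mod_cast Fintype.linearIndependent_iff.1 hbR _ (hx ▸ h0) t
  · have h1 := hcoord (Sum.inl i)
    simp only [Sum.elim_inl, hc, if_pos hi] at h1
    obtain ⟨p, hp⟩ := hN _ (he i hi) x hxΛ
    have h2 : |(p : ℝ)| < 1 := by
      rw [← hp, abs_mul, abs_of_pos hNpos]
      calc (N : ℝ) * |bil ω (e i) x| < N * (N : ℝ)⁻¹ := mul_lt_mul_of_pos_left h1 hNpos
        _ = 1 := mul_inv_cancel₀ hNpos.ne'
    have h3 : p = 0 := Int.abs_lt_one_iff.1 (by exact_mod_cast h2)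
    rw [h3, Int.cast_zero] at hp
    exact (mul_eq_zero.1 hp).resolve_left hNpos.ne'
  · have h1 := hcoord (Sum.inr i)
    simp only [Sum.elim_inr, hc, if_pos hi] at h1
    rwa [bil_swap, abs_neg]
  · have h1 := hcoord (Sum.inl i)
    simpa only [Sum.elim_inl, hc, if_neg (not_lt.2 hi)] using h1
  · have h1 := hcoord (Sum.inr i)
    simp only [Sum.elim_inr, hc, if_neg (not_lt.2 hi)] at h1
    rwa [bil_swap, abs_neg]

/-- Extension of a primitive isotropic family of lattice vectors by a short vector. -/
theorem exists_primitive_extension {Λ : Submodule ℤ V} [DiscreteTopology Λ] [IsZLattice ℝ Λ]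
    (hV : Module.finrank ℝ V = 2 * n) (b : Module.Basis (Fin n ⊕ Fin n) ℤ Λ)
    {ω : V [⋀^Fin 2]→ₗ[ℝ] ℝ} (hrat : IsRationalOn Λ ω) :
    ∃ r : ℝ, 1 ≤ r ∧ ∀ e f : Fin n → V, IsSymplecticFamily ω e f → ∀ k : Fin n,
      (∀ i < k, e i ∈ Λ) → PrimitiveUpTo Λ e k → ∃ x ∈ Λ,
        (∀ i < k, bil ω (e i) x = 0) ∧
        (∀ i, k ≤ i → |bil ω (e i) x| < r ∧ |bil ω x (f i)| < r) ∧
        (∃ i, k ≤ i ∧ (bil ω (e i) x ≠ 0 ∨ bil ω x (f i) ≠ 0)) ∧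
        PrimitiveUpTo Λ (Function.update e k x) (k + 1) := by
  obtain ⟨r, hr1, hr⟩ := exists_box_bound hV b hrat
  refine ⟨r, hr1, fun e f h k he hprim => ?_⟩
  obtain ⟨x₀, hx₀⟩ := hr e f h k k.2 he
  set S : Set V := {x | x ∈ Λ ∧ x ≠ 0 ∧
        (∀ i : Fin n, (i : ℕ) < k → bil ω (e i) x = 0 ∧ |bil ω x (f i)| < 1) ∧
        ∀ i : Fin n, (k : ℕ) ≤ i → |bil ω (e i) x| < r ∧ |bil ω x (f i)| < r} with hS
  have hfin : S.Finite := by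
    have hK : Bornology.IsBounded {x | x ∈ S} := by
      rw [isBounded_iff_forall_norm_le]
      refine ⟨∑ i, (r * ‖e i‖ + r * ‖f i‖), fun x hx => ?_⟩
      rw [h.expand hV x]
      refine (norm_sum_le _ _).trans (Finset.sum_le_sum fun i _ => (norm_add_le _ _).trans ?_)
      rw [norm_smul, norm_smul, Real.norm_eq_abs, Real.norm_eq_abs]
      have : |bil ω x (f i)| ≤ r ∧ |bil ω (e i) x| ≤ r := by
        by_cases hi : (i : ℕ) < k
        · have := hx.2.2.1 i hi
          rw [this.1, abs_zero]
          exact ⟨this.2.le.trans hr1, by linarith⟩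
        · have := hx.2.2.2 i (not_lt.1 hi)
          exact ⟨this.2.le, this.1.le⟩
      gcongr
      · exact this.1
      · exact this.2
    have hd : IsDiscrete (Λ : Set V) := ⟨inferInstanceAs (DiscreteTopology Λ)⟩
    refine (Metric.finite_isBounded_inter_isClosed hd hK (isClosed_lattice Λ)).subset
      fun x hx => ⟨hx, hx.1⟩
  -- `q` ignores the coordinates below k, so reducing modulo the earlier e_i does not change it. A
  -- minimizer in the finite box will be primitive modulo those vectors.
  set q : V → ℝ := fun x => ∑ i : Fin n, if k ≤ i then bil ω (e i) x ^ 2 + bil ω x (f i) ^ 2 else 0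
    with hq
  obtain ⟨x, hxS, hmin⟩ := Set.exists_min_image S q hfin ⟨x₀, hx₀⟩
  have hqt : ∀ (t : ℝ) (y : V), (∀ i, k ≤ i → bil ω (e i) y = t * bil ω (e i) x ∧
      bil ω y (f i) = t * bil ω x (f i)) → q y = t ^ 2 * q x := by
    intro t y hy
    simp only [hq, Finset.mul_sum]
    refine Finset.sum_congr rfl fun i _ => ?_
    split_ifs with hi
    · rw [(hy i hi).1, (hy i hi).2]; ring
    · simp
  obtain ⟨hxΛ, hx0, hx1, hx2⟩ := id hxS
  -- Otherwise x lies in the span of the earlier e_i. By primitivity its coefficients are integers,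
  -- and they have absolute value below 1, so x = 0.
  have hne : ∃ i, k ≤ i ∧ (bil ω (e i) x ≠ 0 ∨ bil ω x (f i) ≠ 0) := by
    by_contra! hcon
    have hxe : x = ∑ i, bil ω x (f i) • e i := by
      conv_lhs => rw [h.expand hV x]
      refine Finset.sum_congr rfl fun i _ => ?_
      have : bil ω (e i) x = 0 := by
        by_cases hi : (i : ℕ) < k
        · exact (hx1 i hi).1
        · exact (hcon i (not_lt.1 hi)).1
      rw [this, zero_smul, add_zero]
    have hz : ∀ i, bil ω x (f i) = 0 := by
      intro i
      by_cases hi : (i : ℕ) < k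
      · obtain ⟨m, hm⟩ := hprim (fun i => bil ω x (f i)) (fun i hi => (hcon i hi).2)
          (hxe ▸ hxΛ) i
        have h1 := (hx1 i hi).2
        rw [hm] at h1 ⊢
        have : m = 0 := Int.abs_lt_one_iff.1 (by exact_mod_cast h1)
        simp [this]
      · exact (hcon i (not_lt.1 hi)).2
    apply hx0
    rw [hxe]
    simp [hz]
  have hqpos : 0 < q x := by
    obtain ⟨i, hi, hi'⟩ := hne
    refine Finset.sum_pos' (fun j _ => by split_ifs <;> positivity) ⟨i, Finset.mem_univ _, ?_⟩
    rw [if_pos hi]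
    rcases hi' with hi' | hi' <;> positivity
  refine ⟨x, hxΛ, fun i hi => (hx1 i hi).1, fun i hi => hx2 i hi, hne, ?_⟩
  intro c hc hcΛ
  -- Subtracting the nearest integer multiple of x, and then integer multiples of the earlier e_i,
  -- leaves a lattice vector y of the box with q(y) = t² q(x) ≤ q(x)/4. Minimality forces y = 0,
  -- hence t = 0, and then the other coefficients are integers too.
  set z : ℤ := round (c k) with hz
  set t : ℝ := c k - z with ht
  have ht2 : |t| ≤ 1 / 2 := abs_sub_round (c k)
  have hsum : ∑ i, c i • Function.update e k x i =
      c k • x + ∑ i, (if i < k then c i else 0) • e i := by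
    rw [← Finset.add_sum_erase _ _ (Finset.mem_univ k), Function.update_self]
    congr 1
    rw [← Finset.add_sum_erase Finset.univ (fun i => (if i < k then c i else 0) • e i)
      (Finset.mem_univ k), if_neg (lt_irrefl k), zero_smul, zero_add]
    refine Finset.sum_congr rfl fun i hi => ?_
    have hik : i ≠ k := Finset.ne_of_mem_erase hi
    rw [Function.update_of_ne hik]
    split_ifs with h1
    · rfl
    · rw [hc i (Nat.succ_le_of_lt (lt_of_le_of_ne (not_lt.1 h1) hik.symm : k < i))]
  set a : Fin n → ℝ := fun i => if i < k then t * bil ω x (f i) + c i else 0 with ha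
  set y : V := t • x + ∑ i, (if i < k then c i else 0) • e i - ∑ i, (round (a i) : ℝ) • e i with hy
  have hround : ∀ i, ¬ i < k → round (a i) = 0 := fun i hi => by
    simp only [ha, if_neg hi, round_zero]
  have hyΛ : y ∈ Λ := by
    have h1 : y = ∑ i, c i • Function.update e k x i - z • x - ∑ i, round (a i) • e i := by
      rw [hsum, hy, ht, sub_smul, Int.cast_smul_eq_zsmul]
      simp only [Int.cast_smul_eq_zsmul]
      abel
    rw [h1]
    refine Λ.sub_mem (Λ.sub_mem hcΛ (Λ.smul_mem _ hxΛ)) (Λ.sum_mem fun i _ => ?_)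
    by_cases hi : i < k
    · exact Λ.smul_mem _ (he i hi)
    · rw [hround i hi, zero_smul]; exact Λ.zero_mem
  have hye : ∀ i, bil ω (e i) y = t * bil ω (e i) x := by
    intro i
    simp only [hy, map_add, map_sub, map_sum, map_smul, h.bil_ee, smul_eq_mul, mul_zero,
      Finset.sum_const_zero, add_zero, sub_zero]
  have hyf : ∀ i, bil ω y (f i) = t * bil ω x (f i) + (if i < k then c i else 0) - round (a i) := by
    intro i
    simp only [hy, map_add, map_sub, map_sum, map_smul, LinearMap.add_apply, LinearMap.sub_apply,
      LinearMap.sum_apply, LinearMap.smul_apply, h.bil_ef, smul_eq_mul, mul_ite, mul_one, mul_zero,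
      Finset.sum_ite_eq', Finset.mem_univ, if_true]
  have hyf1 : ∀ i, i < k → bil ω y (f i) = a i - round (a i) := fun i hi => by
    rw [hyf, if_pos hi]
    simp [ha, hi]
  have hyf2 : ∀ i, k ≤ i → bil ω y (f i) = t * bil ω x (f i) := fun i hi => by
    rw [hyf, if_neg (not_lt.2 hi), hround i (not_lt.2 hi)]
    simp
  have hqy : q y = t ^ 2 * q x := hqt t y fun i hi => ⟨hye i, hyf2 i hi⟩
  have ht1 : |t| ≤ 1 := ht2.trans (by norm_num)
  have hy0 : y = 0 := by
    by_contra hy0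
    have hyS : y ∈ S := by
      refine ⟨hyΛ, hy0, fun i hi => ⟨?_, ?_⟩, fun i hi => ⟨?_, ?_⟩⟩
      · rw [hye, (hx1 i hi).1, mul_zero]
      · rw [hyf1 i hi]
        exact (abs_sub_round _).trans_lt (by norm_num)
      · rw [hye, abs_mul]
        exact (mul_le_of_le_one_left (abs_nonneg _) ht1).trans_lt (hx2 i hi).1
      · rw [hyf2 i hi, abs_mul]
        exact (mul_le_of_le_one_left (abs_nonneg _) ht1).trans_lt (hx2 i hi).2
    have h1 := hmin y hyS
    rw [hqy] at h1
    have h2 : t ^ 2 ≤ 1 / 4 := by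
      rw [← sq_abs]; nlinarith [abs_nonneg t]
    nlinarith
  have ht0 : t = 0 := by
    have h0 : q y = 0 := by rw [hy0]; simp [hq]
    rw [hqy] at h0
    exact pow_eq_zero_iff two_ne_zero |>.1 ((mul_eq_zero.1 h0).resolve_right hqpos.ne')
  intro i
  rcases lt_trichotomy i k with hi | hi | hi
  · refine ⟨round (a i), ?_⟩
    have h1 := hyf1 i hi
    rw [hy0] at h1
    simp only [map_zero, LinearMap.zero_apply] at h1
    have h2 : a i = c i := by simp [ha, hi, ht0]
    linarith
  · subst hi
    exact ⟨z, by linarith⟩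
  · exact ⟨0, by rw [hc i (Nat.succ_le_of_lt hi)]; simp⟩

end Lattice

/-! ## Unitary frames of a compatible complex structure -/

section Unitary

variable {V : Type*} [AddCommGroup V] [Module ℝ V] {n : ℕ} {ω : V [⋀^Fin 2]→ₗ[ℝ] ℝ}
  {J : V →ₗ[ℝ] V}

theorem IsCompatible.bil_J_J (hJ : IsCompatible ω J) (u v : V) :
    bil ω (J u) (J v) = bil ω u v := hJ.invariant u v

theorem IsCompatible.bil_J_left (hJ : IsCompatible ω J) (u v : V) :
    bil ω (J u) v = -bil ω u (J v) := by
  rw [← hJ.bil_J_J (J u) v, hJ.sq, map_neg, LinearMap.neg_apply]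

theorem IsCompatible.bil_J_symm (hJ : IsCompatible ω J) (u v : V) :
    bil ω u (J v) = bil ω v (J u) := by
  rw [bil_swap, hJ.bil_J_left, neg_neg]

theorem IsSymplecticFamily.bil_sum {e f : Fin n → V} (h : IsSymplecticFamily ω e f)
    (a b c d : Fin n → ℝ) :
    bil ω (∑ i, (a i • e i + b i • f i)) (∑ i, (c i • e i + d i • f i)) =
      ∑ i, (a i * d i - b i * c i) := by
  simp only [map_sum, map_add, map_smul, LinearMap.sum_apply, LinearMap.add_apply,
    LinearMap.smul_apply, h.bil_ee, h.bil_ef, h.bil_fe, h.bil_ff, smul_eq_mul, mul_zero, zero_add,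
    add_zero, mul_ite, mul_one, mul_neg]
  refine Finset.sum_congr rfl fun i _ => ?_
  simp only [Finset.sum_ite_eq', Finset.mem_univ, if_true]
  ring

theorem IsSymplecticFamily.update {e f : Fin n → V} (h : IsSymplecticFamily ω e f) (k : Fin n)
    {a b c d : ℝ} (hdet : a * d - b * c = 1) :
    IsSymplecticFamily ω (Function.update e k (a • e k + b • f k))
      (Function.update f k (c • e k + d • f k)) := by
  have key : ∀ i j, bil ω (Function.update e k (a • e k + b • f k) i)
      (Function.update e k (a • e k + b • f k) j) = 0 ∧
      bil ω (Function.update f k (c • e k + d • f k) i)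
      (Function.update f k (c • e k + d • f k) j) = 0 ∧
      bil ω (Function.update e k (a • e k + b • f k) i)
      (Function.update f k (c • e k + d • f k) j) = if i = j then 1 else 0 := by
    intro i j
    rcases eq_or_ne i k with rfl | hi <;> rcases eq_or_ne j i with rfl | hj
    · refine ⟨bil_self _ _, bil_self _ _, ?_⟩
      simp [h.bil_ef, h.bil_fe]
      linarith
    · simp [Function.update_of_ne hj, h.bil_ef, h.bil_fe, h.bil_ee, h.bil_ff, hj.symm]
    · simp [Function.update_of_ne hi, h.bil_ef, h.bil_ee, h.bil_ff]
    · rcases eq_or_ne j k with rfl | hjk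
      · simp [h.bil_ef, h.bil_fe, h.bil_ee, h.bil_ff, hi]
      · simp [Function.update_of_ne hi, Function.update_of_ne hjk, h.bil_ef, h.bil_ee, h.bil_ff]
  exact ⟨fun i j => (key i j).1, fun i j => (key i j).2.1, fun i j => (key i j).2.2⟩

/-- The first `k` vectors of `u` are orthonormal for the Hermitian form of `(ω, J)`. -/
def UnitaryUpTo (ω : V [⋀^Fin 2]→ₗ[ℝ] ℝ) (J : V →ₗ[ℝ] V) (u : Fin n → V) (k : ℕ) : Prop :=
  ∀ i j : Fin n, i < k → j < k →
    bil ω (u i) (u j) = 0 ∧ bil ω (u i) (J (u j)) = if i = j then 1 else 0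

theorem UnitaryUpTo.isSymplecticFamily (hJ : IsCompatible ω J) {u : Fin n → V}
    (h : UnitaryUpTo ω J u n) : IsSymplecticFamily ω u (J ∘ u) where
  ee i j := (h i j i.2 j.2).1
  ff i j := (hJ.invariant _ _).trans (h i j i.2 j.2).1
  ef i j := (h i j i.2 j.2).2

theorem IsSymplecticFamily.unitaryUpTo {u : Fin n → V} (h : IsSymplecticFamily ω u (J ∘ u))
    (k : ℕ) : UnitaryUpTo ω J u k :=
  fun i j _ _ => ⟨h.ee i j, h.ef i j⟩

theorem UnitaryUpTo.update (hJ : IsCompatible ω J) {u : Fin n → V} {k : Fin n}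
    (h : UnitaryUpTo ω J u k) {w : V} (hw : w ≠ 0) (h0 : ∀ i < k, bil ω (u i) w = 0)
    (h1 : ∀ i < k, bil ω (u i) (J w) = 0) :
    UnitaryUpTo ω J (Function.update u k ((√(bil ω w (J w)))⁻¹ • w)) (k + 1) := by
  have hp : 0 < bil ω w (J w) := hJ.pos w hw
  have hs : √(bil ω w (J w)) ≠ 0 := (Real.sqrt_pos.2 hp).ne'
  intro i j hi hj
  rcases eq_or_ne i k with rfl | hi' <;> rcases eq_or_ne j i with rfl | hj'
  · refine ⟨bil_self _ _, ?_⟩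
    simp only [Function.update_self, map_smul, LinearMap.smul_apply, smul_eq_mul, if_true]
    field_simp
    rw [Real.sq_sqrt hp.le]
  · have hlt : j < i := lt_of_le_of_ne (Nat.lt_succ_iff.1 hj) (by simpa using hj')
    rw [Function.update_self, Function.update_of_ne hj', if_neg hj'.symm]
    refine ⟨?_, ?_⟩
    · rw [bil_swap]
      simp [h0 j hlt]
    · rw [hJ.bil_J_symm]
      simp [h1 j hlt]
  · have hlt : j < k := lt_of_le_of_ne (Nat.lt_succ_iff.1 hi) (by simpa using hi')
    rw [Function.update_of_ne hi']
    exact h _ _ hlt hlt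
  · have hlt : i < k := lt_of_le_of_ne (Nat.lt_succ_iff.1 hi) (by simpa using hi')
    rcases eq_or_ne j k with rfl | hjk
    · rw [Function.update_self, Function.update_of_ne hi', if_neg hi']
      simp [h0 i hlt, h1 i hlt]
    · rw [Function.update_of_ne hi', Function.update_of_ne hjk]
      exact h _ _ hlt (lt_of_le_of_ne (Nat.lt_succ_iff.1 hj) (by simpa [Fin.ext_iff] using hjk))

/-- Hermitian orthogonality to k vectors is 2k real linear equations in dimension 2n. A nonzero
solution exists as long as k < n, and it can be normalized by positivity. -/
theorem UnitaryUpTo.exists_extension [FiniteDimensional ℝ V] (hJ : IsCompatible ω J)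
    (hV : Module.finrank ℝ V = 2 * n) {u : Fin n → V} {k : ℕ} (hk : k ≤ n)
    (h : UnitaryUpTo ω J u k) :
    ∃ u' : Fin n → V, (∀ i : Fin n, i < k → u' i = u i) ∧ IsSymplecticFamily ω u' (J ∘ u') := by
  induction hm : n - k generalizing k u with
  | zero =>
    have : k = n := by omega
    subst this
    exact ⟨u, fun _ _ => rfl, h.isSymplecticFamily hJ⟩
  | succ m ih =>
    have hkn : k < n := by omega
    let T : V →ₗ[ℝ] (Fin k ⊕ Fin k → ℝ) := LinearMap.pi (Sum.elim
      (fun i => bil ω (u (Fin.castLE hk i))) (fun i => (bil ω (u (Fin.castLE hk i))) ∘ₗ J))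
    have hker : LinearMap.ker T ≠ ⊥ := LinearMap.ker_ne_bot_of_finrank_lt (by
      rw [hV, Module.finrank_fintype_fun_eq_card]; simp; omega)
    obtain ⟨w, hw, hw0⟩ := (Submodule.ne_bot_iff _).1 hker
    have hT : ∀ s, T w s = 0 := fun s => congrFun hw s
    obtain ⟨u', hu', hs⟩ := ih (u := Function.update u ⟨k, hkn⟩ ((√(bil ω w (J w)))⁻¹ • w))
      (k := k + 1) hkn
      (UnitaryUpTo.update hJ (k := ⟨k, hkn⟩) h hw0
        (fun i hi => hT (Sum.inl ⟨i, hi⟩)) (fun i hi => hT (Sum.inr ⟨i, hi⟩))) (by omega)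
    refine ⟨u', fun i hi => ?_, hs⟩
    rw [hu' i (by omega), Function.update_of_ne]
    rintro rfl
    exact lt_irrefl _ hi

/-- A frame that is triangular with respect to a unitary frame `u` can be completed to a symplectic
family, using `J u` where it agrees with `u`. -/
theorem exists_dual_of_triangular (hJ : IsCompatible ω J) {u e : Fin n → V}
    (hu : IsSymplecticFamily ω u (J ∘ u)) {p : Fin n → ℝ} (hp : ∀ i, p i ≠ 0)
    (he : ∀ i, e i - p i • u i ∈ Submodule.span ℝ (u '' Set.Iio i)) :
    ∃ f : Fin n → V, IsSymplecticFamily ω e f ∧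
      ∀ j, (∀ i, j ≤ i → e i = u i) → f j = J (u j) := by
  have hspan : ∀ i, e i ∈ Submodule.span ℝ (Set.range u) := fun i => by
    have h1 := Submodule.span_mono (Set.image_subset_range u _) (he i)
    have h2 : p i • u i ∈ Submodule.span ℝ (Set.range u) :=
      Submodule.smul_mem _ _ (Submodule.subset_span ⟨i, rfl⟩)
    simpa using Submodule.add_mem _ h1 h2
  have hiso : ∀ x ∈ Submodule.span ℝ (Set.range u), ∀ y ∈ Submodule.span ℝ (Set.range u),
      bil ω x y = 0 := by
    intro x hx y hy
    induction hx, hy using Submodule.span_induction₂ with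
    | mem_mem x y hx hy =>
      obtain ⟨i, rfl⟩ := hx
      obtain ⟨j, rfl⟩ := hy
      exact hu.bil_ee i j
    | zero_left y hy => simp
    | zero_right x hx => simp
    | add_left x y z hx hy hz h1 h2 => simp [h1, h2]
    | add_right x y z hx hy hz h1 h2 => simp [h1, h2]
    | smul_left r x y hx hy h => simp [h]
    | smul_right r x y hx hy h => simp [h]
  -- P is lower triangular with diagonal p, hence invertible. The columns of P⁻¹ combine the J u_m
  -- into the family dual to e.
  set P : Matrix (Fin n) (Fin n) ℝ := Matrix.of fun i j => bil ω (e i) (J (u j)) with hP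
  have hlow : ∀ i j : Fin n, ∀ x ∈ Submodule.span ℝ (u '' Set.Iio i), i ≤ j →
      bil ω x (J (u j)) = 0 := by
    intro i j x hx hij
    induction hx using Submodule.span_induction with
    | mem x hx =>
      obtain ⟨l, hl, rfl⟩ := hx
      exact (hu.bil_ef l j).trans (if_neg (lt_of_lt_of_le hl hij).ne)
    | zero => simp
    | add x y hx hy h1 h2 => simp [h1, h2]
    | smul r x hx h => simp [h]
  have hPij : ∀ i j, i ≤ j → P i j = if i = j then p i else 0 := by
    intro i j hij
    have h1 := hlow i j _ (he i) hij
    rw [map_sub, LinearMap.sub_apply, map_smul, LinearMap.smul_apply,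
      show bil ω (u i) (J (u j)) = _ from hu.bil_ef i j] at h1
    rw [hP, Matrix.of_apply, sub_eq_zero.1 h1]
    simp
  have hdet : IsUnit P.det := by
    have hlt : P.IsLowerTriangular := fun i j hij => by
      have hij' : i < j := hij
      rw [hPij i j hij'.le, if_neg hij'.ne]
    rw [Matrix.det_of_isLowerTriangular P hlt]
    refine isUnit_iff_ne_zero.2 (Finset.prod_ne_zero_iff.2 fun i _ => ?_)
    rw [hPij i i le_rfl, if_pos rfl]
    exact hp i
  refine ⟨fun j => ∑ m, P⁻¹ m j • J (u m), ⟨fun i j => hiso _ (hspan i) _ (hspan j), fun i j => ?_,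
    fun i j => ?_⟩, fun j hj => ?_⟩
  · change bil ω _ _ = 0
    simp only [map_sum, map_smul, LinearMap.sum_apply, LinearMap.smul_apply]
    refine Finset.sum_eq_zero fun l _ => ?_
    rw [Finset.smul_sum]
    refine Finset.sum_eq_zero fun m _ => ?_
    rw [hJ.bil_J_J, hu.bil_ee, smul_zero, smul_zero]
  · change bil ω _ _ = _
    simp only [map_sum, map_smul, smul_eq_mul]
    have := congrFun (congrFun (Matrix.mul_nonsing_inv P hdet) i) j
    rw [Matrix.mul_apply, Matrix.one_apply] at this
    rw [← this]
    exact Finset.sum_congr rfl fun m _ => mul_comm _ _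
  -- When e agrees with u from j on, column j of P is a standard unit vector, so P⁻¹ has the same
  -- column.
  · have hcol : P.mulVec (Pi.single j 1) = Pi.single j 1 := by
      ext i
      rw [Matrix.mulVec_single_one, Matrix.col_apply]
      rcases lt_or_ge i j with hij | hij
      · rw [hPij i j hij.le, if_neg hij.ne, Pi.single_eq_of_ne hij.ne]
      · rw [hP, Matrix.of_apply, hj i hij, show bil ω (u i) (J (u j)) = _ from hu.bil_ef i j,
          Pi.single_apply]
    have hinv : P⁻¹.mulVec (Pi.single j 1) = Pi.single j 1 := by
      conv_lhs => rw [← hcol]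
      rw [Matrix.mulVec_mulVec, Matrix.nonsing_inv_mul P hdet, Matrix.one_mulVec]
    have hc : ∀ m, P⁻¹ m j = (Pi.single j 1 : Fin n → ℝ) m := fun m => by
      rw [← hinv, Matrix.mulVec_single_one, Matrix.col_apply]
    simp only [hc, Pi.single_apply, ite_smul, one_smul, zero_smul, Finset.sum_ite_eq',
      Finset.mem_univ, if_true]

end Unitary

/-! ## Reduction theory -/

section Reduction

variable {V : Type*} [NormedAddCommGroup V] [NormedSpace ℝ V] {n : ℕ}

/-- The first `k` vectors of `v` form a primitive isotropic family of vectors of `Λ` whose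
orthogonalization with respect to the Hermitian form of `(ω, J)` consists of multiples of the
unitary vectors `u i` of length at most `ρ`. -/
structure ReducedUpTo (Λ : Submodule ℤ V) (ω : V [⋀^Fin 2]→ₗ[ℝ] ℝ) (J : V →ₗ[ℝ] V) (ρ : ℝ)
    (u v : Fin n → V) (k : ℕ) : Prop where
  unitary : UnitaryUpTo ω J u k
  mem : ∀ i : Fin n, i < k → v i ∈ Λ
  triangular : ∀ i : Fin n, i < k → ∃ p : ℝ, 0 < p ∧ p ≤ ρ ∧
    v i - p • u i ∈ Submodule.span ℝ (u '' Set.Iio i)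
  primitive : PrimitiveUpTo Λ v k

theorem PrimitiveUpTo.congr {Λ : Submodule ℤ V} {v w : Fin n → V} {k : ℕ}
    (h : PrimitiveUpTo Λ v k) (hvw : ∀ i : Fin n, i < k → v i = w i) : PrimitiveUpTo Λ w k := by
  intro c hc hcΛ
  refine h c hc ?_
  convert hcΛ using 2 with i
  by_cases hi : (i : ℕ) < k
  · rw [hvw i hi]
  · rw [hc i (not_lt.1 hi), zero_smul, zero_smul]

theorem ReducedUpTo.congr {Λ : Submodule ℤ V} {ω : V [⋀^Fin 2]→ₗ[ℝ] ℝ} {J : V →ₗ[ℝ] V} {ρ : ℝ}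
    {u v u' v' : Fin n → V} {k : ℕ} (h : ReducedUpTo Λ ω J ρ u v k)
    (hu : ∀ i : Fin n, i < k → u i = u' i) (hv : ∀ i : Fin n, i < k → v i = v' i) :
    ReducedUpTo Λ ω J ρ u' v' k where
  unitary i j hi hj := by
    rw [← hu i hi, ← hu j hj]
    exact h.unitary i j hi hj
  mem i hi := hv i hi ▸ h.mem i hi
  triangular i hi := by
    obtain ⟨p, hp, hpρ, hspan⟩ := h.triangular i hi
    refine ⟨p, hp, hpρ, ?_⟩
    rw [← hu i hi, ← hv i hi]
    have : u' '' Set.Iio i = u '' Set.Iio i :=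
      Set.image_congr fun j hj => (hu j (lt_trans (show (j : ℕ) < i from hj) hi)).symm
    rwa [this]
  primitive := h.primitive.congr hv

/-- The symplectic family completing a reduced family `v`: it is `v` up to `k` and `(u, J u)` from
`k` on. -/
theorem ReducedUpTo.exists_symplecticFamily {Λ : Submodule ℤ V} {ω : V [⋀^Fin 2]→ₗ[ℝ] ℝ}
    {J : V →ₗ[ℝ] V} (hJ : IsCompatible ω J) {ρ : ℝ} {u v : Fin n → V} {k : Fin n}
    (h : ReducedUpTo Λ ω J ρ u v k) (hu : IsSymplecticFamily ω u (J ∘ u)) :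
    ∃ e f : Fin n → V, IsSymplecticFamily ω e f ∧ (∀ i < k, e i = v i) ∧
      (∀ i, k ≤ i → e i = u i) ∧ ∀ i, k ≤ i → f i = J (u i) := by
  have hp : ∀ i : Fin n, ∃ p : ℝ, p ≠ 0 ∧ (if i < k then v i else u i) - p • u i ∈
      Submodule.span ℝ (u '' Set.Iio i) := by
    intro i
    by_cases hi : i < k
    · obtain ⟨p, hp, -, hs⟩ := h.triangular i hi
      exact ⟨p, hp.ne', by rwa [if_pos hi]⟩
    · exact ⟨1, one_ne_zero, by rw [if_neg hi]; simp⟩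
  choose p hp0 hps using hp
  obtain ⟨f, hf, hf'⟩ := exists_dual_of_triangular hJ hu hp0 hps
  refine ⟨_, f, hf, fun i hi => if_pos hi, fun i hi => if_neg (not_lt.2 hi), fun i hi =>
    hf' i fun l hl => if_neg (not_lt.2 (hi.trans hl))⟩

theorem ReducedUpTo.span_le {Λ : Submodule ℤ V} {ω : V [⋀^Fin 2]→ₗ[ℝ] ℝ}
    {J : V →ₗ[ℝ] V} {ρ : ℝ} {u v : Fin n → V} {k : Fin n}
    (h : ReducedUpTo Λ ω J ρ u v k) {i : Fin n} (hi : i < k) :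
    v i ∈ Submodule.span ℝ (u '' Set.Iio k) := by
  obtain ⟨p, -, -, hs⟩ := h.triangular i hi
  have h1 := Submodule.span_mono (Set.image_mono (Set.Iio_subset_Iio hi.le)) hs
  have h2 : p • u i ∈ Submodule.span ℝ (u '' Set.Iio k) :=
    Submodule.smul_mem _ _ (Submodule.subset_span ⟨i, hi, rfl⟩)
  simpa using Submodule.add_mem _ h1 h2

variable [FiniteDimensional ℝ V]

/-- Induction on k. The vectors found so far, continued by (u, J u) from index k on, form part of a
symplectic family, and the short extension vector x for it is the next lattice vector. The next
unitary vector is the normalized component w of x in the span of the u_i and J u_i with i ≥ k. Only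
the frames depend on J; the constant does not. -/
theorem exists_reducedUpTo {Λ : Submodule ℤ V} [DiscreteTopology Λ] [IsZLattice ℝ Λ]
    (hV : Module.finrank ℝ V = 2 * n) (b : Module.Basis (Fin n ⊕ Fin n) ℤ Λ)
    {ω : V [⋀^Fin 2]→ₗ[ℝ] ℝ} (hrat : IsRationalOn Λ ω) :
    ∃ ρ : ℝ, 1 ≤ ρ ∧ ∀ J : V →ₗ[ℝ] V, IsCompatible ω J → ∀ k ≤ n, ∃ u v : Fin n → V,
      IsSymplecticFamily ω u (J ∘ u) ∧ ReducedUpTo Λ ω J ρ u v k := by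
  obtain ⟨r, hr1, hr⟩ := exists_primitive_extension hV b hrat
  -- The component w has at most 2n coordinates, each below r in absolute value.
  refine ⟨√(n * (2 * r ^ 2)) + 1, le_add_of_nonneg_left (Real.sqrt_nonneg _), fun J hJ k => ?_⟩
  induction k with
  | zero =>
    intro _
    obtain ⟨u, -, hu⟩ := UnitaryUpTo.exists_extension hJ hV (u := fun _ => 0) (Nat.zero_le n)
      (fun i j hi => absurd hi (Nat.not_lt_zero _))
    refine ⟨u, u, hu, ⟨hu.unitaryUpTo 0, fun i hi => absurd hi (Nat.not_lt_zero _),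
      fun i hi => absurd hi (Nat.not_lt_zero _), fun c hc _ i => ⟨0, by simp [hc i]⟩⟩⟩
  | succ k ih =>
    intro hk
    obtain ⟨u, v, hu, h⟩ := ih (Nat.le_of_succ_le hk)
    set κ : Fin n := ⟨k, hk⟩ with hκ
    obtain ⟨e, f, hef, hev, heu, hfu⟩ := ReducedUpTo.exists_symplecticFamily hJ (k := κ) h hu
    obtain ⟨x, hxΛ, hx0, hxr, hxne, hprim⟩ := hr e f hef κ
      (fun i hi => (hev i hi).symm ▸ h.mem i hi)
      (h.primitive.congr fun i hi => (hev i hi).symm)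
    set α : Fin n → ℝ := fun i => if κ ≤ i then bil ω x (f i) else 0 with hα
    set β : Fin n → ℝ := fun i => if κ ≤ i then bil ω (e i) x else 0 with hβ
    set w : V := ∑ i, (α i • u i + β i • J (u i)) with hw
    have hJw : J w = ∑ i, ((-β i) • u i + α i • J (u i)) := by
      simp only [hw, map_sum, map_add, map_smul, hJ.sq]
      refine Finset.sum_congr rfl fun i _ => ?_
      rw [smul_neg, neg_smul, add_comm]
    have hww : bil ω w (J w) = ∑ i, (α i ^ 2 + β i ^ 2) := by
      rw [hJw, hw]
      have := hu.bil_sum α β (-β) α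
      refine this.trans (Finset.sum_congr rfl fun i _ => ?_)
      simp only [Pi.neg_apply]; ring
    -- Since ω(e_i, x) = 0 for i < κ, x has no f_i-component there. What remains beside w is a
    -- combination of earlier v_i, which lie in the span of the earlier u_i.
    have hxw : x - w ∈ Submodule.span ℝ (u '' Set.Iio κ) := by
      have hx : x - w = ∑ i, if i < κ then bil ω x (f i) • v i else 0 := by
        conv_lhs => rw [hef.expand hV x, hw, ← Finset.sum_sub_distrib]
        refine Finset.sum_congr rfl fun i _ => ?_
        by_cases hi : i < κ
        · have hni : ¬ κ ≤ i := not_le.2 hi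
          rw [hx0 i hi, hev i hi]
          simp [hα, hβ, hi, hni]
        · have hni : κ ≤ i := not_lt.1 hi
          simp [hα, hβ, hi, hni, heu i hni, hfu i hni]
      rw [hx]
      refine Submodule.sum_mem _ fun i _ => ?_
      split_ifs with hi
      · exact Submodule.smul_mem _ _ (ReducedUpTo.span_le (k := κ) h hi)
      · exact Submodule.zero_mem _
    have hpos : 0 < bil ω w (J w) := by
      rw [hww]
      obtain ⟨i, hi, hi'⟩ := hxne
      refine Finset.sum_pos' (fun i _ => by positivity) ⟨i, Finset.mem_univ _, ?_⟩
      simp only [hα, hβ, if_pos hi]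
      rcases hi' with hi' | hi' <;> positivity
    have hw0 : w ≠ 0 := by rintro h0; rw [h0] at hpos; simp at hpos
    set p := √(bil ω w (J w)) with hp
    have hp0 : 0 < p := Real.sqrt_pos.2 hpos
    have hpr : p ≤ √(n * (2 * r ^ 2)) := by
      refine Real.sqrt_le_sqrt ?_
      rw [hww]
      calc ∑ i, (α i ^ 2 + β i ^ 2) ≤ ∑ i : Fin n, 2 * r ^ 2 := by
            refine Finset.sum_le_sum fun i _ => ?_
            simp only [hα, hβ]
            split_ifs with hi
            · have h1 := sq_le_sq' (abs_lt.1 (hxr i hi).1).1.le (abs_lt.1 (hxr i hi).1).2.le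
              have h2 := sq_le_sq' (abs_lt.1 (hxr i hi).2).1.le (abs_lt.1 (hxr i hi).2).2.le
              linarith
            · have := sq_nonneg r
              simp only [ne_eq, OfNat.ofNat_ne_zero, not_false_eq_true, zero_pow, add_zero]
              linarith
        _ = n * (2 * r ^ 2) := by simp
    have hw1 : ∀ i < κ, bil ω (u i) w = 0 := by
      intro i hi
      have hni : ¬ κ ≤ i := not_le.2 hi
      simp only [hw, map_sum, map_add, map_smul, hu.bil_ee,
        show ∀ j, bil ω (u i) (J (u j)) = _ from hu.bil_ef i]
      simp [hβ, hni]
    have hw2 : ∀ i < κ, bil ω (u i) (J w) = 0 := by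
      intro i hi
      have hni : ¬ κ ≤ i := not_le.2 hi
      simp only [hJw, map_sum, map_add, map_smul, hu.bil_ee,
        show ∀ j, bil ω (u i) (J (u j)) = _ from hu.bil_ef i]
      simp [hα, hni]
    have hun := UnitaryUpTo.update hJ (k := κ) h.unitary hw0 hw1 hw2
    obtain ⟨u', hu', hs⟩ := UnitaryUpTo.exists_extension hJ hV hk hun
    have hold : ∀ i : Fin n, i < k → u' i = u i := fun i hi => by
      rw [hu' i (Nat.lt_succ_of_lt hi), Function.update_of_ne (ne_of_lt (show i < κ from hi))]
    have hvx : ∀ i : Fin n, i < k → Function.update v κ x i = v i := fun i hi => by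
      rw [Function.update_of_ne (ne_of_lt (show i < κ from hi))]
    have h' := h.congr (fun i hi => (hold i hi).symm) (fun i hi => (hvx i hi).symm)
    refine ⟨u', Function.update v κ x, hs, ⟨hs.unitaryUpTo _, fun i hi => ?_, fun i hi => ?_, ?_⟩⟩
    · rcases Nat.lt_succ_iff_lt_or_eq.1 hi with hi | hi
      · exact h'.mem i hi
      · rw [show i = κ from Fin.ext hi, Function.update_self]; exact hxΛ
    · rcases Nat.lt_succ_iff_lt_or_eq.1 hi with hi | hi
      · obtain ⟨q, hq, hqr, hqs⟩ := h'.triangular i hi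
        exact ⟨q, hq, hqr, hqs⟩
      · obtain rfl : i = κ := Fin.ext hi
        refine ⟨p, hp0, by linarith, ?_⟩
        have himg : u' '' Set.Iio κ = u '' Set.Iio κ :=
          Set.image_congr fun j hj => hold j hj
        rw [himg, Function.update_self, hu' κ (Nat.lt_succ_self k), Function.update_self, smul_smul,
          mul_inv_cancel₀ hp0.ne', one_smul]
        exact hxw
    · refine hprim.congr fun i hi => ?_
      rcases eq_or_ne i κ with rfl | hik
      · simp
      · rw [Function.update_of_ne hik, Function.update_of_ne hik]
        exact hev i (lt_of_le_of_ne (Nat.lt_succ_iff.1 hi : i ≤ κ) hik)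

/-- The last vector of a reduced Lagrangian family can be chosen to be short with respect to any
unimodular basis `ζ₁, ζ₂` of the complex line of the last unitary vector. -/
theorem exists_last_vector {Λ : Submodule ℤ V} [DiscreteTopology Λ] [IsZLattice ℝ Λ]
    (hV : Module.finrank ℝ V = 2 * n) (b : Module.Basis (Fin n ⊕ Fin n) ℤ Λ)
    {ω : V [⋀^Fin 2]→ₗ[ℝ] ℝ} (hrat : IsRationalOn Λ ω) :
    ∃ r : ℝ, 1 ≤ r ∧ ∀ J : V →ₗ[ℝ] V, IsCompatible ω J → ∀ (ρ : ℝ) (u v : Fin n → V),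
      IsSymplecticFamily ω u (J ∘ u) → ∀ k : Fin n, (∀ i, i ≤ k) → ReducedUpTo Λ ω J ρ u v k →
      ∀ ζ₁ ζ₂ : ℂ, ζ₁.re * ζ₂.im - ζ₁.im * ζ₂.re = 1 → ∃ x ∈ Λ, ∃ a c : ℝ,
        |a| < r ∧ |c| < r ∧ (a ≠ 0 ∨ c ≠ 0) ∧
        x - ((a * ζ₁ + c * ζ₂).re • u k + (a * ζ₁ + c * ζ₂).im • J (u k)) ∈
          Submodule.span ℝ (u '' Set.Iio k) ∧
        PrimitiveUpTo Λ (Function.update v k x) n := by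
  obtain ⟨r, hr1, hr⟩ := exists_primitive_extension hV b hrat
  refine ⟨r, hr1, fun J hJ ρ u v hu k hk h ζ₁ ζ₂ hζ => ?_⟩
  obtain ⟨e, f, hef, hev, heu, hfu⟩ := h.exists_symplecticFamily hJ hu
  -- A unimodular change of the pair (e_k, f_k) keeps the family symplectic, so the same `r` bounds
  -- the coordinates with respect to ζ₁, ζ₂, however eccentric that basis is.
  have hef' := hef.update k hζ
  set e' := Function.update e k (ζ₁.re • e k + ζ₁.im • f k) with he'
  set f' := Function.update f k (ζ₂.re • e k + ζ₂.im • f k) with hf'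
  have hev' : ∀ i < k, e' i = v i := fun i hi => by
    rw [he', Function.update_of_ne hi.ne, hev i hi]
  obtain ⟨x, hxΛ, hx0, hxr, ⟨l, hl, hlne⟩, hprim⟩ := hr e' f' hef' k
    (fun i hi => (hev' i hi).symm ▸ h.mem i hi)
    (h.primitive.congr fun i hi => (hev' i hi).symm)
  obtain rfl : l = k := le_antisymm (hk l) hl
  refine ⟨x, hxΛ, bil ω x (f' l), bil ω (e' l) x, (hxr l le_rfl).2, (hxr l le_rfl).1, hlne.symm,
    ?_, ?_⟩
  · have hx : x - ((bil ω x (f' l) * ζ₁ + bil ω (e' l) x * ζ₂ : ℂ).re • u l +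
        (bil ω x (f' l) * ζ₁ + bil ω (e' l) x * ζ₂ : ℂ).im • J (u l)) =
        ∑ i ∈ Finset.univ.erase l, bil ω x (f' i) • v i := by
      have hx' := hef'.expand hV x
      rw [← Finset.add_sum_erase _ _ (Finset.mem_univ l)] at hx'
      have h1 : bil ω x (f' l) • e' l + bil ω (e' l) x • f' l -
          ((bil ω x (f' l) * ζ₁ + bil ω (e' l) x * ζ₂ : ℂ).re • u l +
          (bil ω x (f' l) * ζ₁ + bil ω (e' l) x * ζ₂ : ℂ).im • J (u l)) = 0 := by
        have h2 : e' l = ζ₁.re • u l + ζ₁.im • J (u l) := by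
          rw [he', Function.update_self, heu l le_rfl, hfu l le_rfl]
        have h3 : f' l = ζ₂.re • u l + ζ₂.im • J (u l) := by
          rw [hf', Function.update_self, heu l le_rfl, hfu l le_rfl]
        generalize bil ω x (f' l) = s
        generalize bil ω (e' l) x = t
        rw [h2, h3]
        simp only [Complex.add_re, Complex.add_im, Complex.re_ofReal_mul, Complex.im_ofReal_mul]
        module
      rw [← sub_eq_zero.1 h1, sub_eq_iff_eq_add']
      refine hx'.trans (congrArg _ (Finset.sum_congr rfl fun i hi => ?_))
      have hil : i < l := lt_of_le_of_ne (hk i) (Finset.ne_of_mem_erase hi)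
      rw [hx0 i hil, hev' i hil, zero_smul, add_zero]
    rw [hx]
    refine Submodule.sum_mem _ fun i hi => Submodule.smul_mem _ _ (h.span_le
      (lt_of_le_of_ne (hk i) (Finset.ne_of_mem_erase hi)))
  · have hn : n = (l : ℕ) + 1 := by
      have h1 := hk ⟨n - 1, by have := l.2; omega⟩
      have h2 := l.2
      rw [Fin.le_def] at h1
      simp only at h1
      omega
    have h3 := hprim.congr (w := Function.update v l x) fun i hi => by
      rcases eq_or_ne i l with rfl | hik
      · simp
      · rw [Function.update_of_ne hik, Function.update_of_ne hik]
        exact hev' i (lt_of_le_of_ne (hk i) hik)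
    rwa [← hn] at h3

end Reduction

/-! ## Evaluation of wedge products -/

section Wedge

variable {V : Type*} [AddCommGroup V] [Module ℝ V] {A : Type*} [CommRing A] [Algebra ℝ A]

/-- For alternatizations the shuffle sum unfolds into a sum over all permutations without
factorials. An alternating form has its own alternatization equal to k! times itself, which explains
the factor in `factorial_smul_wedge_apply`. -/
theorem wedge_apply_alternatization {k l : ℕ} (a : MultilinearMap ℝ (fun _ : Fin k => V) A)
    (b : MultilinearMap ℝ (fun _ : Fin l => V) A) (v : Fin (k + l) → V) :
    wedge (MultilinearMap.alternatization a) (MultilinearMap.alternatization b) v =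
      ∑ σ : Equiv.Perm (Fin k ⊕ Fin l), Equiv.Perm.sign σ •
        (a (fun i => v (finSumFinEquiv (σ (Sum.inl i)))) *
          b (fun j => v (finSumFinEquiv (σ (Sum.inr j))))) := by
  rw [wedge, ← MultilinearMap.domCoprod_alternization]
  simp only [AlternatingMap.domDomCongr_apply, LinearMap.compAlternatingMap_apply,
    MultilinearMap.alternatization_apply, map_sum]
  refine Finset.sum_congr rfl fun σ _ => ?_
  rw [Units.smul_def, Units.smul_def, map_zsmul]
  rfl

theorem factorial_smul_wedge_apply {k l : ℕ} (a : V [⋀^Fin k]→ₗ[ℝ] A) (b : V [⋀^Fin l]→ₗ[ℝ] A)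
    (v : Fin (k + l) → V) :
    (k.factorial * l.factorial) • wedge a b v =
      ∑ σ : Equiv.Perm (Fin k ⊕ Fin l), Equiv.Perm.sign σ •
        (a (fun i => v (finSumFinEquiv (σ (Sum.inl i)))) *
          b (fun j => v (finSumFinEquiv (σ (Sum.inr j))))) := by
  have h := MultilinearMap.domCoprod_alternization_eq a b
  rw [Fintype.card_fin, Fintype.card_fin] at h
  have h1 := congrArg (fun F => LinearMap.mul' ℝ A (F (v ∘ finSumFinEquiv))) h
  simp only [AlternatingMap.smul_apply, map_nsmul] at h1
  rw [wedge, AlternatingMap.domDomCongr_apply, LinearMap.compAlternatingMap_apply]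
  refine h1.symm.trans ?_
  simp only [MultilinearMap.alternatization_apply, map_sum]
  refine Finset.sum_congr rfl fun σ _ => ?_
  rw [Units.smul_def, Units.smul_def, map_zsmul]
  rfl

end Wedge

/-! ## The sign of the symplectic volume -/

section Sign

variable {V : Type*} [AddCommGroup V] [Module ℝ V]

/-- The equivalence `Fin (2 * n) ≃ Fin n ⊕ Fin n` listing the left summand first. -/
def blockEquiv (n : ℕ) : Fin (2 * n) ≃ Fin n ⊕ Fin n :=
  (finCongr (two_mul n)).trans finSumFinEquiv.symm

/-- The family `e₁, …, eₙ, f₁, …, fₙ`. -/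
def blockFamily {n : ℕ} (e f : Fin n → V) : Fin (2 * n) → V := Sum.elim e f ∘ blockEquiv n

@[simp] theorem val_blockEquiv_symm_inl {n : ℕ} (i : Fin n) :
    (((blockEquiv n).symm (Sum.inl i) : Fin (2 * n)) : ℕ) = i := by
  simp [blockEquiv]

@[simp] theorem val_blockEquiv_symm_inr {n : ℕ} (i : Fin n) :
    (((blockEquiv n).symm (Sum.inr i) : Fin (2 * n)) : ℕ) = n + i := by
  simp [blockEquiv, add_comm]

/-- The labelling of `Fin (2 * n) ⊕ Fin 2` that lists the last pair separately. -/
def lastPairMap (n : ℕ) : Fin (2 * n) ⊕ Fin 2 → Fin (n + 1) ⊕ Fin (n + 1) :=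
  Sum.elim (Sum.map Fin.castSucc Fin.castSucc ∘ blockEquiv n)
    ![Sum.inl (Fin.last n), Sum.inr (Fin.last n)]

/-- The orders e₁…eₙ f₁…fₙ e₍ₙ₊₁₎ f₍ₙ₊₁₎ and e₁…e₍ₙ₊₁₎ f₁…f₍ₙ₊₁₎ differ by moving e₍ₙ₊₁₎ past n
vectors. The resulting sign (-1)ⁿ drives the induction for the sign of ωⁿ. -/
theorem lastPairMap_comp (n : ℕ) (s : Fin (2 * n) ⊕ Fin 2) :
    lastPairMap n s = blockEquiv (n + 1)
      (Fin.cycleIcc (n := 2 * n + 2) ⟨n, by omega⟩ ⟨2 * n, by omega⟩ (finSumFinEquiv s)) := by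
  rw [← Equiv.symm_apply_eq]
  rcases s with s | s
  · obtain ⟨t, rfl⟩ := (blockEquiv n).symm.surjective s
    rcases t with i | i
    · rw [Fin.cycleIcc_of_lt]
      · apply Fin.ext
        simp [lastPairMap]
      · simp [Fin.lt_def]
    · rw [Fin.cycleIcc_of_ge_of_lt]
      · apply Fin.ext
        rw [Fin.val_add_one_of_lt']
        · simp [lastPairMap]; omega
        · simp; omega
      · simp [Fin.le_def]
      · simp [Fin.lt_def]; omega
  · fin_cases s
    · have : finSumFinEquiv (Sum.inr ((fun i => i) ⟨0, by omega⟩) : Fin (2 * n) ⊕ Fin 2) =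
        (⟨2 * n, by omega⟩ : Fin (2 * n + 2)) := Fin.ext (by simp)
      rw [this, Fin.cycleIcc_of_last (Fin.le_def.2 (by simp; omega))]
      apply Fin.ext
      simp [lastPairMap]
    · rw [Fin.cycleIcc_of_gt]
      · apply Fin.ext
        simp [lastPairMap]; omega
      · simp [Fin.lt_def]

theorem lastPairMap_injective (n : ℕ) : Function.Injective (lastPairMap n) := by
  have : lastPairMap n = blockEquiv (n + 1) ∘
      (Fin.cycleIcc (n := 2 * n + 2) ⟨n, by omega⟩ ⟨2 * n, by omega⟩) ∘ finSumFinEquiv :=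
    funext (lastPairMap_comp n)
  rw [this]
  exact (blockEquiv (n + 1)).injective.comp ((Equiv.injective _).comp (Equiv.injective _))

/-- The labelling `lastPairMap` as an equivalence. -/
noncomputable def lastPairEquiv (n : ℕ) : Fin (2 * n) ⊕ Fin 2 ≃ Fin (n + 1) ⊕ Fin (n + 1) :=
  Equiv.ofBijective (lastPairMap n)
    ((Fintype.bijective_iff_injective_and_card _).2 ⟨lastPairMap_injective n, by simp; omega⟩)

theorem lastPairEquiv_apply (n : ℕ) (s : Fin (2 * n) ⊕ Fin 2) :
    lastPairEquiv n s = lastPairMap n s := rfl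

variable {ω : V [⋀^Fin 2]→ₗ[ℝ] ℝ}

theorem IsSymplecticFamily.comp {n m : ℕ} {e f : Fin n → V} (h : IsSymplecticFamily ω e f)
    {φ : Fin m → Fin n} (hφ : Function.Injective φ) :
    IsSymplecticFamily ω (e ∘ φ) (f ∘ φ) where
  ee i j := h.ee _ _
  ff i j := h.ff _ _
  ef i j := by simpa [hφ.eq_iff] using h.ef (φ i) (φ j)

/-- The summand of `ω^n ∧ ω` belonging to a permutation has the expected sign. -/
theorem IsSymplecticFamily.wedgePow_term_nonneg {n : ℕ} {t : ℝ}
    (ih : ∀ e f : Fin n → V, IsSymplecticFamily ω e f → 0 < t * wedgePow ω n (blockFamily e f))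
    {e f : Fin (n + 1) → V} (h : IsSymplecticFamily ω e f)
    (σ : Equiv.Perm (Fin (2 * n) ⊕ Fin 2)) :
    0 ≤ t * (Equiv.Perm.sign σ •
      (wedgePow ω n (fun i => (Sum.elim e f ∘ lastPairEquiv n) (σ (Sum.inl i))) *
        ω (fun j => (Sum.elim e f ∘ lastPairEquiv n) (σ (Sum.inr j))))) := by
  set y := Sum.elim e f ∘ lastPairEquiv n with hy
  by_cases h0 : ω (fun j => y (σ (Sum.inr j))) = 0
  · simp [h0]
  -- A nonzero factor ω must pair some e_i with its own f_i.
  obtain ⟨i, hi⟩ : ∃ i : Fin (n + 1), ∀ j : Fin 2,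
      lastPairEquiv n (σ (Sum.inr j)) = Sum.inl i ∨
      lastPairEquiv n (σ (Sum.inr j)) = Sum.inr i := by
    have h0' : bil ω (Sum.elim e f (lastPairEquiv n (σ (Sum.inr 0))))
        (Sum.elim e f (lastPairEquiv n (σ (Sum.inr 1)))) ≠ 0 := by
      convert h0 using 2
      rw [bil_apply]
      congr 1
      ext j
      fin_cases j <;> rfl
    rcases h1 : lastPairEquiv n (σ (Sum.inr 0)) with a | a <;>
    rcases h2 : lastPairEquiv n (σ (Sum.inr 1)) with c | c <;>
    simp only [h1, h2, Sum.elim_inl, Sum.elim_inr, h.bil_ee, h.bil_ff, h.bil_ef, h.bil_fe, ne_eq,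
      not_true_eq_false, ite_eq_right_iff, one_ne_zero, neg_eq_zero, imp_false, not_not] at h0'
    · subst h0'
      refine ⟨a, fun j => ?_⟩
      fin_cases j
      · exact Or.inl h1
      · exact Or.inr h2
    · subst h0'
      refine ⟨a, fun j => ?_⟩
      fin_cases j
      · exact Or.inr h1
      · exact Or.inl h2
  -- Swapping i with the last index in both the e's and the f's is an even permutation. It reduces σ
  -- to a block permutation (τ, ε), whose sign cancels against the signs produced by the two
  -- alternating factors.
  set sw : Equiv.Perm (Fin (n + 1)) := Equiv.swap i (Fin.last n) with hsw
  set κ' : Equiv.Perm (Fin (n + 1) ⊕ Fin (n + 1)) := Equiv.sumCongr sw sw with hκ'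
  set κ : Equiv.Perm (Fin (2 * n) ⊕ Fin 2) := (lastPairEquiv n).symm.permCongr κ' with hκ
  have hκsign : Equiv.Perm.sign κ = 1 := by
    rw [hκ, Equiv.Perm.sign_permCongr, hκ', Equiv.Perm.sign_sumCongr, Int.units_mul_self]
  have hκκ : ∀ s, κ (κ s) = s := by
    intro s
    rcases hs : lastPairEquiv n s with c | c <;>
    simp [hκ, hκ', Equiv.permCongr_apply, hs, hsw, (Equiv.symm_apply_eq (lastPairEquiv n)).2 hs.symm]
  have hmaps : Set.MapsTo (κ * σ) (Set.range Sum.inr) (Set.range Sum.inr) := by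
    rintro _ ⟨j, rfl⟩
    rw [Equiv.Perm.mul_apply, hκ, Equiv.permCongr_apply, Equiv.symm_symm]
    rcases hi j with hj | hj
    · refine ⟨0, ?_⟩
      rw [hj, hκ', Equiv.sumCongr_apply, Sum.map_inl, hsw, Equiv.swap_apply_left,
        Equiv.eq_symm_apply]
      rfl
    · refine ⟨1, ?_⟩
      rw [hj, hκ', Equiv.sumCongr_apply, Sum.map_inr, hsw, Equiv.swap_apply_left,
        Equiv.eq_symm_apply]
      rfl
  obtain ⟨⟨τ, ε⟩, hτε⟩ := Equiv.Perm.mem_sumCongrHom_range_of_perm_mapsTo_inl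
    ((Equiv.Perm.perm_mapsTo_inl_iff_mapsTo_inr _).2 hmaps)
  rw [Equiv.Perm.sumCongrHom_apply] at hτε
  have hσ : ∀ s, σ s = κ (Equiv.sumCongr τ ε s) := by
    intro s
    have := congrArg (fun p : Equiv.Perm (Fin (2 * n) ⊕ Fin 2) => κ (p s)) hτε
    simpa [hκκ] using this.symm
  have hsign : Equiv.Perm.sign σ = Equiv.Perm.sign τ * Equiv.Perm.sign ε := by
    have h1 := congrArg Equiv.Perm.sign hτε
    rw [Equiv.Perm.sign_mul, hκsign, one_mul] at h1
    rw [← h1]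
    exact Equiv.Perm.sign_sumCongr τ ε
  have hyκ : ∀ s, y (κ s) = (Sum.elim (e ∘ sw) (f ∘ sw)) (lastPairEquiv n s) := by
    intro s
    simp only [hy, hκ, Function.comp_apply, Equiv.permCongr_apply, Equiv.symm_symm,
      Equiv.apply_symm_apply, hκ']
    rcases lastPairEquiv n s with c | c <;> rfl
  have hl : (fun p => y (σ (Sum.inl p))) =
      blockFamily (e ∘ sw ∘ Fin.castSucc) (f ∘ sw ∘ Fin.castSucc) ∘ τ := by
    ext p
    rw [hσ, Equiv.sumCongr_apply, Sum.map_inl, hyκ, lastPairEquiv_apply]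
    simp only [lastPairMap, Sum.elim_inl, Function.comp_apply, blockFamily]
    rcases blockEquiv n (τ p) with c | c <;> rfl
  have hr : (fun p => y (σ (Sum.inr p))) = ![e i, f i] ∘ ε := by
    ext p
    rw [hσ, Equiv.sumCongr_apply, Sum.map_inr, hyκ, lastPairEquiv_apply]
    simp only [Function.comp_apply]
    generalize ε p = q
    fin_cases q <;> simp [lastPairMap, hsw]
  rw [hl, hr, AlternatingMap.map_perm, AlternatingMap.map_perm, hsign]
  have hω : ω ![e i, f i] = 1 := by simpa using h.ef i i
  have h1 := ih _ _ (h.comp (sw.injective.comp (Fin.castSucc_injective n)))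
  rw [hω]
  rcases Int.units_eq_one_or (Equiv.Perm.sign τ) with h2 | h2 <;>
  rcases Int.units_eq_one_or (Equiv.Perm.sign ε) with h3 | h3 <;>
  simpa [h2, h3] using h1.le

theorem IsSymplecticFamily.wedgePow_pos {n : ℕ} {e f : Fin n → V}
    (h : IsSymplecticFamily ω e f) :
    0 < (-1 : ℝ) ^ (n * (n - 1) / 2) * wedgePow ω n (blockFamily e f) := by
  induction n with
  | zero => simp [wedgePow]
  | succ n ih =>
    set y := Sum.elim e f ∘ lastPairEquiv n with hy
    set ρ := Fin.cycleIcc (n := 2 * n + 2) ⟨n, by omega⟩ ⟨2 * n, by omega⟩ with hρ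
    have hv : blockFamily e f = (y ∘ finSumFinEquiv.symm) ∘ ⇑(ρ⁻¹) := by
      have : blockFamily e f ∘ ρ = y ∘ finSumFinEquiv.symm := by
        ext q
        obtain ⟨s, rfl⟩ := finSumFinEquiv.surjective q
        simp only [Function.comp_apply, Equiv.symm_apply_apply, hy, lastPairEquiv_apply,
          lastPairMap_comp]
        rfl
      rw [← this]
      ext q
      simp
    have hsign : (Equiv.Perm.sign ρ⁻¹ : ℤˣ) = (-1) ^ n := by
      rw [Equiv.Perm.sign_inv, hρ, Fin.sign_cycleIcc_of_le (Fin.le_def.2 (by simp; omega))]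
      congr 1
      simp; omega
    have hexp : (-1 : ℝ) ^ ((n + 1) * (n + 1 - 1) / 2) = (-1) ^ (n * (n - 1) / 2) * (-1) ^ n := by
      rw [← pow_add]
      congr 1
      rcases n with _ | n
      · rfl
      · have : (n + 1 + 1) * (n + 1 + 1 - 1) = (n + 1) * (n + 1 - 1) + 2 * (n + 1) := by
          simp only [Nat.add_sub_cancel]; ring
        rw [this, Nat.add_mul_div_left _ _ (by norm_num)]
    set t : ℝ := (-1) ^ (n * (n - 1) / 2) with ht
    have hw : wedgePow ω (n + 1) (blockFamily e f) =
        (-1) ^ n * wedge (wedgePow ω n) ω (y ∘ finSumFinEquiv.symm) := by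
      rw [hv]
      refine ((wedge (wedgePow ω n) ω).map_perm _ _).trans ?_
      rw [hsign, Units.smul_def]
      simp
    have hsum := factorial_smul_wedge_apply (wedgePow ω n) ω (y ∘ finSumFinEquiv.symm)
    simp only [Function.comp_apply, Equiv.symm_apply_apply] at hsum
    have hpos : 0 < t * wedge (wedgePow ω n) ω (y ∘ finSumFinEquiv.symm) := by
      have h1 : 0 < t * ((2 * n).factorial * Nat.factorial 2) •
          wedge (wedgePow ω n) ω (y ∘ finSumFinEquiv.symm) := by
        rw [hsum, Finset.mul_sum]
        refine Finset.sum_pos' (fun σ _ => h.wedgePow_term_nonneg (fun e f h => ih h) σ)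
          ⟨1, Finset.mem_univ _, ?_⟩
        have hl : (fun p => y (Sum.inl p)) = blockFamily (e ∘ Fin.castSucc) (f ∘ Fin.castSucc) := by
          ext p
          simp only [hy, Function.comp_apply, lastPairEquiv_apply, lastPairMap, Sum.elim_inl,
            blockFamily]
          rcases blockEquiv n p with c | c <;> rfl
        have hr : (fun p => y (Sum.inr p)) = ![e (Fin.last n), f (Fin.last n)] := by
          ext p
          fin_cases p <;> rfl
        have hω : ω ![e (Fin.last n), f (Fin.last n)] = 1 := by
          simpa using h.ef (Fin.last n) (Fin.last n)
        simp only [Equiv.Perm.sign_one, one_smul, Equiv.Perm.one_apply, hl, hr, hω, mul_one]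
        exact ih (h.comp (Fin.castSucc_injective n))
      rw [nsmul_eq_mul, mul_left_comm] at h1
      exact pos_of_mul_pos_right h1 (by positivity)
    rw [hw, hexp]
    have h2 : ((-1 : ℝ) ^ n) * (-1) ^ n = 1 := by rw [← mul_pow]; simp
    calc 0 < t * wedge (wedgePow ω n) ω (y ∘ finSumFinEquiv.symm) := hpos
      _ = t * ((-1) ^ n * (-1) ^ n) * wedge (wedgePow ω n) ω (y ∘ finSumFinEquiv.symm) := by
        rw [h2, mul_one]
      _ = _ := by ring

end Sign

/-! ## Forms of type `(n, 0)` as determinants -/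

section DetForm

variable {V : Type*} [AddCommGroup V] [Module ℝ V] {n : ℕ}

/-- The multilinear map `v ↦ ∏ α_i(v_i)`. -/
noncomputable def prodForm (α : Fin n → V →ₗ[ℝ] ℂ) : MultilinearMap ℝ (fun _ : Fin n => V) ℂ :=
  (MultilinearMap.mkPiAlgebra ℝ (Fin n) ℂ).compLinearMap α

/-- The form `α₁ ∧ ⋯ ∧ αₙ`. -/
noncomputable def detForm (α : Fin n → V →ₗ[ℝ] ℂ) : V [⋀^Fin n]→ₗ[ℝ] ℂ :=
  MultilinearMap.alternatization (prodForm α)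

theorem prodForm_apply (α : Fin n → V →ₗ[ℝ] ℂ) (v : Fin n → V) :
    prodForm α v = ∏ i, α i (v i) := by
  simp [prodForm]

theorem detForm_apply (α : Fin n → V →ₗ[ℝ] ℂ) (v : Fin n → V) :
    detForm α v = (Matrix.of fun i j => α i (v j)).det := by
  rw [detForm, MultilinearMap.alternatization_apply, ← Matrix.det_transpose, Matrix.det_apply]
  refine Finset.sum_congr rfl fun σ _ => ?_
  rw [MultilinearMap.domDomCongr_apply, prodForm_apply]
  rfl

theorem alternatization_combination (α β : Fin n → V →ₗ[ℝ] ℂ) (A B : ℂ) :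
    MultilinearMap.alternatization (A • prodForm α + B • prodForm β) =
      A • detForm α + B • detForm β := by
  ext v
  simp only [detForm, MultilinearMap.alternatization_apply, AlternatingMap.add_apply,
    AlternatingMap.smul_apply, Finset.smul_sum, ← Finset.sum_add_distrib]
  refine Finset.sum_congr rfl fun σ _ => ?_
  simp only [MultilinearMap.domDomCongr_apply, add_apply, smul_apply,
    Units.smul_def, zsmul_eq_mul, smul_eq_mul]
  ring

/-- The determinant `α₁ ∧ ⋯ ∧ αₙ ∧ β₁ ∧ ⋯ ∧ βₙ` evaluated on `2 n` vectors. -/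
noncomputable def blockDet (α β : Fin n → V →ₗ[ℝ] ℂ) (w : Fin n ⊕ Fin n → V) : ℂ :=
  (Matrix.of fun s t => Sum.elim α β s (w t)).det

/-- Each factor is the alternatization of a combination of product maps, so the permutation sum for
the wedge is termwise the Leibniz expansion of the block determinants. -/
theorem wedge_detForm (α β : Fin n → V →ₗ[ℝ] ℂ) (A B C D : ℂ) (w : Fin n ⊕ Fin n → V) :
    wedge (A • detForm α + B • detForm β) (C • detForm α + D • detForm β)
      (w ∘ finSumFinEquiv.symm) = A * C * blockDet α α w + A * D * blockDet α β w +
        B * C * blockDet β α w + B * D * blockDet β β w := by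
  rw [← alternatization_combination, ← alternatization_combination, wedge_apply_alternatization]
  have hdet : ∀ α β : Fin n → V →ₗ[ℝ] ℂ, blockDet α β w = ∑ σ : Equiv.Perm (Fin n ⊕ Fin n),
      ((Equiv.Perm.sign σ : ℤ) : ℂ) * ((∏ i, α i (w (σ (Sum.inl i)))) *
        ∏ i, β i (w (σ (Sum.inr i)))) := by
    intro α β
    rw [blockDet, ← Matrix.det_transpose, Matrix.det_apply']
    refine Finset.sum_congr rfl fun σ _ => ?_
    rw [Fintype.prod_sum_type]
    rfl
  simp only [hdet, Finset.mul_sum, ← Finset.sum_add_distrib]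
  refine Finset.sum_congr rfl fun σ _ => ?_
  simp only [Function.comp_apply, Equiv.symm_apply_apply, add_apply,
    smul_apply, prodForm_apply, Units.smul_def, zsmul_eq_mul, smul_eq_mul]
  ring

variable {ω : V [⋀^Fin 2]→ₗ[ℝ] ℝ} {J : V →ₗ[ℝ] V}

/-- The coordinates of a vector with respect to the unitary frame `u`, with `J` acting as
multiplication by `c`. -/
noncomputable def coordForm (ω : V [⋀^Fin 2]→ₗ[ℝ] ℝ) (J : V →ₗ[ℝ] V) (u : Fin n → V) (c : ℂ)
    (i : Fin n) : V →ₗ[ℝ] ℂ :=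
  Complex.ofRealCLM.toLinearMap ∘ₗ (bil ω).flip (J (u i)) +
    c • (Complex.ofRealCLM.toLinearMap ∘ₗ bil ω (u i))

theorem coordForm_apply (u : Fin n → V) (c : ℂ) (i : Fin n) (x : V) :
    coordForm ω J u c i x = bil ω x (J (u i)) + c * bil ω (u i) x := by
  simp [coordForm]

theorem coordForm_J (hJ : IsCompatible ω J) (u : Fin n → V) {c : ℂ} (hc : c * c = -1) (i : Fin n)
    (x : V) : coordForm ω J u c i (J x) = c * coordForm ω J u c i x := by
  rw [coordForm_apply, coordForm_apply, hJ.bil_J_J, hJ.bil_J_symm (u i) x, bil_swap ω x (u i),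
    mul_add, ← mul_assoc, hc]
  push_cast
  ring

theorem coordForm_frame {u : Fin n → V} (hu : IsSymplecticFamily ω u (J ∘ u)) (c : ℂ)
    (i j : Fin n) : coordForm ω J u c i (u j) = if i = j then 1 else 0 := by
  rw [coordForm_apply, show bil ω (u j) (J (u i)) = _ from hu.bil_ef j i, hu.bil_ee]
  rcases eq_or_ne i j with rfl | hij
  · simp
  · simp [hij, hij.symm]

theorem coordForm_J_frame {u : Fin n → V} (hu : IsSymplecticFamily ω u (J ∘ u)) (c : ℂ)
    (i j : Fin n) : coordForm ω J u c i (J (u j)) = if i = j then c else 0 := by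
  rw [coordForm_apply, show bil ω (J (u j)) (J (u i)) = _ from hu.bil_ff j i,
    show bil ω (u i) (J (u j)) = _ from hu.bil_ef i j]
  split_ifs <;> simp

theorem blockDet_coordForm {u : Fin n → V} (hu : IsSymplecticFamily ω u (J ∘ u)) (c d : ℂ) :
    blockDet (coordForm ω J u c) (coordForm ω J u d) (Sum.elim u (J ∘ u)) = (d - c) ^ n := by
  have : (Matrix.of fun s t => Sum.elim (coordForm ω J u c) (coordForm ω J u d) s
      (Sum.elim u (J ∘ u) t)) = Matrix.fromBlocks 1 (c • 1) 1 (d • (1 : Matrix (Fin n) (Fin n) ℂ)) := by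
    ext (i | i) (j | j) <;>
    simp [coordForm_frame hu, coordForm_J_frame hu, Matrix.one_apply]
  rw [blockDet, this, Matrix.det_fromBlocks_one₁₁, one_mul, ← sub_smul, Matrix.det_smul]
  simp

/-- `J` acts on every argument of `Ω` as multiplication by `c`. -/
def IsEigenform (J : V →ₗ[ℝ] V) (c : ℂ) (Ω : V [⋀^Fin n]→ₗ[ℝ] ℂ) : Prop :=
  ∀ (v : Fin n → V) (i : Fin n), Ω (Function.update v i (J (v i))) = c * Ω v

theorem isEigenform_detForm (hJ : IsCompatible ω J) (u : Fin n → V) {c : ℂ} (hc : c * c = -1) :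
    IsEigenform J c (detForm (coordForm ω J u c)) := by
  intro v i
  rw [detForm_apply, detForm_apply]
  conv_rhs => rw [← Matrix.updateCol_eq_self (Matrix.of fun i j => coordForm ω J u c i (v j)) i]
  rw [← Matrix.det_updateCol_smul]
  congr 1
  ext j l
  rcases eq_or_ne l i with rfl | hl
  · simp [coordForm_J hJ u hc]
  · simp [hl]

/-- Values on the basis (u, J u) reduce to values on u alone, since replacing u_i by J u_i in one
argument multiplies by c. On arguments taken from u, either two coincide or they are a permutation
of u. -/
theorem IsEigenform.eq_zero [FiniteDimensional ℝ V] {c : ℂ} {Ω : V [⋀^Fin n]→ₗ[ℝ] ℂ}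
    (h : IsEigenform J c Ω) (hV : Module.finrank ℝ V = 2 * n) {u : Fin n → V}
    (hu : IsSymplecticFamily ω u (J ∘ u)) (h0 : Ω u = 0) : Ω = 0 := by
  classical
  have key : ∀ φ : Fin n → Fin n, Ω (u ∘ φ) = 0 := by
    intro φ
    by_cases hφ : Function.Injective φ
    · have := Ω.map_perm u (Equiv.ofBijective φ (Finite.injective_iff_bijective.1 hφ))
      rw [h0, smul_zero] at this
      exact this
    · exact Ω.map_eq_zero_of_not_injective _ fun hi => hφ hi.of_comp
  refine (hu.basis hV).ext_alternating fun w _ => ?_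
  set φ : Fin n → Fin n := fun j => Sum.elim id id (w j) with hφ
  have hS : ∀ S : Finset (Fin n),
      Ω (fun j => if j ∈ S then hu.basis hV (w j) else u (φ j)) = 0 := by
    intro S
    induction S using Finset.induction_on with
    | empty => simpa using (show Ω (fun j => u (φ j)) = 0 from key φ)
    | insert a S ha ih =>
      set v : Fin n → V := fun j => if j ∈ S then hu.basis hV (w j) else u (φ j) with hv
      have hins : (fun j => if j ∈ insert a S then hu.basis hV (w j) else u (φ j)) =
          Function.update v a (hu.basis hV (w a)) := by
        ext j
        rcases eq_or_ne j a with rfl | hj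
        · simp
        · simp [hj, hv]
      have hva : v a = u (φ a) := by simp [hv, ha]
      rw [hins]
      rcases hwa : w a with i | i
      · have : hu.basis hV (Sum.inl i) = v a := by simp [hva, hφ, hwa]
        rw [this, Function.update_eq_self, ih]
      · have : hu.basis hV (Sum.inr i) = J (v a) := by simp [hva, hφ, hwa]
        rw [this, h, ih, mul_zero]
  simpa using hS Finset.univ

theorem IsEigenform.eq_smul_detForm [FiniteDimensional ℝ V] (hJ : IsCompatible ω J) {c : ℂ}
    (hc : c * c = -1) {Ω : V [⋀^Fin n]→ₗ[ℝ] ℂ} (h : IsEigenform J c Ω)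
    (hV : Module.finrank ℝ V = 2 * n) {u : Fin n → V} (hu : IsSymplecticFamily ω u (J ∘ u)) :
    Ω = Ω u • detForm (coordForm ω J u c) := by
  have h1 : detForm (coordForm ω J u c) u = 1 := by
    rw [detForm_apply]
    have : (Matrix.of fun i j => coordForm ω J u c i (u j)) = 1 := by
      ext i j
      simp [coordForm_frame hu, Matrix.one_apply]
    rw [this, Matrix.det_one]
  have h2 : IsEigenform J c (Ω - Ω u • detForm (coordForm ω J u c)) := by
    intro v i
    rw [AlternatingMap.sub_apply, AlternatingMap.sub_apply, AlternatingMap.smul_apply,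
      AlternatingMap.smul_apply, h, isEigenform_detForm hJ u hc, smul_eq_mul, smul_eq_mul]
    ring
  exact sub_eq_zero.1 (h2.eq_zero hV hu (by simp [h1]))

/-- A real linear endomorphism of `ℂ` is a combination of the identity and the conjugation. -/
theorem exists_complex_coefficients (g : ℂ →ₗ[ℝ] ℂ) : ∃ A B : ℂ,
    (∀ z, g z = A * z + B * (starRingEnd ℂ) z) ∧
      LinearMap.det g = ‖A‖ ^ 2 - ‖B‖ ^ 2 := by
  have hg : ∀ z, g z = z.re • g 1 + z.im • g Complex.I := by
    intro z
    rw [← map_smul, ← map_smul, ← map_add]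
    congr 1
    simp [Complex.re_add_im]
  refine ⟨(g 1 - Complex.I * g Complex.I) / 2, (g 1 + Complex.I * g Complex.I) / 2, fun z => ?_, ?_⟩
  · rw [hg z]
    apply Complex.ext <;> simp <;> ring
  · rw [← LinearMap.det_toMatrix Complex.basisOneI, Matrix.det_fin_two, ← Complex.normSq_eq_norm_sq,
      ← Complex.normSq_eq_norm_sq]
    simp [LinearMap.toMatrix_apply, Complex.normSq_apply]
    ring

/-- With α, β the coordinates of eigenvalue i and -i and a = Ω₀(u), g ∘ Ω₀ = A a det α + B ā det β.
Only the mixed determinants (-2i)ⁿ and (2i)ⁿ survive in the wedge with the conjugate, and (i/2)ⁿ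
turns them into 1 and (-1)ⁿ. -/
theorem volForm_blockFamily [FiniteDimensional ℝ V] (hn : n ≠ 0) (hJ : IsCompatible ω J)
    (hV : Module.finrank ℝ V = 2 * n) {Ω₀ : V [⋀^Fin n]→ₗ[ℝ] ℂ} (hΩ : IsTypeN0 J Ω₀)
    {u : Fin n → V} (hu : IsSymplecticFamily ω u (J ∘ u)) {g : ℂ →ₗ[ℝ] ℂ} {A B : ℂ}
    (hg : ∀ z, g z = A * z + B * (starRingEnd ℂ) z) :
    volForm (g.compAlternatingMap Ω₀) (blockFamily u (J ∘ u)) =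
      (-1) ^ (n * (n - 1) / 2) * (((‖A‖ ^ 2 + (-1) ^ n * ‖B‖ ^ 2) * ‖Ω₀ u‖ ^ 2 : ℝ) : ℂ) := by
  set α := coordForm ω J u Complex.I with hα
  set β := coordForm ω J u (-Complex.I) with hβ
  set a := Ω₀ u with ha
  have h1 : Ω₀ = a • detForm α :=
    IsEigenform.eq_smul_detForm hJ (by simp) (c := Complex.I) hΩ hV hu
  have h2 : conjForm Ω₀ = (starRingEnd ℂ) a • detForm β := by
    refine IsEigenform.eq_smul_detForm hJ (c := -Complex.I) (by simp) (Ω := conjForm Ω₀)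
      (fun v i => ?_) hV hu
    simp only [conjForm, LinearMap.compAlternatingMap_apply]
    rw [hΩ v i]
    simp
  have hv1 : ∀ v, Ω₀ v = a * detForm α v := fun v => by
    conv_lhs => rw [h1]
    rfl
  have hv2 : ∀ v, (starRingEnd ℂ) (Ω₀ v) = (starRingEnd ℂ) a * detForm β v := fun v => by
    have := congrArg (fun F : V [⋀^Fin n]→ₗ[ℝ] ℂ => F v) h2
    exact this
  have h3 : g.compAlternatingMap Ω₀ =
      (A * a) • detForm α + (B * (starRingEnd ℂ) a) • detForm β := by
    ext v
    simp only [LinearMap.compAlternatingMap_apply, hg, AlternatingMap.add_apply,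
      AlternatingMap.smul_apply, smul_eq_mul]
    rw [hv2 v, hv1 v]
    ring
  have h4 : conjForm (g.compAlternatingMap Ω₀) =
      ((starRingEnd ℂ) B * a) • detForm α + ((starRingEnd ℂ) A * (starRingEnd ℂ) a) • detForm β := by
    ext v
    simp only [conjForm, LinearMap.compAlternatingMap_apply, hg, AlternatingMap.add_apply,
      AlternatingMap.smul_apply, smul_eq_mul]
    change (starRingEnd ℂ) (A * Ω₀ v + B * (starRingEnd ℂ) (Ω₀ v)) = _
    rw [map_add, map_mul, map_mul, Complex.conj_conj, hv2 v, hv1 v]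
    ring
  have hw : volForm (g.compAlternatingMap Ω₀) (blockFamily u (J ∘ u)) =
      ((-1 : ℂ) ^ (n * (n - 1) / 2) * (Complex.I / 2) ^ n) *
        wedge (g.compAlternatingMap Ω₀) (conjForm (g.compAlternatingMap Ω₀))
          (Sum.elim u (J ∘ u) ∘ finSumFinEquiv.symm) := by
    rfl
  rw [hw, h4, h3, wedge_detForm, hα, hβ]
  simp only [blockDet_coordForm hu]
  -- The unmixed determinants are 0ⁿ, which vanish only for n ≠ 0; this is one reason for treating n
  -- = 0 separately.
  rw [sub_self, sub_self, zero_pow hn, mul_zero, zero_add, mul_zero, add_zero, mul_assoc]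
  congr 1
  have hI1 : (Complex.I / 2) ^ n * (-Complex.I - Complex.I) ^ n = 1 := by
    rw [← mul_pow]
    convert one_pow n using 2
    linear_combination (-1 : ℂ) * Complex.I_mul_I
  have hI2 : (Complex.I / 2) ^ n * (Complex.I - -Complex.I) ^ n = (-1) ^ n := by
    rw [← mul_pow]
    congr 1
    linear_combination Complex.I_mul_I
  push_cast
  rw [← Complex.mul_conj' A, ← Complex.mul_conj' B, ← Complex.mul_conj' a]
  linear_combination (A * a * ((starRingEnd ℂ) A * (starRingEnd ℂ) a)) * hI1 +
    (B * (starRingEnd ℂ) a * ((starRingEnd ℂ) B * a)) * hI2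

end DetForm

/-! ## The volume of the torus -/

section Volume

theorem IsSymplecticFamily.basis_repr_inl {V : Type*} [AddCommGroup V] [Module ℝ V]
    [FiniteDimensional ℝ V] {n : ℕ} {ω : V [⋀^Fin 2]→ₗ[ℝ] ℝ} {e f : Fin n → V}
    (h : IsSymplecticFamily ω e f) (hV : Module.finrank ℝ V = 2 * n) (x : V) (i : Fin n) :
    (h.basis hV).repr x (Sum.inl i) = bil ω x (f i) := by
  have key : (h.basis hV).coord (Sum.inl i) = (bil ω).flip (f i) := by
    refine (h.basis hV).ext ?_
    rintro (j | j)
    · rw [Module.Basis.coord_apply, Module.Basis.repr_self, LinearMap.flip_apply, h.basis_inl]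
      simp [h.bil_ef, Finsupp.single_apply]
    · rw [Module.Basis.coord_apply, Module.Basis.repr_self, LinearMap.flip_apply, h.basis_inr]
      simp [h.bil_ff]
  exact LinearMap.congr_fun key x

theorem IsSymplecticFamily.basis_repr_inr {V : Type*} [AddCommGroup V] [Module ℝ V]
    [FiniteDimensional ℝ V] {n : ℕ} {ω : V [⋀^Fin 2]→ₗ[ℝ] ℝ} {e f : Fin n → V}
    (h : IsSymplecticFamily ω e f) (hV : Module.finrank ℝ V = 2 * n) (x : V) (i : Fin n) :
    (h.basis hV).repr x (Sum.inr i) = bil ω (e i) x := by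
  have key : (h.basis hV).coord (Sum.inr i) = bil ω (e i) := by
    refine (h.basis hV).ext ?_
    rintro (j | j)
    · rw [Module.Basis.coord_apply, Module.Basis.repr_self, h.basis_inl]
      simp [h.bil_ee]
    · rw [Module.Basis.coord_apply, Module.Basis.repr_self, h.basis_inr]
      simp [h.bil_ef, Finsupp.single_apply, eq_comm]
  exact LinearMap.congr_fun key x

theorem IsSymplecticFamily.basis_det_sq {V : Type*} [AddCommGroup V] [Module ℝ V]
    [FiniteDimensional ℝ V] {n : ℕ} {ω : V [⋀^Fin 2]→ₗ[ℝ] ℝ} {e f : Fin n → V}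
    (h : IsSymplecticFamily ω e f) (hV : Module.finrank ℝ V = 2 * n) (b : Fin n ⊕ Fin n → V) :
    (h.basis hV).det b ^ 2 = (Matrix.of fun s t => bil ω (b s) (b t)).det := by
  rw [← h.det_sq hV b, Module.Basis.det_apply]
  have hM : (h.basis hV).toMatrix b = Matrix.J (Fin n) ℝ *
      Matrix.of fun (s t : Fin n ⊕ Fin n) => bil ω (Sum.elim e f s) (b t) := by
    ext (i | i) t
    · rw [Module.Basis.toMatrix_apply, h.basis_repr_inl, bil_swap, Matrix.mul_apply,
        Fintype.sum_sum_type]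
      simp [Matrix.J, Matrix.one_apply, Matrix.neg_apply]
    · rw [Module.Basis.toMatrix_apply, h.basis_repr_inr, Matrix.mul_apply, Fintype.sum_sum_type]
      simp [Matrix.J, Matrix.one_apply]
  rw [hM, Matrix.det_mul, mul_pow, sq (Matrix.J (Fin n) ℝ).det, Matrix.J_det_mul_J_det, one_mul]

variable {V : Type*} [NormedAddCommGroup V] [NormedSpace ℝ V] [FiniteDimensional ℝ V] {n : ℕ}

/-- The lattice basis, indexed by two blocks. -/
noncomputable def blockLatticeBasis (Λ : Submodule ℤ V) [DiscreteTopology Λ] [IsZLattice ℝ Λ]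
    (hV : Module.finrank ℝ V = 2 * n) : Module.Basis (Fin n ⊕ Fin n) ℤ Λ :=
  (latticeBasis Λ hV).reindex (blockEquiv n)

/-- The absolute value of the Pfaffian of `ω` on the lattice `Λ`. -/
noncomputable def covolume (Λ : Submodule ℤ V) [DiscreteTopology Λ] [IsZLattice ℝ Λ]
    (hV : Module.finrank ℝ V = 2 * n) (ω : V [⋀^Fin 2]→ₗ[ℝ] ℝ) : ℝ :=
  √(Matrix.of fun s t =>
    bil ω (blockLatticeBasis Λ hV s : V) (blockLatticeBasis Λ hV t)).det

theorem covolume_eq {Λ : Submodule ℤ V} [DiscreteTopology Λ] [IsZLattice ℝ Λ]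
    (hV : Module.finrank ℝ V = 2 * n) {ω : V [⋀^Fin 2]→ₗ[ℝ] ℝ} {e f : Fin n → V}
    (h : IsSymplecticFamily ω e f) :
    covolume Λ hV ω = |(h.basis hV).det fun s => (blockLatticeBasis Λ hV s : V)| := by
  rw [covolume, ← h.basis_det_sq hV, Real.sqrt_sq_eq_abs]

theorem covolume_pos {Λ : Submodule ℤ V} [DiscreteTopology Λ] [IsZLattice ℝ Λ]
    (hV : Module.finrank ℝ V = 2 * n) {ω : V [⋀^Fin 2]→ₗ[ℝ] ℝ} {e f : Fin n → V}
    (h : IsSymplecticFamily ω e f) : 0 < covolume Λ hV ω := by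
  rw [covolume_eq hV h, abs_pos]
  have h1 : (fun s => (blockLatticeBasis Λ hV s : V)) =
      ((blockLatticeBasis Λ hV).ofZLatticeBasis ℝ Λ : Fin n ⊕ Fin n → V) :=
    funext fun s => ((blockLatticeBasis Λ hV).ofZLatticeBasis_apply ℝ Λ s).symm
  rw [h1]
  exact ((h.basis hV).isUnit_det _).ne_zero

/-- Both top-degree forms are multiples of the determinant of the basis (u, J u). The sign
(-1)^(n(n-1)/2) occurs in both and cancels, leaving the absolute value of the determinant of the
lattice basis. -/
theorem vol_eq {Λ : Submodule ℤ V} [DiscreteTopology Λ] [IsZLattice ℝ Λ] (hn : n ≠ 0)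
    (hV : Module.finrank ℝ V = 2 * n) {ω : V [⋀^Fin 2]→ₗ[ℝ] ℝ} {J : V →ₗ[ℝ] V}
    (hJ : IsCompatible ω J) {Ω₀ : V [⋀^Fin n]→ₗ[ℝ] ℂ} (hΩ : IsTypeN0 J Ω₀)
    {u : Fin n → V} (hu : IsSymplecticFamily ω u (J ∘ u)) {g : ℂ →ₗ[ℝ] ℂ} {A B : ℂ}
    (hg : ∀ z, g z = A * z + B * (starRingEnd ℂ) z) :
    vol Λ hV ω (g.compAlternatingMap Ω₀) =
      covolume Λ hV ω * ((‖A‖ ^ 2 + (-1) ^ n * ‖B‖ ^ 2) * ‖Ω₀ u‖ ^ 2) := by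
  set E := (hu.basis hV).reindex (blockEquiv n).symm with hE
  have hEb : ⇑E = blockFamily u (J ∘ u) := by
    ext j
    rw [hE, Module.Basis.reindex_apply, Equiv.symm_symm, blockFamily, Function.comp_apply]
    rcases blockEquiv n j with i | i <;> simp
  set x : Fin (2 * n) → V := fun j => (latticeBasis Λ hV j : V) with hx
  have hdet : covolume Λ hV ω = |E.det x| := by
    rw [covolume_eq hV hu, hE, Module.Basis.det_reindex]
    congr 2
    ext s
    simp [blockLatticeBasis, hx]
  have h1 := congrArg (fun F => F x) ((wedgePow ω n).eq_smul_basis_det E)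
  have h2 := congrArg (fun F => F x)
    ((Complex.reCLM.toLinearMap.compAlternatingMap
      (volForm (g.compAlternatingMap Ω₀))).eq_smul_basis_det E)
  simp only [AlternatingMap.smul_apply, smul_eq_mul, hEb, LinearMap.compAlternatingMap_apply] at h1 h2
  change (volForm (g.compAlternatingMap Ω₀) x).re =
    (volForm (g.compAlternatingMap Ω₀) (blockFamily u (J ∘ u))).re * _ at h2
  rw [volForm_blockFamily hn hJ hV hΩ hu hg] at h2
  set t : ℝ := (-1) ^ (n * (n - 1) / 2) with ht
  set m : ℝ := (‖A‖ ^ 2 + (-1) ^ n * ‖B‖ ^ 2) * ‖Ω₀ u‖ ^ 2 with hm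
  have h3 : ((-1 : ℂ) ^ (n * (n - 1) / 2) * (m : ℂ)).re = t * m := by
    rw [show (-1 : ℂ) ^ (n * (n - 1) / 2) = (t : ℂ) by rw [ht]; push_cast; rfl, ← Complex.ofReal_mul,
      Complex.ofReal_re]
  rw [h3] at h2
  have hpos := hu.wedgePow_pos
  rw [← ht] at hpos
  have hsign : Real.sign (wedgePow ω n (blockFamily u (J ∘ u))) = t := by
    rcases neg_one_pow_eq_or ℝ (n * (n - 1) / 2) with h | h
    · rw [ht, h] at hpos ⊢
      exact Real.sign_of_pos (by linarith)
    · rw [ht, h] at hpos ⊢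
      exact Real.sign_of_neg (by linarith)
  have htt : t * t = 1 := by rw [ht, ← mul_pow]; simp
  have hmul : ∀ a c : ℝ, Real.sign (a * c) = Real.sign a * Real.sign c := by
    intro a c
    rcases lt_trichotomy a 0 with ha | rfl | ha <;> rcases lt_trichotomy c 0 with hc | rfl | hc <;>
    simp [Real.sign_of_pos, Real.sign_of_neg, *, mul_pos_of_neg_of_neg, mul_neg_of_neg_of_pos,
      mul_neg_of_pos_of_neg]
  have habs : ∀ c : ℝ, Real.sign c * c = |c| := by
    intro c
    rcases lt_trichotomy c 0 with hc | rfl | hc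
    · rw [Real.sign_of_neg hc, abs_of_neg hc]; ring
    · simp
    · rw [Real.sign_of_pos hc, abs_of_pos hc]; ring
  change Real.sign (wedgePow ω n x) * (volForm (g.compAlternatingMap Ω₀) x).re = _
  rw [h1, h2, hmul, hsign, hdet, ← habs]
  linear_combination (Real.sign (E.det x) * E.det x * m) * htt

theorem vol_zero {Λ : Submodule ℤ V} [DiscreteTopology Λ] [IsZLattice ℝ Λ]
    (hV : Module.finrank ℝ V = 2 * 0) (ω : V [⋀^Fin 2]→ₗ[ℝ] ℝ) (Ω : V [⋀^Fin 0]→ₗ[ℝ] ℂ) :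
    vol Λ hV ω Ω = ‖Ω ![]‖ ^ 2 := by
  have h := factorial_smul_wedge_apply Ω (conjForm Ω) ![]
  simp only [Nat.factorial_zero, mul_one, one_smul, Fintype.sum_unique,
    Equiv.Perm.default_eq, Equiv.Perm.sign_one] at h
  have h0 : ∀ v, Ω v = Ω ![] := fun v => congrArg Ω (Subsingleton.elim _ _)
  have h1 : ∀ v, conjForm Ω v = (starRingEnd ℂ) (Ω ![]) := fun v => by
    rw [← h0 v]; rfl
  rw [h0, h1, Complex.mul_conj'] at h
  have h2 : ∀ v, volForm Ω v = (‖Ω ![]‖ : ℂ) ^ 2 := fun v => by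
    rw [← h]
    simp only [volForm, AlternatingMap.domDomCongr_apply, AlternatingMap.smul_apply]
    simp
    exact congrArg _ (funext fun i => i.elim0)
  rw [vol, h2]
  simp only [wedgePow, AlternatingMap.constOfIsEmpty_apply, Function.const_apply, Real.sign_one, one_mul]
  rw [← Complex.ofReal_pow, Complex.ofReal_re]

end Volume

/-! ## Linear special Lagrangian subtori -/

section Subtorus

variable {V : Type*} [NormedAddCommGroup V] [NormedSpace ℝ V] {n : ℕ} {Λ : Submodule ℤ V}
  {v : Fin n → V}

/-- The linear parametrization `x ↦ ∑ x_i v_i`. -/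
noncomputable def linearParam (v : Fin n → V) : (Fin n → ℝ) →L[ℝ] V :=
  (Fintype.linearCombination ℝ v).toContinuousLinearMap

theorem linearParam_apply (v : Fin n → V) (x : Fin n → ℝ) :
    linearParam v x = ∑ i, x i • v i := rfl

/-- A nontrivial relation could be rescaled to have a coefficient 1/2 while its sum 0 still lies in
Λ. -/
theorem PrimitiveUpTo.linearIndependent (h : PrimitiveUpTo Λ v n) : LinearIndependent ℝ v := by
  rw [Fintype.linearIndependent_iff]
  intro c hc i
  by_contra hi
  obtain ⟨m, hm⟩ := h (fun j => (2 * c i)⁻¹ * c j) (fun j hj => absurd j.2 (not_lt.2 hj)) (by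
    have : ∑ j, ((2 * c i)⁻¹ * c j) • v j = (2 * c i)⁻¹ • ∑ j, c j • v j := by
      rw [Finset.smul_sum]
      exact Finset.sum_congr rfl fun j _ => mul_smul _ _ _
    rw [this, hc, smul_zero]
    exact Λ.zero_mem) i
  have h2 : (m : ℝ) * 2 = 1 := by
    rw [← hm]
    field_simp
  have h3 : m * 2 = 1 := by exact_mod_cast h2
  omega

theorem PrimitiveUpTo.toTorus_eq_iff (h : PrimitiveUpTo Λ v n) (hv : ∀ i, v i ∈ Λ)
    (x y : Fin n → ℝ) :
    toTorus Λ (linearParam v) x = toTorus Λ (linearParam v) y ↔ ∀ i, ∃ m : ℤ, x i - y i = m := by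
  rw [toTorus, toTorus, Submodule.Quotient.eq, ← map_sub, linearParam_apply]
  constructor
  · intro hxy i
    exact h (x - y) (fun j hj => absurd j.2 (not_lt.2 hj)) hxy i
  · intro hxy
    refine Λ.sum_mem fun i _ => ?_
    obtain ⟨m, hm⟩ := hxy i
    rw [Pi.sub_apply, hm, Int.cast_smul_eq_zsmul]
    exact Λ.smul_mem _ (hv i)

theorem continuous_toTorus_linearParam (Λ : Submodule ℤ V) (v : Fin n → V) :
    Continuous (toTorus Λ (linearParam v)) :=
  continuous_quot_mk.comp (linearParam v).continuous

theorem PrimitiveUpTo.range_toTorus (h : PrimitiveUpTo Λ v n) (hv : ∀ i, v i ∈ Λ) :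
    Set.range (toTorus Λ (linearParam v)) =
      toTorus Λ (linearParam v) '' Set.univ.pi fun _ => Set.Icc (0 : ℝ) 1 := by
  refine Set.Subset.antisymm ?_ (Set.image_subset_range _ _)
  rintro _ ⟨x, rfl⟩
  refine ⟨fun i => Int.fract (x i), fun i _ => ⟨Int.fract_nonneg _, (Int.fract_lt_one _).le⟩, ?_⟩
  rw [h.toTorus_eq_iff hv]
  exact fun i => ⟨-⌊x i⌋, by rw [Int.fract]; push_cast; ring⟩

theorem isCompact_unitCube : IsCompact (Set.univ.pi fun _ : Fin n => Set.Icc (0 : ℝ) 1) :=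
  isCompact_univ_pi fun _ => isCompact_Icc

theorem PrimitiveUpTo.isLocalParam [DiscreteTopology Λ] (h : PrimitiveUpTo Λ v n)
    (hv : ∀ i, v i ∈ Λ) (c : Fin n → ℝ) :
    IsLocalParam Λ (Set.range (toTorus Λ (linearParam v)))
      (Set.univ.pi fun i => Set.Ioo (c i) (c i + 1)) (linearParam v) where
  isOpen := isOpen_set_pi Set.finite_univ fun _ _ => isOpen_Ioo
  smooth := (linearParam v).contDiff.contDiffOn
  immersion x _ := by
    rw [ContinuousLinearMap.fderiv]
    exact h.linearIndependent.fintypeLinearCombination_injective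
  injOn x hx y hy hxy := by
    ext i
    obtain ⟨m, hm⟩ := (h.toTorus_eq_iff hv x y).1 hxy i
    have h1 := hx i trivial
    have h2 := hy i trivial
    have h3 : |(m : ℝ)| < 1 := by
      rw [← hm, abs_lt]
      constructor <;> linarith [h1.1, h1.2, h2.1, h2.2]
    have h4 : m = 0 := Int.abs_lt_one_iff.1 (by exact_mod_cast h3)
    rw [h4, Int.cast_zero] at hm
    linarith
  relOpen O' _ hO' := by
    have : IsClosed (Λ : Set V) := isClosed_lattice Λ
    set K : Set (Fin n → ℝ) := Set.univ.pi fun _ => Set.Icc (0 : ℝ) 1 with hK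
    -- S consists of the points of the unit cube with no integer translate in O'. Its image is
    -- compact, hence closed, and is the complement of the image of O' in the subtorus.
    set S : Set (Fin n → ℝ) := K ∩ ⋂ m : Fin n → ℤ, {x | (x + fun i => (m i : ℝ)) ∉ O'} with hS
    have hSc : IsCompact S := isCompact_unitCube.inter_right (isClosed_iInter fun m =>
      hO'.isClosed_compl.preimage (continuous_id.add continuous_const))
    refine ⟨(toTorus Λ (linearParam v) '' S)ᶜ,
      (hSc.image (continuous_toTorus_linearParam Λ v)).isClosed.isOpen_compl, ?_⟩
    ext p
    constructor
    · rintro ⟨x, hx, rfl⟩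
      refine ⟨⟨x, rfl⟩, ?_⟩
      rintro ⟨y, hy, hxy⟩
      have h1 := (h.toTorus_eq_iff hv x y).1 hxy.symm
      choose m hm using h1
      refine Set.mem_iInter.1 hy.2 m ?_
      convert hx using 1
      ext i
      simp [← hm i]
    · rintro ⟨hp, hpS⟩
      rw [h.range_toTorus hv] at hp
      obtain ⟨x, hx, rfl⟩ := hp
      by_contra hcon
      refine hpS ⟨x, ⟨hx, Set.mem_iInter.2 fun m hm => hcon ⟨_, hm, ?_⟩⟩, rfl⟩
      rw [h.toTorus_eq_iff hv]
      exact fun i => ⟨m i, by simp⟩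

theorem tangentFrame_linearParam (v : Fin n → V) (x : Fin n → ℝ) :
    tangentFrame (linearParam v) x = v := by
  ext j
  rw [tangentFrame, ContinuousLinearMap.fderiv, linearParam_apply]
  simp [Pi.single_apply, ite_smul]

theorem PrimitiveUpTo.isCompactSpecialLagrangian [DiscreteTopology Λ] (h : PrimitiveUpTo Λ v n)
    (hv : ∀ i, v i ∈ Λ) {ω : V [⋀^Fin 2]→ₗ[ℝ] ℝ} (hω : ∀ i j, ω ![v i, v j] = 0)
    {Ω : V [⋀^Fin n]→ₗ[ℝ] ℂ} (hΩ : Ω v ≠ 0) :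
    IsCompactSpecialLagrangian Λ ω Ω (Set.range (toTorus Λ (linearParam v))) := by
  refine ⟨?_, Set.range_nonempty _, (Ω v).arg, ?_⟩
  · rw [h.range_toTorus hv]
    exact isCompact_unitCube.image (continuous_toTorus_linearParam Λ v)
  · rintro _ ⟨x, rfl⟩
    refine ⟨_, linearParam v, h.isLocalParam hv fun i => x i - 1 / 2,
      ⟨x, fun i _ => ⟨by linarith, by linarith⟩, rfl⟩, fun y _ => ?_⟩
    rw [tangentFrame_linearParam]
    refine ⟨hω, ‖Ω v‖, norm_ne_zero_iff.2 hΩ, ?_⟩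
    rw [mul_comm Complex.I, Complex.norm_mul_exp_arg_mul_I]

/-- The dissection of a linear subtorus into `2 ^ n` cubes of side length `1 / 2`. -/
noncomputable def PrimitiveUpTo.dissection [DiscreteTopology Λ] (h : PrimitiveUpTo Λ v n)
    (hv : ∀ i, v i ∈ Λ) : Dissection n Λ (Set.range (toTorus Λ (linearParam v))) where
  m := Fintype.card (Fin n → Fin 2)
  -- A half-open unit cube does not fit into an open unit box, on which the parametrization is
  -- injective. Cubes of side 1/2 do, with a margin 1/4 on each side.
  O k := Set.univ.pi fun i => Set.Ioo
    (((Fintype.equivFin (Fin n → Fin 2)).symm k i : ℕ) / 2 - 1 / 4 : ℝ)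
    (((Fintype.equivFin (Fin n → Fin 2)).symm k i : ℕ) / 2 - 1 / 4 + 1)
  ψ _ := linearParam v
  A k := Set.univ.pi fun i => Set.Ico
    (((Fintype.equivFin (Fin n → Fin 2)).symm k i : ℕ) / 2 : ℝ)
    (((Fintype.equivFin (Fin n → Fin 2)).symm k i : ℕ) / 2 + 1 / 2)
  isLocalParam k := h.isLocalParam hv _
  subset k := Set.pi_mono fun i _ x hx => ⟨by linarith [hx.1], by linarith [hx.2]⟩
  measurable k := MeasurableSet.univ_pi fun _ => measurableSet_Ico
  disjoint := by
    intro k l hkl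
    rw [Set.disjoint_left]
    rintro _ ⟨x, hx, rfl⟩ ⟨y, hy, hxy⟩
    apply hkl
    apply (Fintype.equivFin (Fin n → Fin 2)).symm.injective
    ext i
    obtain ⟨m, hm⟩ := (h.toTorus_eq_iff hv y x).1 hxy i
    have h1 := hx i trivial
    have h2 := hy i trivial
    simp only [Set.mem_Ico] at h1 h2
    generalize (Fintype.equivFin (Fin n → Fin 2)).symm k i = s at h1 ⊢
    generalize (Fintype.equivFin (Fin n → Fin 2)).symm l i = t at h2 ⊢
    have hs1 : ((s : ℕ) : ℝ) ≤ 1 := by exact_mod_cast Nat.lt_succ_iff.1 s.2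
    have ht1 : ((t : ℕ) : ℝ) ≤ 1 := by exact_mod_cast Nat.lt_succ_iff.1 t.2
    have hs0 : (0 : ℝ) ≤ ((s : ℕ) : ℝ) := Nat.cast_nonneg _
    have ht0 : (0 : ℝ) ≤ ((t : ℕ) : ℝ) := Nat.cast_nonneg _
    have h3 : |(m : ℝ)| < 1 := by
      rw [← hm, abs_lt]
      constructor <;> linarith [h1.1, h1.2, h2.1, h2.2]
    have h4 : m = 0 := Int.abs_lt_one_iff.1 (by exact_mod_cast h3)
    rw [h4, Int.cast_zero] at hm
    have h5 : ((s : ℕ) : ℝ) < (t : ℕ) + 1 := by linarith [h1.1, h2.2]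
    have h6 : ((t : ℕ) : ℝ) < (s : ℕ) + 1 := by linarith [h1.2, h2.1]
    have h7 : (s : ℕ) < (t : ℕ) + 1 := by exact_mod_cast h5
    have h8 : (t : ℕ) < (s : ℕ) + 1 := by exact_mod_cast h6
    omega
  cover := by
    refine Set.Subset.antisymm (Set.iUnion_subset fun k => Set.image_subset_range _ _) ?_
    rintro _ ⟨x, rfl⟩
    refine Set.mem_iUnion.2 ⟨Fintype.equivFin (Fin n → Fin 2)
      (fun i => if Int.fract (x i) < 1 / 2 then 0 else 1), fun i => Int.fract (x i), fun i _ => ?_,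
      ?_⟩
    · have h1 := Int.fract_nonneg (x i)
      have h2 := Int.fract_lt_one (x i)
      simp only [Equiv.symm_apply_apply]
      split_ifs with h3
      · simp only [Fin.val_zero, Nat.cast_zero, zero_div, Set.mem_Ico]
        constructor <;> linarith
      · simp only [Fin.val_one, Nat.cast_one, Set.mem_Ico]
        constructor <;> linarith
    · rw [h.toTorus_eq_iff hv]
      exact fun i => ⟨-⌊x i⌋, by rw [Int.fract]; push_cast; ring⟩

theorem PrimitiveUpTo.dissection_integral [DiscreteTopology Λ] (h : PrimitiveUpTo Λ v n)
    (hv : ∀ i, v i ∈ Λ) (Ω : V [⋀^Fin n]→ₗ[ℝ] ℂ) :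
    (h.dissection hv).integral Ω = ‖Ω v‖ₑ := by
  have hvol : ∀ s : Fin n → ℝ, MeasureTheory.volume
      (Set.univ.pi fun i => Set.Ico (s i) (s i + 1 / 2)) = (2⁻¹ : ℝ≥0∞) ^ n := by
    intro s
    rw [Real.volume_pi_Ico]
    simp only [add_sub_cancel_left, one_div]
    rw [Finset.prod_const, Finset.card_univ, Fintype.card_fin,
      ENNReal.ofReal_inv_of_pos (by norm_num)]
    simp
  have hterm : ∀ k, ∫⁻ x in (h.dissection hv).A k,
      ‖Ω (tangentFrame ((h.dissection hv).ψ k) x)‖ₑ = ‖Ω v‖ₑ * (2⁻¹ : ℝ≥0∞) ^ n := by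
    intro k
    simp only [PrimitiveUpTo.dissection, tangentFrame_linearParam]
    rw [MeasureTheory.setLIntegral_const, hvol]
  rw [Dissection.integral, Finset.sum_congr rfl fun k _ => hterm k, Finset.sum_const,
    Finset.card_univ, Fintype.card_fin, nsmul_eq_mul]
  have hm : ((h.dissection hv).m : ℝ≥0∞) = 2 ^ n := by
    simp [PrimitiveUpTo.dissection]
  rw [hm, mul_left_comm, ← mul_pow, ENNReal.mul_inv_cancel (by norm_num) (by norm_num), one_pow,
    mul_one]

/-- A primitive Lagrangian frame of lattice vectors bounds the systole. -/
theorem PrimitiveUpTo.sys_le [DiscreteTopology Λ] (h : PrimitiveUpTo Λ v n)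
    (hv : ∀ i, v i ∈ Λ) {ω : V [⋀^Fin 2]→ₗ[ℝ] ℝ} (hω : ∀ i j, ω ![v i, v j] = 0)
    {Ω : V [⋀^Fin n]→ₗ[ℝ] ℂ} (hΩ : Ω v ≠ 0) : sys Λ ω Ω ≤ ‖Ω v‖ₑ := by
  refine (iInf₂_le _ (h.isCompactSpecialLagrangian hv hω hΩ)).trans ?_
  exact (iInf_le _ (h.dissection hv)).trans (h.dissection_integral hv Ω).le

theorem PrimitiveUpTo.sys_bound [DiscreteTopology Λ] (h : PrimitiveUpTo Λ v n)
    (hv : ∀ i, v i ∈ Λ) {ω : V [⋀^Fin 2]→ₗ[ℝ] ℝ} (hω : ∀ i j, ω ![v i, v j] = 0)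
    {Ω : V [⋀^Fin n]→ₗ[ℝ] ℂ} (hΩ : Ω v ≠ 0) {c : ℝ} (hc : ‖Ω v‖ ^ 2 ≤ c) :
    sys Λ ω Ω ≠ ∞ ∧ (sys Λ ω Ω).toReal ^ 2 ≤ c := by
  have h1 := h.sys_le hv hω hΩ
  have h2 : ‖Ω v‖ₑ ≠ ∞ := enorm_ne_top
  refine ⟨ne_top_of_le_ne_top h2 h1, le_trans ?_ hc⟩
  have h3 := ENNReal.toReal_mono h2 h1
  rw [toReal_enorm] at h3
  exact pow_le_pow_left₀ ENNReal.toReal_nonneg h3 2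

end Subtorus

/-! ## The systolic bound for almost geometric forms -/

section Lagrangian

variable {V : Type*} [AddCommGroup V] [Module ℝ V] {n : ℕ} {ω : V [⋀^Fin 2]→ₗ[ℝ] ℝ}

theorem bil_eq_zero_of_mem_span {s : Set V} (hs : ∀ x ∈ s, ∀ y ∈ s, bil ω x y = 0) {x y : V}
    (hx : x ∈ Submodule.span ℝ s) (hy : y ∈ Submodule.span ℝ s) : bil ω x y = 0 := by
  induction hx, hy using Submodule.span_induction₂ with
  | mem_mem x y hx hy => exact hs x hx y hy
  | zero_left y hy => simp
  | zero_right x hx => simp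
  | add_left x y z hx hy hz h1 h2 => simp [h1, h2]
  | add_right x y z hx hy hz h1 h2 => simp [h1, h2]
  | smul_left r x y hx hy h => simp [h]
  | smul_right r x y hx hy h => simp [h]

theorem isLagrangian_span {v : Fin n → V} (hv : LinearIndependent ℝ v)
    (h : ∀ i j, bil ω (v i) (v j) = 0) :
    IsLagrangian n ω (Submodule.span ℝ (Set.range v)) := by
  refine ⟨by rw [finrank_span_eq_card hv, Fintype.card_fin], fun x hx y hy => ?_⟩
  refine bil_eq_zero_of_mem_span ?_ hx hy
  rintro _ ⟨i, rfl⟩ _ ⟨j, rfl⟩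
  exact h i j

theorem ne_zero_of_mem_U {Ω : V [⋀^Fin n]→ₗ[ℝ] ℂ} (hΩ : Ω ∈ U n ω) {v : Fin n → V}
    (hv : LinearIndependent ℝ v) (h : ∀ i j, bil ω (v i) (v j) = 0) : Ω v ≠ 0 := by
  intro h0
  refine hΩ.2 _ (isLagrangian_span hv h) ?_
  refine (Module.Basis.span hv).ext_alternating fun w hw => ?_
  have hbij := Finite.injective_iff_bijective.1 hw
  have h1 := Ω.map_perm v (Equiv.ofBijective w hbij)
  rw [h0, smul_zero] at h1
  simp only [AlternatingMap.compLinearMap_apply, AlternatingMap.zero_apply]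
  refine Eq.trans (congrArg Ω (funext fun i => ?_)) h1
  simp [Module.Basis.span_apply]

end Lagrangian

/-- A linear automorphism of `ℂ` of positive determinant maps some unimodular frame, scaled by
`D`, to a conformal frame. -/
theorem exists_conformal_frame {g : ℂ →ₗ[ℝ] ℂ} (hg : 0 < LinearMap.det g) {D : ℂ} (hD : D ≠ 0) :
    ∃ (ζ₁ ζ₂ : ℂ) (s : ℝ), s ≠ 0 ∧ s ^ 2 = LinearMap.det g * ‖D‖ ^ 2 ∧
      g (D * ζ₁) = s ∧ g (D * ζ₂) = s * Complex.I ∧ ζ₁.re * ζ₂.im - ζ₁.im * ζ₂.re = 1 := by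
  obtain ⟨A, B, hAB, hdet⟩ := exists_complex_coefficients g
  set d := LinearMap.det g with hd
  have hdC : A * (starRingEnd ℂ) A - B * (starRingEnd ℂ) B = (d : ℂ) := by
    rw [Complex.mul_conj', Complex.mul_conj', hdet]; push_cast; ring
  have hd0 : (d : ℂ) ≠ 0 := by exact_mod_cast hg.ne'
  have hsurj : ∀ w : ℂ, ∃ ζ : ℂ, g (D * ζ) = w := by
    intro w
    -- The inverse of z ↦ A z + B z̄ is w ↦ (Ā w - B w̄)/d.
    refine ⟨((starRingEnd ℂ) A * w - B * (starRingEnd ℂ) w) / d / D, ?_⟩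
    rw [mul_div_cancel₀ _ hD, hAB]
    simp only [map_div₀, map_sub, map_mul, Complex.conj_conj, Complex.conj_ofReal]
    field_simp
    linear_combination w * hdC
  -- The map ζ ↦ g(Dζ) scales area by d‖D‖² = s², so the preimages of s and s i span area exactly 1.
  have harea : ∀ x y : ℂ, (g (D * x)).re * (g (D * y)).im - (g (D * x)).im * (g (D * y)).re =
      d * ‖D‖ ^ 2 * (x.re * y.im - x.im * y.re) := by
    intro x y
    rw [hdet, ← Complex.normSq_eq_norm_sq, ← Complex.normSq_eq_norm_sq, ← Complex.normSq_eq_norm_sq,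
      hAB, hAB]
    simp only [Complex.normSq_apply, Complex.add_re, Complex.add_im, Complex.mul_re, Complex.mul_im,
      Complex.conj_re, Complex.conj_im]
    ring
  have hs0 : 0 < d * ‖D‖ ^ 2 := mul_pos hg (pow_pos (norm_pos_iff.2 hD) 2)
  obtain ⟨ζ₁, h1⟩ := hsurj (√(d * ‖D‖ ^ 2) : ℝ)
  obtain ⟨ζ₂, h2⟩ := hsurj ((√(d * ‖D‖ ^ 2) : ℝ) * Complex.I)
  refine ⟨ζ₁, ζ₂, √(d * ‖D‖ ^ 2), (Real.sqrt_pos.2 hs0).ne', Real.sq_sqrt hs0.le, h1, h2, ?_⟩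
  have h3 := harea ζ₁ ζ₂
  rw [h1, h2] at h3
  simp only [Complex.ofReal_re, Complex.ofReal_im, Complex.re_ofReal_mul, Complex.im_ofReal_mul,
    Complex.I_re, Complex.I_im, mul_one, mul_zero, sub_zero, Real.mul_self_sqrt hs0.le] at h3
  exact (mul_left_cancel₀ hs0.ne' (by rw [mul_one]; exact h3)).symm

theorem coordForm_eq_zero_of_mem_span {V : Type*} [AddCommGroup V] [Module ℝ V] {n : ℕ}
    {ω : V [⋀^Fin 2]→ₗ[ℝ] ℝ} {J : V →ₗ[ℝ] V} {u : Fin n → V}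
    (hu : IsSymplecticFamily ω u (J ∘ u)) (c : ℂ) {i j : Fin n} (hij : j ≤ i) {x : V}
    (hx : x ∈ Submodule.span ℝ (u '' Set.Iio j)) : coordForm ω J u c i x = 0 := by
  induction hx using Submodule.span_induction with
  | mem x hx =>
    obtain ⟨l, hl, rfl⟩ := hx
    rw [coordForm_frame hu, if_neg (lt_of_lt_of_le hl hij).ne']
  | zero => simp
  | add x y hx hy h1 h2 => simp [h1, h2]
  | smul r x hx h => simp [h]

section Bound

variable {V : Type*} [NormedAddCommGroup V] [NormedSpace ℝ V] [FiniteDimensional ℝ V] {n : ℕ}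

theorem systolicBound_Uag_zero {Λ : Submodule ℤ V} [DiscreteTopology Λ] [IsZLattice ℝ Λ]
    (hV : Module.finrank ℝ V = 2 * 0) (ω : V [⋀^Fin 2]→ₗ[ℝ] ℝ) :
    SystolicBound Λ hV ω (Uag 0 ω) := by
  refine ⟨1, one_pos, ?_⟩
  rintro Ω ⟨g, hg, Ω₀, hΩ₀, rfl⟩
  have hprim : PrimitiveUpTo Λ (![] : Fin 0 → V) 0 := fun _ _ _ i => i.elim0
  have h0 : Ω₀ ![] ≠ 0 :=
    ne_zero_of_mem_U hΩ₀.1 (linearIndependent_empty_type) fun i => i.elim0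
  have hinj : Function.Injective g := by
    have := (LinearMap.equivOfDetNeZero g hg.ne').injective
    exact this
  refine hprim.sys_bound (fun i => i.elim0) (fun i => i.elim0) ?_ ?_
  · exact fun h => h0 (hinj (by rw [map_zero]; exact h))
  · rw [one_mul, vol_zero]

theorem systolicBound_Uag {Λ : Submodule ℤ V} [DiscreteTopology Λ] [IsZLattice ℝ Λ]
    (hV : Module.finrank ℝ V = 2 * n) {ω : V [⋀^Fin 2]→ₗ[ℝ] ℝ} (hrat : IsRationalOn Λ ω) :
    SystolicBound Λ hV ω (Uag n ω) := by
  rcases Nat.eq_zero_or_pos n with rfl | hn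
  · exact systolicBound_Uag_zero hV ω
  obtain ⟨ρ, hρ1, hρ⟩ := exists_reducedUpTo hV (blockLatticeBasis Λ hV) hrat
  obtain ⟨r, hr1, hr⟩ := exists_last_vector hV (blockLatticeBasis Λ hV) hrat
  set δ := covolume Λ hV ω with hδ
  have hδ0 : 0 ≤ δ := Real.sqrt_nonneg _
  -- The factor ρ^(n-1) bounds the first n - 1 diagonal entries and 2r² the last vector. Adding 1
  -- keeps the constant positive: δ > 0 is only known once some compatible J supplies a symplectic
  -- frame.
  refine ⟨2 * r ^ 2 * (ρ ^ (n - 1)) ^ 2 / δ + 1, by positivity, ?_⟩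
  rintro Ω ⟨g, hg, Ω₀, ⟨hΩU, J, hJ, hΩJ⟩, rfl⟩
  set k : Fin n := ⟨n - 1, by omega⟩ with hk
  have hle : ∀ i : Fin n, i ≤ k := fun i => Fin.le_def.2 (by have := i.2; simp only [hk]; omega)
  obtain ⟨u, v, hu, hred⟩ := hρ J hJ k k.2.le
  have hδpos : 0 < δ := covolume_pos hV hu
  have hu0 : Ω₀ u ≠ 0 :=
    ne_zero_of_mem_U hΩU (hu.linearIndependent.comp Sum.inl Sum.inl_injective) hu.bil_ee
  have hp : ∀ i : Fin n, ∃ p : ℝ, 0 < p ∧ p ≤ ρ ∧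
      (i < k → v i - p • u i ∈ Submodule.span ℝ (u '' Set.Iio i)) := by
    intro i
    by_cases hi : i < k
    · obtain ⟨p, hp, hpρ, hs⟩ := hred.triangular i hi
      exact ⟨p, hp, hpρ, fun _ => hs⟩
    · exact ⟨1, one_pos, hρ1, fun h => absurd h hi⟩
  choose p hp0 hpρ hps using hp
  set P : ℝ := ∏ i ∈ Finset.univ.erase k, p i with hP
  have hP0 : 0 < P := Finset.prod_pos fun i _ => hp0 i
  have hPρ : P ≤ ρ ^ (n - 1) := by
    refine (Finset.prod_le_prod (fun i _ => (hp0 i).le) fun i _ => hpρ i).trans_eq ?_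
    rw [Finset.prod_const, Finset.card_erase_of_mem (Finset.mem_univ _), Finset.card_univ,
      Fintype.card_fin]
  set D : ℂ := Ω₀ u * P with hD
  have hD0 : D ≠ 0 := mul_ne_zero hu0 (by exact_mod_cast hP0.ne')
  -- Once the first n - 1 vectors are fixed, Ω depends on the last one through ζ ↦ g(Dζ). In the
  -- basis ζ₁, ζ₂ this is s times an isometry, so a vector short in that basis has a small period.
  obtain ⟨ζ₁, ζ₂, s, hs0, hs, h1, h2, hζ⟩ := exists_conformal_frame hg hD0
  obtain ⟨x, hxΛ, a, c, ha, hc, hac, hxs, hprim⟩ := hr J hJ ρ u v hu k hle hred ζ₁ ζ₂ hζ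
  set ζ : ℂ := a * ζ₁ + c * ζ₂ with hζdef
  set w := Function.update v k x with hw
  have hwv : ∀ i, i < k → w i = v i := fun i hi => by rw [hw, Function.update_of_ne hi.ne]
  have hwk : w k = x := by rw [hw, Function.update_self]
  have hmem : ∀ i, w i ∈ Λ := by
    intro i
    rcases (hle i).eq_or_lt with rfl | hi
    · rwa [hwk]
    · rw [hwv i hi]; exact hred.mem i hi
  have hspan : ∀ i < k, w i ∈ Submodule.span ℝ (u '' Set.Iio k) := fun i hi => by
    rw [hwv i hi]; exact hred.span_le hi
  have hisou : ∀ y ∈ u '' Set.Iio k, ∀ z ∈ u '' Set.Iio k, bil ω y z = 0 := by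
    rintro _ ⟨i, -, rfl⟩ _ ⟨j, -, rfl⟩
    exact hu.bil_ee i j
  have hxu : ∀ y ∈ Submodule.span ℝ (u '' Set.Iio k), bil ω y x = 0 := by
    intro y hy
    have e1 := bil_eq_zero_of_mem_span hisou hy hxs
    have e2 : bil ω y (u k) = 0 ∧ bil ω y (J (u k)) = 0 := by
      clear e1
      induction hy using Submodule.span_induction with
      | mem y hy =>
        obtain ⟨i, hi, rfl⟩ := hy
        exact ⟨hu.bil_ee i k, (hu.bil_ef i k).trans (if_neg (ne_of_lt hi))⟩
      | zero => simp
      | add y z hy hz h1 h2 => simp [h1, h2]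
      | smul t y hy h => simp [h]
    rw [map_sub, map_add, map_smul, map_smul, e2.1, e2.2] at e1
    simpa using e1
  have hiso : ∀ i j, ω ![w i, w j] = 0 := by
    intro i j
    change bil ω (w i) (w j) = 0
    rcases (hle i).eq_or_lt with rfl | hi <;> rcases (hle j).eq_or_lt with hj | hj
    · rw [hj, bil_self]
    · rw [hwk, bil_swap, hxu _ (hspan j hj), neg_zero]
    · rw [hj, hwk, hxu _ (hspan i hi)]
    · exact bil_eq_zero_of_mem_span hisou (hspan i hi) (hspan j hj)
  have hdiag : ∀ j, coordForm ω J u Complex.I j (w j) = if j = k then ζ else p j := by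
    intro j
    rcases (hle j).eq_or_lt with rfl | hj
    · have e := coordForm_eq_zero_of_mem_span hu Complex.I le_rfl hxs
      rw [map_sub, map_add, map_smul, map_smul, coordForm_frame hu, coordForm_J_frame hu,
        sub_eq_zero] at e
      rw [hwk, e, if_pos rfl, if_pos rfl, if_pos rfl]
      simp only [Complex.real_smul, mul_one]
      exact Complex.re_add_im ζ
    · have e := coordForm_eq_zero_of_mem_span hu Complex.I le_rfl (hps j hj)
      rw [map_sub, map_smul, coordForm_frame hu, sub_eq_zero] at e
      rw [hwv j hj, e, if_pos rfl, if_neg hj.ne]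
      simp
  -- The complex coordinate matrix of w is triangular with diagonal p_j and finally ζ, so Ω₀(w) is
  -- Ω₀(u) ∏ p_j ζ = Dζ.
  have hupper : (Matrix.of fun i j => coordForm ω J u Complex.I i (w j)).IsUpperTriangular := by
    intro i j hij
    have hij' : j < i := hij
    have hjk : j < k := lt_of_lt_of_le hij' (hle i)
    have e := coordForm_eq_zero_of_mem_span hu Complex.I hij'.le (hps j hjk)
    rw [map_sub, map_smul, coordForm_frame hu, if_neg hij'.ne', smul_zero, sub_zero] at e
    rw [Matrix.of_apply, hwv j hjk, e]
  have hΩw : Ω₀ w = D * ζ := by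
    have e := IsEigenform.eq_smul_detForm hJ (c := Complex.I) (by simp) hΩJ hV hu
    have e2 : Ω₀ w = Ω₀ u * detForm (coordForm ω J u Complex.I) w := by
      conv_lhs => rw [e]
      rfl
    rw [e2, detForm_apply, Matrix.det_of_isUpperTriangular hupper]
    simp only [Matrix.of_apply, hdiag]
    rw [← Finset.mul_prod_erase _ _ (Finset.mem_univ k), if_pos rfl, hD, hP,
      Finset.prod_congr rfl fun i hi => if_neg (Finset.ne_of_mem_erase hi)]
    push_cast
    ring
  have hgw : (g.compAlternatingMap Ω₀) w = s * (a + c * Complex.I) := by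
    rw [LinearMap.compAlternatingMap_apply, hΩw]
    have e : D * ζ = a • (D * ζ₁) + c • (D * ζ₂) := by
      rw [hζdef, Complex.real_smul, Complex.real_smul]; ring
    rw [e, map_add, map_smul, map_smul, h1, h2, Complex.real_smul, Complex.real_smul]
    ring
  have hnorm : ‖(g.compAlternatingMap Ω₀) w‖ ^ 2 = s ^ 2 * (a ^ 2 + c ^ 2) := by
    rw [hgw, ← Complex.normSq_eq_norm_sq, Complex.normSq_mul, Complex.normSq_ofReal,
      Complex.normSq_add_mul_I]
    ring
  have hac2 : a ^ 2 + c ^ 2 ≤ 2 * r ^ 2 := by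
    have e1 := sq_le_sq' (abs_lt.1 ha).1.le (abs_lt.1 ha).2.le
    have e2 := sq_le_sq' (abs_lt.1 hc).1.le (abs_lt.1 hc).2.le
    linarith
  have hacpos : 0 < a ^ 2 + c ^ 2 := by rcases hac with h | h <;> positivity
  refine hprim.sys_bound hmem hiso ?_ ?_
  · intro h0
    rw [h0, norm_zero] at hnorm
    have : 0 < s ^ 2 * (a ^ 2 + c ^ 2) := by positivity
    norm_num at hnorm
    rcases hnorm with h | h
    · exact hs0 h
    · exact hacpos.ne' h
  · obtain ⟨A, B, hAB, hdet⟩ := exists_complex_coefficients g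
    rw [hnorm, vol_eq hn.ne' hV hJ hΩJ hu hAB, ← hδ]
    set d := LinearMap.det g with hd
    set y := ‖Ω₀ u‖ ^ 2 with hy
    have hy0 : 0 ≤ y := sq_nonneg _
    have hDn : ‖D‖ ^ 2 = y * P ^ 2 := by
      rw [hD, norm_mul, mul_pow, Complex.norm_real, Real.norm_eq_abs, sq_abs]
    -- Equality holds for odd n; for even n the right side is ‖A‖² + ‖B‖².
    have hdle : d ≤ ‖A‖ ^ 2 + (-1) ^ n * ‖B‖ ^ 2 := by
      rw [hdet]
      rcases neg_one_pow_eq_or ℝ n with h | h <;> rw [h] <;> linarith [sq_nonneg ‖B‖]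
    have hP2 : P ^ 2 ≤ (ρ ^ (n - 1)) ^ 2 := pow_le_pow_left₀ hP0.le hPρ 2
    set m := ‖A‖ ^ 2 + (-1) ^ n * ‖B‖ ^ 2 with hm
    calc s ^ 2 * (a ^ 2 + c ^ 2) ≤ s ^ 2 * (2 * r ^ 2) := by gcongr
      _ = 2 * r ^ 2 * P ^ 2 * (d * y) := by rw [hs, hDn]; ring
      _ ≤ 2 * r ^ 2 * (ρ ^ (n - 1)) ^ 2 * (m * y) := by gcongr
      _ = 2 * r ^ 2 * (ρ ^ (n - 1)) ^ 2 / δ * (δ * (m * y)) := by field_simp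
      _ ≤ (2 * r ^ 2 * (ρ ^ (n - 1)) ^ 2 / δ + 1) * (δ * (m * y)) := by
        have : 0 ≤ δ * (m * y) := mul_nonneg hδ0 (mul_nonneg (hg.le.trans hdle) hy0)
        nlinarith

end Bound

/-! ## Primitive two-forms on a four-dimensional symplectic space -/

theorem sum_perm_fin_four (F : Fin 4 → Fin 4 → Fin 4 → Fin 4 → ℂ) :
    ∑ σ : Equiv.Perm (Fin 4), Equiv.Perm.sign σ • F (σ 0) (σ 1) (σ 2) (σ 3) =
      F 0 1 2 3 + -F 0 1 3 2 + (F 0 2 3 1 + -F 0 2 1 3 + (F 0 3 1 2 + -F 0 3 2 1)) +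
      (F 1 3 2 0 + -F 1 3 0 2 + (F 1 2 0 3 + -F 1 2 3 0) + (F 1 0 3 2 + -F 1 0 2 3) +
      (F 2 3 0 1 + -F 2 3 1 0 + (F 2 0 1 3 + -F 2 0 3 1) + (F 2 1 3 0 + -F 2 1 0 3) +
      (F 3 0 2 1 + -F 3 0 1 2 + (F 3 2 1 0 + -F 3 2 0 1) + (F 3 1 0 2 + -F 3 1 2 0)))) := by
  simp [Finset.univ_perm_fin_succ, ← Finset.univ_product_univ, Finset.sum_product,
    Fin.sum_univ_succ, Equiv.Perm.decomposeFin.symm_sign]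
  rfl

section FourDim

variable {V : Type*} [AddCommGroup V] [Module ℝ V] {ω : V [⋀^Fin 2]→ₗ[ℝ] ℝ} {e f : Fin 2 → V}

/-- Evaluating Ω ∧ ω on e₀, f₀, e₁, f₁, the factor ω leaves only the pairs (e_i, f_i). In the
permutation sum each surviving term occurs four times. -/
theorem IsSymplecticFamily.primitive (h : IsSymplecticFamily ω e f) {Ω : V [⋀^Fin 2]→ₗ[ℝ] ℂ}
    (hΩ : IsPrimitive ω Ω) : bil Ω (e 0) (f 0) + bil Ω (e 1) (f 1) = 0 := by
  set y : Fin 4 → V := ![e 0, f 0, e 1, f 1] with hy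
  have h1 := factorial_smul_wedge_apply Ω (complexify ω) y
  rw [show wedge Ω (complexify ω) = 0 from hΩ, AlternatingMap.zero_apply, smul_zero] at h1
  have h2 : ∀ σ : Equiv.Perm (Fin 4), Ω (fun i => y (σ (finSumFinEquiv (Sum.inl i : Fin 2 ⊕ Fin 2)))) *
      complexify ω (fun j => y (σ (finSumFinEquiv (Sum.inr j : Fin 2 ⊕ Fin 2)))) =
      bil Ω (y (σ 0)) (y (σ 1)) * (bil ω (y (σ 2)) (y (σ 3)) : ℂ) := by
    intro σ
    congr 1
    · rw [bil_apply]
      congr 1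
      ext i
      fin_cases i <;> rfl
    · rw [bil_apply, complexify, LinearMap.compAlternatingMap_apply]
      have : (fun j => y (σ (finSumFinEquiv (Sum.inr j : Fin 2 ⊕ Fin 2)))) = ![y (σ 2), y (σ 3)] := by
        ext i
        fin_cases i <;> rfl
      rw [this]
      rfl
  rw [← Equiv.sum_comp (finSumFinEquiv (m := 2) (n := 2)).symm.permCongr] at h1
  simp only [Equiv.Perm.sign_permCongr, Equiv.permCongr_apply, Equiv.symm_symm,
    Equiv.apply_symm_apply, h2] at h1
  rw [sum_perm_fin_four (fun i j k l => bil Ω (y i) (y j) * (bil ω (y k) (y l) : ℂ))] at h1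
  have y0 : y 0 = e 0 := rfl
  have y1 : y 1 = f 0 := rfl
  have y2 : y 2 = e 1 := rfl
  have y3 : y 3 = f 1 := rfl
  simp only [y0, y1, y2, y3, h.bil_ee, h.bil_ff, h.bil_ef, h.bil_fe] at h1
  simp only [bil_swap Ω (f 0) (e 0), bil_swap Ω (f 1) (e 1)] at h1
  norm_num at h1
  linear_combination (-1 / 4 : ℂ) * h1

end FourDim

/-! ### The endomorphism of a primitive 2-form and its discriminant -/

section FormOperator

variable {V : Type*} [AddCommGroup V] [Module ℝ V] {ω : V [⋀^Fin 2]→ₗ[ℝ] ℝ} {e f : Fin 2 → V}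

/-- The endomorphism `T` with `ω(T u, v) = α(u, v)`, for a symplectic basis `e, f` of `ω`. -/
noncomputable def formOp (e f : Fin 2 → V) (α : V [⋀^Fin 2]→ₗ[ℝ] ℝ) : V →ₗ[ℝ] V :=
  ∑ i, (((bil α).flip (f i)).smulRight (e i) - ((bil α).flip (e i)).smulRight (f i))

theorem formOp_apply (α : V [⋀^Fin 2]→ₗ[ℝ] ℝ) (u : V) :
    formOp e f α u = ∑ i, (bil α u (f i) • e i - bil α u (e i) • f i) := by
  simp [formOp]

variable [FiniteDimensional ℝ V]

theorem bil_formOp (h : IsSymplecticFamily ω e f) (hV : Module.finrank ℝ V = 2 * 2)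
    (α : V [⋀^Fin 2]→ₗ[ℝ] ℝ) (u v : V) : bil ω (formOp e f α u) v = bil α u v := by
  have key : bil ω (formOp e f α u) = bil α u := by
    refine (h.basis hV).ext ?_
    rintro (j | j)
    · rw [h.basis_inl, formOp_apply]
      fin_cases j <;> simp [h.bil_ee, h.bil_fe]
    · rw [h.basis_inr, formOp_apply]
      fin_cases j <;> simp [h.bil_ef, h.bil_ff]
  rw [key]

theorem bil_formOp_right (h : IsSymplecticFamily ω e f) (hV : Module.finrank ℝ V = 2 * 2)
    (α : V [⋀^Fin 2]→ₗ[ℝ] ℝ) (u v : V) : bil ω u (formOp e f α v) = bil α u v := by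
  rw [bil_swap, bil_formOp h hV, ← bil_swap]

theorem eq_of_bil_eq (h : IsSymplecticFamily ω e f) (hV : Module.finrank ℝ V = 2 * 2)
    {x y : V} (hxy : ∀ z, bil ω x z = bil ω y z) : x = y := by
  rw [h.expand hV x, h.expand hV y]
  refine Finset.sum_congr rfl fun i _ => ?_
  rw [bil_swap ω (e i) x, bil_swap ω (e i) y, hxy, hxy]

/-- The discriminant of a primitive 2-form: the square of its endomorphism. -/
noncomputable def formDisc (e f : Fin 2 → V) (α : V [⋀^Fin 2]→ₗ[ℝ] ℝ) : ℝ :=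
  bil α (e 0) (f 0) ^ 2 + bil α (e 0) (f 1) * bil α (e 1) (f 0) +
    bil α (e 0) (e 1) * bil α (f 0) (f 1)

/-- The operator T is a root of the Pfaffian polynomial λ ↦ Pf(α - λω), suitably normalized. It is
quadratic in dimension four, and primitivity removes its linear term. -/
theorem formOp_formOp (h : IsSymplecticFamily ω e f) (hV : Module.finrank ℝ V = 2 * 2)
    {α : V [⋀^Fin 2]→ₗ[ℝ] ℝ} (hα : bil α (e 0) (f 0) + bil α (e 1) (f 1) = 0) (u : V) :
    formOp e f α (formOp e f α u) = formDisc e f α • u := by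
  have hr : bil α (e 1) (f 1) = -bil α (e 0) (f 0) := by linarith
  have key : formOp e f α ∘ₗ formOp e f α = formDisc e f α • LinearMap.id := by
    refine (h.basis hV).ext ?_
    have he0 : formOp e f α (e 0) = bil α (e 0) (f 0) • e 0 + bil α (e 0) (f 1) • e 1
        - bil α (e 0) (e 1) • f 1 := by
      rw [formOp_apply, Fin.sum_univ_two, bil_self]; module
    have he1 : formOp e f α (e 1) = bil α (e 1) (f 0) • e 0 - bil α (e 0) (f 0) • e 1
        + bil α (e 0) (e 1) • f 0 := by
      rw [formOp_apply, Fin.sum_univ_two, bil_self, hr, bil_swap α (e 1) (e 0)]; module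
    have hf0 : formOp e f α (f 0) = bil α (f 0) (f 1) • e 1 + bil α (e 0) (f 0) • f 0
        + bil α (e 1) (f 0) • f 1 := by
      rw [formOp_apply, Fin.sum_univ_two, bil_self, bil_swap α (f 0) (e 0),
        bil_swap α (f 0) (e 1)]; module
    have hf1 : formOp e f α (f 1) = -(bil α (f 0) (f 1)) • e 0 + bil α (e 0) (f 1) • f 0
        - bil α (e 0) (f 0) • f 1 := by
      rw [formOp_apply, Fin.sum_univ_two, bil_self, bil_swap α (f 1) (f 0),
        bil_swap α (f 1) (e 0), bil_swap α (f 1) (e 1), hr]; module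
    rintro (j | j) <;> fin_cases j <;>
    simp only [Fin.mk_zero, Fin.mk_one, Fin.isValue, h.basis_inl, h.basis_inr,
      LinearMap.comp_apply, LinearMap.smul_apply, LinearMap.id_apply, he0, he1, hf0, hf1, map_add,
      map_sub, map_smul, formDisc] <;>
    module
  exact LinearMap.congr_fun key u

variable {α β : V [⋀^Fin 2]→ₗ[ℝ] ℝ}

/-- If two primitive 2-forms have no common isotropic Lagrangian plane, then their discriminants
are negative. -/
theorem formDisc_neg (h : IsSymplecticFamily ω e f) (hV : Module.finrank ℝ V = 2 * 2)
    (hα : bil α (e 0) (f 0) + bil α (e 1) (f 1) = 0)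
    (hno : ∀ u v, LinearIndependent ℝ ![u, v] → bil ω u v = 0 → bil α u v = 0 → bil β u v ≠ 0) :
    formDisc e f α < 0 := by
  by_contra! hc
  set T := formOp e f α with hT
  set c := formDisc e f α with hcdef
  have hTT : ∀ u, T (T u) = c • u := formOp_formOp h hV hα
  have hTl : ∀ u v, bil ω (T u) v = bil α u v := bil_formOp h hV α
  have hTr : ∀ u v, bil ω u (T v) = bil α u v := bil_formOp_right h hV α
  rcases hc.eq_or_lt with hc0 | hc0
  · by_cases hT0 : ∀ w, T w = 0
    -- Here α = 0. Among the Lagrangian planes spanned by e₀ and a vector of ⟨e₁, f₁⟩, one linear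
    -- condition in two unknowns makes β vanish.
    · have hα0 : ∀ u v, bil α u v = 0 := fun u v => by rw [← hTl, hT0]; simp
      set p := bil β (e 0) (e 1)
      set s := bil β (e 0) (f 1)
      have hex : ∃ x y : ℝ, (x ≠ 0 ∨ y ≠ 0) ∧ x * p + y * s = 0 := by
        by_cases hp : p = 0
        · exact ⟨1, 0, Or.inl one_ne_zero, by rw [hp]; ring⟩
        · exact ⟨-s, p, Or.inr hp, by ring⟩
      obtain ⟨x, y, hxy, hz⟩ := hex
      refine hno (e 0) (x • e 1 + y • f 1) ?_ ?_ (hα0 _ _) ?_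
      · rw [LinearIndependent.pair_iff]
        intro a d had
        have h1 := congrArg (fun z => bil ω z (f 0)) had
        have h2 := congrArg (fun z => bil ω z (f 1)) had
        have h3 := congrArg (fun z => bil ω (e 1) z) had
        simp [h.bil_ef, h.bil_ff, h.bil_ee] at h1 h2 h3
        refine ⟨h1, ?_⟩
        rcases hxy with hx | hy
        · exact h2.resolve_right hx
        · exact h3.resolve_right hy
      · simp [h.bil_ee, h.bil_ef]
      · simp only [map_add, map_smul, smul_eq_mul]
        exact hz
    -- Here T² = 0 and T ≠ 0, so T z and T w span a plane isotropic for ω and α. If β is nonzero on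
    -- it, the planes spanned by w + t T z and T w are still isotropic for both, and β depends on t
    -- affinely with nonzero slope.
    · push Not at hT0
      obtain ⟨w, hw⟩ := hT0
      have hT2 : ∀ u, T (T u) = 0 := fun u => by rw [hTT, ← hc0, zero_smul]
      obtain ⟨z, hz⟩ : ∃ z, bil α w z ≠ 0 := by
        by_contra! hcon
        apply hw
        refine eq_of_bil_eq h hV fun z => ?_
        rw [hTl, hcon z]; simp
      have hli : LinearIndependent ℝ ![T z, T w] := by
        rw [LinearIndependent.pair_iff]
        intro a d had
        have h1 := congrArg (fun x => bil ω x w) had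
        have h2 := congrArg (fun x => bil ω x z) had
        simp only [map_add, map_smul, LinearMap.add_apply, LinearMap.smul_apply, hTl, bil_self,
          smul_zero, add_zero, zero_add, map_zero, LinearMap.zero_apply, smul_eq_zero,
          bil_swap α z w, neg_eq_zero, hz, or_false] at h1 h2
        exact ⟨h1, h2⟩
      have hω0 : ∀ x y, bil ω (T x) (T y) = 0 := fun x y => by
        rw [hTl, ← hTr, hT2, map_zero]
      have hα0 : ∀ x y, bil α (T x) y = 0 := fun x y => by
        rw [← hTl, hT2]; simp
      by_cases hβ : bil β (T z) (T w) = 0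
      · exact hno _ _ hli (hω0 _ _) (hα0 _ _) hβ
      · set t := -(bil β w (T w) / bil β (T z) (T w)) with ht
        refine hno (w + t • T z) (T w) ?_ ?_ ?_ ?_
        · rw [LinearIndependent.pair_iff]
          intro a d had
          have h1 := congrArg T had
          simp only [map_add, map_smul, hT2, smul_zero, add_zero, map_zero, smul_eq_zero, hw,
            or_false] at h1
          subst h1
          refine ⟨rfl, ?_⟩
          simpa [hw] using had
        · simp [hTr, hα0]
        · simp [hα0, bil_swap α w (T w)]
        · simp only [map_add, map_smul, LinearMap.add_apply, LinearMap.smul_apply, smul_eq_mul, ht]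
          field_simp
          ring
  -- T has eigenvalues ±k, with eigenspaces orthogonal for both ω and α. For u of eigenvalue k, β(u,
  -- ·) vanishes at a nonzero vector of the other eigenspace, because that space contains two
  -- independent vectors w, w'.
  · set k := √c with hk
    have hk0 : 0 < k := Real.sqrt_pos.2 hc0
    have hkk : k * k = c := Real.mul_self_sqrt hc
    -- Primitivity excludes a scalar T: the sum α(e₀, f₀) + α(e₁, f₁) would be 2k'.
    have hnot : ∀ k' : ℝ, k' ≠ 0 → ∃ x, T x - k' • x ≠ 0 := by
      intro k' hk'
      by_contra! hcon
      have h1 := hTl (e 0) (f 0)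
      have h2 := hTl (e 1) (f 1)
      rw [sub_eq_zero.1 (hcon (e 0))] at h1
      rw [sub_eq_zero.1 (hcon (e 1))] at h2
      simp only [map_smul, LinearMap.smul_apply, h.bil_ef, if_true, smul_eq_mul, mul_one] at h1 h2
      apply hk'
      linarith
    obtain ⟨x, hx⟩ := hnot k hk0.ne'
    obtain ⟨y, hy⟩ := hnot (-k) (neg_ne_zero.2 hk0.ne')
    set w := T x - k • x with hw
    set u := T y - (-k) • y with hu
    have hTw : T w = -k • w := by
      rw [hw, map_sub, map_smul, hTT, ← hkk]; module
    have hTu : T u = k • u := by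
      rw [hu, map_sub, map_smul, hTT, ← hkk]; module
    obtain ⟨z, hz⟩ : ∃ z, bil ω w z ≠ 0 := by
      by_contra! hcon
      exact hx (eq_of_bil_eq h hV fun z => by rw [hcon z]; simp)
    set w' := k • z - T z with hw'
    have hTw' : T w' = -k • w' := by
      rw [hw', map_sub, map_smul, hTT, ← hkk]; module
    have hww' : bil ω w w' ≠ 0 := by
      have h1 : bil ω w (T z) = -k * bil ω w z := by
        rw [hTr, ← hTl, hTw, map_smul, LinearMap.smul_apply, smul_eq_mul]
      rw [hw', map_sub, map_smul, h1, smul_eq_mul]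
      have : k * bil ω w z - -k * bil ω w z = 2 * k * bil ω w z := by ring
      rw [this]
      exact mul_ne_zero (mul_ne_zero two_ne_zero hk0.ne') hz
    have horth : ∀ m, T m = -k • m → bil ω u m = 0 ∧ bil α u m = 0 := by
      intro m hm
      have h1 : bil ω (T u) m = bil ω u (T m) := (hTl u m).trans (hTr u m).symm
      rw [hTu, hm, map_smul, map_smul, LinearMap.smul_apply, smul_eq_mul, smul_eq_mul] at h1
      have h2 : bil ω u m = 0 := by
        have : 2 * k * bil ω u m = 0 := by linarith
        exact (mul_eq_zero.1 this).resolve_left (mul_ne_zero two_ne_zero hk0.ne')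
      refine ⟨h2, ?_⟩
      rw [← hTr, hm, map_smul, h2, smul_zero]
    have hli : ∀ m, T m = -k • m → m ≠ 0 → LinearIndependent ℝ ![u, m] := by
      intro m hm hm0
      rw [LinearIndependent.pair_iff]
      intro a d had
      have h1 := congrArg T had
      rw [map_add, map_smul, map_smul, hTu, hm, map_zero] at h1
      have h2 : (2 * k * a) • u = 0 := by
        have : (2 * k * a) • u = (a • k • u + d • -k • m) + k • (a • u + d • m) := by module
        rw [this, h1, had]; simp
      have ha : a = 0 := by
        have := (smul_eq_zero.1 h2).resolve_right hy
        exact (mul_eq_zero.1 this).resolve_left (mul_ne_zero two_ne_zero hk0.ne')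
      subst ha
      refine ⟨rfl, ?_⟩
      simpa [hm0] using had
    by_cases hβ : bil β u w = 0
    · exact hno u w (hli w hTw hx) (horth w hTw).1 (horth w hTw).2 hβ
    · set m := bil β u w' • w - bil β u w • w' with hm
      have hTm : T m = -k • m := by
        rw [hm, map_sub, map_smul, map_smul, hTw, hTw']; module
      have hm0 : m ≠ 0 := by
        intro h0
        have h1 := congrArg (fun x => bil ω w x) h0
        simp only [hm, map_sub, map_smul, bil_self, smul_zero, zero_sub, map_zero, neg_eq_zero,
          smul_eq_zero] at h1
        exact h1.elim hβ hww'
      refine hno u m (hli m hTm hm0) (horth m hTm).1 (horth m hTm).2 ?_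
      simp only [hm, map_sub, map_smul, smul_eq_mul]
      ring

end FormOperator

/-! ### Normalizing four-dimensional forms to complex type -/

section Normalization

variable {V : Type*} [AddCommGroup V] [Module ℝ V] {ω : V [⋀^Fin 2]→ₗ[ℝ] ℝ}

theorem IsPrimitive.comp {n : ℕ} {Ω : V [⋀^Fin n]→ₗ[ℝ] ℂ} (h : IsPrimitive ω Ω) (g : ℂ →ₗ[ℝ] ℂ) :
    IsPrimitive ω (g.compAlternatingMap Ω) := by
  refine AlternatingMap.ext fun v => ?_
  have h1 := factorial_smul_wedge_apply Ω (complexify ω) v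
  have h2 := factorial_smul_wedge_apply (g.compAlternatingMap Ω) (complexify ω) v
  rw [show wedge Ω (complexify ω) = 0 from h, AlternatingMap.zero_apply, smul_zero] at h1
  have h3 : ∀ (r : ℝ) (z : ℂ), g z * r = g (z * r) := fun r z => by
    rw [mul_comm, ← Complex.real_smul, ← map_smul, Complex.real_smul, mul_comm]
  have h4 : ∑ σ : Equiv.Perm (Fin n ⊕ Fin 2), Equiv.Perm.sign σ •
      (g.compAlternatingMap Ω (fun i => v (finSumFinEquiv (σ (Sum.inl i)))) *
        complexify ω (fun j => v (finSumFinEquiv (σ (Sum.inr j))))) = g 0 := by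
    rw [h1, map_sum]
    refine Finset.sum_congr rfl fun σ _ => ?_
    rw [Units.smul_def, Units.smul_def, map_zsmul]
    congr 1
    exact h3 _ _
  rw [h4, map_zero, smul_eq_zero] at h2
  exact h2.resolve_left (mul_ne_zero (Nat.factorial_ne_zero _) (Nat.factorial_ne_zero _))

theorem U.comp {n : ℕ} {Ω : V [⋀^Fin n]→ₗ[ℝ] ℂ} (h : Ω ∈ U n ω) {g : ℂ →ₗ[ℝ] ℂ}
    (hg : Function.Injective g) : g.compAlternatingMap Ω ∈ U n ω := by
  refine ⟨IsPrimitive.comp h.1 g, fun W hW h0 => h.2 W hW ?_⟩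
  refine AlternatingMap.ext fun v => hg ?_
  rw [AlternatingMap.zero_apply, map_zero]
  exact congrArg (fun F : W [⋀^Fin n]→ₗ[ℝ] ℂ => F v) h0

/-- A positive definite binary quadratic form has an orthonormal basis of triangular shape. -/
theorem exists_orthonormal_of_posDef {a m b : ℝ}
    (h : ∀ x y : ℝ, (x ≠ 0 ∨ y ≠ 0) → 0 < a * x ^ 2 + 2 * m * x * y + b * y ^ 2) :
    ∃ x y z : ℝ, 0 < x ∧ 0 < z ∧ a * x ^ 2 = 1 ∧ a * y ^ 2 + 2 * m * y * z + b * z ^ 2 = 1 ∧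
      a * x * y + m * x * z = 0 := by
  have ha : 0 < a := by simpa using h 1 0 (Or.inl one_ne_zero)
  have hd : 0 < b - m ^ 2 / a := by
    have := h (-(m / a)) 1 (Or.inr one_ne_zero)
    convert this using 1
    field_simp
    ring
  have h1 := Real.sq_sqrt ha.le
  have h2 := Real.sq_sqrt hd.le
  have h3 := (Real.sqrt_pos.2 ha).ne'
  have h4 := (Real.sqrt_pos.2 hd).ne'
  refine ⟨(√a)⁻¹, -(m / a) * (√(b - m ^ 2 / a))⁻¹, (√(b - m ^ 2 / a))⁻¹, by positivity,
    by positivity, ?_, ?_, ?_⟩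
  · rw [inv_pow, h1, mul_inv_cancel₀ ha.ne']
  · have : a * (-(m / a) * (√(b - m ^ 2 / a))⁻¹) ^ 2 +
        2 * m * (-(m / a) * (√(b - m ^ 2 / a))⁻¹) * (√(b - m ^ 2 / a))⁻¹ +
        b * (√(b - m ^ 2 / a))⁻¹ ^ 2 = (b - m ^ 2 / a) * (√(b - m ^ 2 / a) ^ 2)⁻¹ := by
      field_simp
      ring
    rw [this, h2, mul_inv_cancel₀ hd.ne']
  · field_simp
    ring

/-- The real linear map `z ↦ x Re z + i (y Re z + w Im z)`. -/
noncomputable def lowerTriangular (x y w : ℝ) : ℂ →ₗ[ℝ] ℂ :=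
  Complex.reLm.smulRight (x + y * Complex.I) + Complex.imLm.smulRight (w * Complex.I)

theorem lowerTriangular_apply (x y w : ℝ) (z : ℂ) :
    lowerTriangular x y w z = (x * z.re : ℝ) + (y * z.re + w * z.im : ℝ) * Complex.I := by
  simp [lowerTriangular]
  ring

theorem det_lowerTriangular (x y w : ℝ) : LinearMap.det (lowerTriangular x y w) = x * w := by
  rw [← LinearMap.det_toMatrix Complex.basisOneI, Matrix.det_fin_two]
  simp [LinearMap.toMatrix_apply, lowerTriangular_apply]

theorem linearIndependent_J {J : V →ₗ[ℝ] V} (hJ : ∀ v, J (J v) = -v) {v : V} (hv : v ≠ 0) :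
    LinearIndependent ℝ ![v, J v] := by
  rw [LinearIndependent.pair_iff]
  intro s t h
  have h1 := congrArg J h
  rw [map_add, map_smul, map_smul, hJ, map_zero] at h1
  have h2 : (s ^ 2 + t ^ 2) • v = 0 := by
    have : (s ^ 2 + t ^ 2) • v = s • (s • v + t • J v) - t • (s • J v + t • -v) := by module
    rw [this, h, h1]; simp
  have h3 := (smul_eq_zero.1 h2).resolve_right hv
  constructor <;> nlinarith [sq_nonneg s, sq_nonneg t]

/-- A complex structure preserving `ω` without isotropic complex lines is compatible up to sign. -/
theorem isCompatible_or_neg {J : V →ₗ[ℝ] V} (hJ : ∀ v, J (J v) = -v)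
    (hinv : ∀ u v, bil ω (J u) (J v) = bil ω u v) (hne : ∀ v, v ≠ 0 → bil ω v (J v) ≠ 0) :
    IsCompatible ω J ∨ IsCompatible ω (-J) := by
  by_cases hpos : ∀ v, v ≠ 0 → 0 < bil ω v (J v)
  · exact Or.inl ⟨hJ, hinv, hpos⟩
  · push Not at hpos
    obtain ⟨y, hy, hyneg⟩ := hpos
    have hyneg' := hyneg.lt_of_ne (hne y hy)
    refine Or.inr ⟨fun v => by simp [hJ], fun u v => ?_, fun x hx => ?_⟩
    · have : bil ω (-J u) (-J v) = bil ω u v := by simp [hinv]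
      exact this
    · have hgoal : 0 < bil ω x (-J x) := by
        rw [map_neg, neg_pos]
        by_contra! hc
        have hxpos := hc.lt_of_ne (hne x hx).symm
        have hsymm : bil ω y (J x) = bil ω x (J y) := by
          rw [← hinv, hJ, map_neg, ← bil_swap]
        -- A quadratic polynomial with negative leading and positive constant coefficient has a real
        -- root t. There x + t y must vanish, so x is a multiple of y, contradicting the opposite
        -- signs at x and y.
        have hexp : ∀ t : ℝ, bil ω (x + t • y) (J (x + t • y)) =
            bil ω y (J y) * (t * t) + 2 * bil ω x (J y) * t + bil ω x (J x) := by
          intro t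
          simp only [map_add, map_smul, LinearMap.add_apply, LinearMap.smul_apply, smul_eq_mul,
            hsymm]
          ring
        obtain ⟨t, ht⟩ := exists_quadratic_eq_zero (a := bil ω y (J y)) (b := 2 * bil ω x (J y))
          (c := bil ω x (J x)) hyneg'.ne ⟨√(discrim _ _ _), (Real.mul_self_sqrt (by
            unfold discrim
            nlinarith [sq_nonneg (bil ω x (J y)), mul_pos hxpos (neg_pos.2 hyneg')])).symm⟩
        have h0 : x + t • y = 0 := by
          by_contra h0
          exact hne _ h0 ((hexp t).trans ht)
        have h1 : x = (-t) • y := by rw [neg_smul]; exact eq_neg_of_add_eq_zero_left h0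
        rw [h1] at hxpos
        simp only [map_smul, LinearMap.smul_apply, smul_eq_mul] at hxpos
        nlinarith [sq_nonneg t]
      exact hgoal

variable [FiniteDimensional ℝ V] {e f : Fin 2 → V}

/-- -disc is a positive definite quadratic form on the combinations of Re Ω and Im Ω. In an
orthonormal basis of this pencil the operators satisfy T² = S² = -1 and TS = -ST. For Ω' = ω(T·,·) +
i ω(S·,·), the product J = TS acts as multiplication by i. An isotropic complex line of J would be a
Lagrangian plane on which Ω' vanishes. -/
theorem exists_complexStructure (h : IsSymplecticFamily ω e f)
    (hV : Module.finrank ℝ V = 2 * 2) {Ω : V [⋀^Fin 2]→ₗ[ℝ] ℂ} (hΩ : Ω ∈ U 2 ω) :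
    ∃ g : ℂ →ₗ[ℝ] ℂ, 0 < LinearMap.det g ∧ ∃ Ω' ∈ U 2 ω, Ω = g.compAlternatingMap Ω' ∧
      ∃ J : V →ₗ[ℝ] V, (IsCompatible ω J ∨ IsCompatible ω (-J)) ∧ IsTypeN0 J Ω' := by
  have hprim := h.primitive hΩ.1
  set A : ℝ → ℝ → ℂ →ₗ[ℝ] ℝ := fun x y => x • Complex.reLm + y • Complex.imLm with hA
  have hAa : ∀ x y z, A x y z = x * z.re + y * z.im := fun x y z => by simp [hA]
  set F : ℝ → ℝ → V [⋀^Fin 2]→ₗ[ℝ] ℝ := fun x y => (A x y).compAlternatingMap Ω with hF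
  have hFa : ∀ x y u v, bil (F x y) u v = x * (bil Ω u v).re + y * (bil Ω u v).im :=
    fun x y u v => by rw [← hAa]; rfl
  have hFprim : ∀ x y, bil (F x y) (e 0) (f 0) + bil (F x y) (e 1) (f 1) = 0 := fun x y => by
    have h1 := congrArg Complex.re hprim
    have h2 := congrArg Complex.im hprim
    simp only [Complex.add_re, Complex.add_im, Complex.zero_re, Complex.zero_im] at h1 h2
    rw [hFa, hFa]
    linear_combination x * h1 + y * h2
  have hUne : ∀ Ω₁ ∈ U 2 ω, ∀ u v, LinearIndependent ℝ ![u, v] → bil ω u v = 0 →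
      bil Ω₁ u v ≠ 0 := by
    intro Ω₁ hΩ₁ u v hli huv
    refine ne_zero_of_mem_U hΩ₁ hli fun i j => ?_
    fin_cases i <;> fin_cases j <;> simp [huv, bil_swap ω v u]
  have hneg : ∀ x y : ℝ, (x ≠ 0 ∨ y ≠ 0) → formDisc e f (F x y) < 0 := by
    intro x y hxy
    -- F(x, y) and F(-y, x) are the real and imaginary parts of Ω up to an invertible
    -- transformation, so their common vanishing means Ω = 0 on the plane.
    refine formDisc_neg (β := F (-y) x) h hV (hFprim x y) fun u v hli huv h1 h2 => ?_
    refine hUne Ω hΩ u v hli huv ?_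
    rw [hFa] at h1 h2
    have hpos : 0 < x ^ 2 + y ^ 2 := by rcases hxy with h | h <;> positivity
    apply Complex.ext
    · have : (x ^ 2 + y ^ 2) * (bil Ω u v).re = 0 := by linear_combination x * h1 - y * h2
      exact (mul_eq_zero.1 this).resolve_left hpos.ne'
    · have : (x ^ 2 + y ^ 2) * (bil Ω u v).im = 0 := by linear_combination y * h1 + x * h2
      exact (mul_eq_zero.1 this).resolve_left hpos.ne'
  obtain ⟨a, m, b, hquad⟩ : ∃ a m b : ℝ, ∀ x y,
      -formDisc e f (F x y) = a * x ^ 2 + 2 * m * x * y + b * y ^ 2 := by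
    refine ⟨-formDisc e f (F 1 0), -(formDisc e f (F 1 1) - formDisc e f (F 1 0) -
      formDisc e f (F 0 1)) / 2, -formDisc e f (F 0 1), fun x y => ?_⟩
    simp only [formDisc, hFa]
    ring
  obtain ⟨x, y, z, hx, hz, hxx, hyz, horth⟩ := exists_orthonormal_of_posDef (a := a) (m := m)
    (b := b) fun x y hxy => by rw [← hquad]; exact neg_pos.2 (hneg x y hxy)
  have d1 : formDisc e f (F x 0) = -1 := by linear_combination -hquad x 0 - hxx
  have d2 : formDisc e f (F y z) = -1 := by linear_combination -hquad y z - hyz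
  -- Orthogonality gives (T + S)² = -2, and comparison with T² = S² = -1 yields TS + ST = 0.
  have d12 : formDisc e f (F (x + y) z) = -2 := by
    linear_combination -hquad (x + y) z - hxx - hyz - 2 * horth
  set T := formOp e f (F x 0) with hT
  set S := formOp e f (F y z) with hS
  have hTT : ∀ u, T (T u) = -u := fun u => by
    rw [hT, formOp_formOp h hV (hFprim _ _), d1, neg_one_smul]
  have hSS : ∀ u, S (S u) = -u := fun u => by
    rw [hS, formOp_formOp h hV (hFprim _ _), d2, neg_one_smul]
  have hTl : ∀ u v, bil ω (T u) v = bil (F x 0) u v := bil_formOp h hV _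
  have hTr : ∀ u v, bil ω u (T v) = bil (F x 0) u v := bil_formOp_right h hV _
  have hSl : ∀ u v, bil ω (S u) v = bil (F y z) u v := bil_formOp h hV _
  have hSr : ∀ u v, bil ω u (S v) = bil (F y z) u v := bil_formOp_right h hV _
  have hsum : ∀ u, formOp e f (F (x + y) z) u = T u + S u := fun u => by
    refine eq_of_bil_eq h hV fun w => ?_
    rw [bil_formOp h hV, map_add, LinearMap.add_apply, hTl, hSl, hFa, hFa, hFa]
    ring
  have hST : ∀ u, S (T u) = -T (S u) := fun u => by
    have h1 := formOp_formOp h hV (hFprim (x + y) z) u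
    rw [d12, hsum, hsum, map_add, map_add, hTT, hSS] at h1
    have h2 : S (T u) + T (S u) = 0 := by
      have : S (T u) + T (S u) = (-u + T (S u) + (S (T u) + -u)) - (-2 : ℝ) • u := by module
      rw [this, h1, sub_self]
    exact eq_neg_of_add_eq_zero_left h2
  set k := lowerTriangular x y z with hk
  have hkdet : LinearMap.det k = x * z := det_lowerTriangular x y z
  have hkpos : 0 < LinearMap.det k := by rw [hkdet]; positivity
  set G := LinearMap.equivOfDetNeZero k hkpos.ne' with hG
  have hGk : ∀ w, G.symm (k w) = w := G.symm_apply_apply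
  set Ω' := k.compAlternatingMap Ω with hΩ'
  have hΩ'U : Ω' ∈ U 2 ω := U.comp hΩ G.injective
  have hΩ'a : ∀ u v, bil Ω' u v = (bil (F x 0) u v : ℂ) + bil (F y z) u v * Complex.I := by
    intro u v
    change lowerTriangular x y z (bil Ω u v) = _
    rw [lowerTriangular_apply, hFa, hFa, zero_mul, add_zero]
  have hJJ : ∀ v, (T ∘ₗ S) ((T ∘ₗ S) v) = -v := fun v => by
    rw [LinearMap.comp_apply, LinearMap.comp_apply, hST, hSS, map_neg, hTT, neg_neg]
  have hleft : ∀ u v, bil Ω' (T (S u)) v = Complex.I * bil Ω' u v := fun u v => by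
    have h1 : bil (F x 0) (T (S u)) v = -bil (F y z) u v := by
      rw [← hTl, hTT, map_neg, LinearMap.neg_apply, hSl]
    have h2 : bil (F y z) (T (S u)) v = bil (F x 0) u v := by
      rw [← hSl, hST, hSS]
      simp [hTl]
    rw [hΩ'a, hΩ'a, h1, h2]
    push_cast
    linear_combination (-(bil (F y z) u v : ℂ)) * Complex.I_mul_I
  refine ⟨G.symm, ?_, Ω', hΩ'U, ?_, T ∘ₗ S, isCompatible_or_neg hJJ ?_ ?_, ?_⟩
  · have h1 : LinearMap.det ((G.symm : ℂ →ₗ[ℝ] ℂ) ∘ₗ k) = 1 := by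
      rw [show (G.symm : ℂ →ₗ[ℝ] ℂ) ∘ₗ k = LinearMap.id from LinearMap.ext hGk, LinearMap.det_id]
    rw [LinearMap.det_comp] at h1
    exact pos_of_mul_pos_left (h1 ▸ one_pos) hkpos.le
  · exact AlternatingMap.ext fun v => (hGk _).symm
  · intro u v
    rw [LinearMap.comp_apply, LinearMap.comp_apply, hTl, ← hTr, hTT, map_neg, hSl, ← hSr, hSS,
      map_neg, neg_neg]
  · intro v hv h0
    refine hUne Ω' hΩ'U v ((T ∘ₗ S) v) (linearIndependent_J hJJ hv) h0 ?_
    rw [bil_swap, LinearMap.comp_apply, hleft, bil_self, mul_zero, neg_zero]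
  · intro v i
    have hv : ∀ w : Fin 2 → V, Ω' w = bil Ω' (w 0) (w 1) := fun w => by
      rw [bil_apply]
      congr 1
      ext j
      fin_cases j <;> rfl
    rw [hv, hv v]
    fin_cases i
    · simpa using hleft (v 0) (v 1)
    · rw [bil_swap Ω' (v 0) (v 1)]
      have := hleft (v 1) (v 0)
      rw [bil_swap] 
      simpa [mul_neg] using this

end Normalization

/-! ## The phase of the standard loop -/

section Phase

/-- The oriented area of the parallelogram spanned by two complex numbers. -/
def area (a b : ℂ) : ℝ := a.re * b.im - a.im * b.re

theorem area_map (g : ℂ →ₗ[ℝ] ℂ) (a b : ℂ) : area (g a) (g b) = LinearMap.det g * area a b := by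
  have hg : ∀ z, g z = z.re • g 1 + z.im • g Complex.I := by
    intro z
    rw [← map_smul, ← map_smul, ← map_add]
    congr 1
    simp [Complex.re_add_im]
  rw [hg a, hg b, ← LinearMap.det_toMatrix Complex.basisOneI, Matrix.det_fin_two]
  simp [LinearMap.toMatrix_apply, area]
  ring

/-- A closed curve of lines in `ℂ` of the form `cos θ a + sin θ b` with `(a, b)` negatively
oriented turns in the negative direction. -/
theorem lift_le_of_area_neg {a b : ℂ} (hab : area a b < 0) {g : ℝ → ℝ} (hg : Continuous g)
    (hlift : ∀ θ : ℝ, ∃ r : ℝ, (Real.cos θ : ℂ) * a + Real.sin θ * b =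
      r * Complex.exp (Complex.I * g θ)) : g Real.pi ≤ g 0 := by
  by_contra! hlt
  choose r hr using hlift
  have hexp : ∀ t : ℝ, Complex.exp (Complex.I * t) = Real.cos t + Real.sin t * Complex.I :=
    fun t => by
      rw [mul_comm, Complex.exp_mul_I, Complex.ofReal_cos, Complex.ofReal_sin]
  have hre : ∀ θ, Real.cos θ * a.re + Real.sin θ * b.re = r θ * Real.cos (g θ) := fun θ => by
    have := congrArg Complex.re (hr θ)
    rw [hexp] at this
    simpa [-Complex.ofReal_cos, -Complex.ofReal_sin] using this
  have him : ∀ θ, Real.cos θ * a.im + Real.sin θ * b.im = r θ * Real.sin (g θ) := fun θ => by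
    have := congrArg Complex.im (hr θ)
    rw [hexp] at this
    simpa [-Complex.ofReal_cos, -Complex.ofReal_sin] using this
  have hreq : r = fun θ => (Real.cos θ * a.re + Real.sin θ * b.re) * Real.cos (g θ) +
      (Real.cos θ * a.im + Real.sin θ * b.im) * Real.sin (g θ) := by
    funext θ
    rw [hre, him]
    linear_combination -(r θ) * Real.sin_sq_add_cos_sq (g θ)
  have hrc : Continuous r := by
    rw [hreq]
    fun_prop
  have hr0 : ∀ θ, r θ ≠ 0 := by
    intro θ h0
    have h1 := hre θ
    have h2 := him θ
    rw [h0, zero_mul] at h1 h2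
    have h3 : Real.cos θ * area a b = 0 := by
      unfold area; linear_combination b.im * h1 - b.re * h2
    have h4 : Real.sin θ * area a b = 0 := by
      unfold area; linear_combination -a.im * h1 + a.re * h2
    have h5 := (mul_eq_zero.1 h3).resolve_right hab.ne
    have h6 := (mul_eq_zero.1 h4).resolve_right hab.ne
    have h7 := Real.sin_sq_add_cos_sq θ
    rw [h5, h6] at h7
    norm_num at h7
  have hrr : ∀ θ, 0 < r 0 * r θ := by
    intro θ
    by_contra! hc
    have hc1 : 0 ∈ Set.uIcc (r 0 * r 0) (r 0 * r θ) :=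
      Set.mem_uIcc.2 (Or.inr ⟨hc, mul_self_nonneg _⟩)
    obtain ⟨t, -, ht⟩ := intermediate_value_uIcc
      ((continuous_const.mul hrc).continuousOn (s := Set.uIcc 0 θ)) hc1
    exact mul_ne_zero (hr0 0) (hr0 t) ht
  -- The oriented area spanned by the points of the curve at 0 and θ is sin θ · area(a, b), and r
  -- has constant sign.
  have hsin : ∀ θ, 0 < θ → θ < Real.pi → Real.sin (g θ - g 0) < 0 := by
    intro θ h0 h1
    have e1 := hre θ
    have e2 := him θ
    have e3 := hre 0
    have e4 := him 0
    rw [Real.cos_zero, Real.sin_zero, one_mul, zero_mul, add_zero] at e3 e4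
    have e5 : Real.sin θ * area a b = r 0 * r θ * Real.sin (g θ - g 0) := by
      have : Real.sin θ * area a b = a.re * (Real.cos θ * a.im + Real.sin θ * b.im) -
          a.im * (Real.cos θ * a.re + Real.sin θ * b.re) := by
        unfold area; ring
      rw [this, e1, e2, e3, e4, Real.sin_sub]
      ring
    have e6 : Real.sin θ * area a b < 0 :=
      mul_neg_of_pos_of_neg (Real.sin_pos_of_pos_of_lt_pi h0 h1) hab
    rw [e5] at e6
    exact neg_of_mul_neg_right e6 (hrr θ).le
  -- If g π > g 0, the increment g θ - g 0 takes the value m in (0, π), where its sine is positive.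
  set m := min ((g Real.pi - g 0) / 2) (Real.pi / 2) with hm
  have hm0 : 0 < m := lt_min (by linarith) (by positivity)
  have hm1 : m < g Real.pi - g 0 := (min_le_left _ _).trans_lt (by linarith)
  have hm2 : m < Real.pi := (min_le_right _ _).trans_lt (by linarith [Real.pi_pos])
  obtain ⟨θ, hθ, hθm⟩ := intermediate_value_Ioo Real.pi_pos.le
    ((hg.sub continuous_const).continuousOn (s := Set.Icc 0 Real.pi))
    (show m ∈ Set.Ioo (g 0 - g 0) (g Real.pi - g 0) from ⟨by rw [sub_self]; exact hm0, hm1⟩)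
  have h1 := hsin θ hθ.1 hθ.2
  rw [show g θ - g 0 = m from hθm] at h1
  exact absurd (Real.sin_pos_of_pos_of_lt_pi hm0 hm2) h1.not_gt

end Phase

/-! ### The sign of the phase for forms of conjugate type -/

section Positivity

variable {V : Type*} [AddCommGroup V] [Module ℝ V] [FiniteDimensional ℝ V] {n : ℕ}
  {ω : V [⋀^Fin 2]→ₗ[ℝ] ℝ} {J : V →ₗ[ℝ] V} {e f : Fin n → V}

/-- The vector `f_i` of a symplectic basis decomposes along `span e ⊕ J (span e)`, with positive
`J e_i`-coefficient. -/
theorem IsSymplecticFamily.exists_decomposition (h : IsSymplecticFamily ω e f)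
    (hV : Module.finrank ℝ V = 2 * n) (hJ : IsCompatible ω J) (i : Fin n) :
    ∃ x y : Fin n → ℝ, 0 < y i ∧ f i = ∑ j, x j • e j + J (∑ j, y j • e j) := by
  have hli : LinearIndependent ℝ e := h.linearIndependent.comp Sum.inl Sum.inl_injective
  set Y : (Fin n → ℝ) →ₗ[ℝ] V := Fintype.linearCombination ℝ e with hY
  have hYa : ∀ c, Y c = ∑ j, c j • e j := fun c => Fintype.linearCombination_apply ℝ e c
  -- Φ is the Gram matrix of ω(·, J·) on the e_j, which is positive definite. Solving Φ y = δ_i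
  -- gives y_i = ω(Y y, J Y y) > 0.
  set Φ : (Fin n → ℝ) →ₗ[ℝ] (Fin n → ℝ) :=
    LinearMap.pi fun j => bil ω (e j) ∘ₗ J ∘ₗ Y with hΦ
  have hΦa : ∀ c j, Φ c j = bil ω (e j) (J (Y c)) := fun c j => rfl
  have hYJ : ∀ c d, bil ω (Y d) (J (Y c)) = ∑ j, d j * Φ c j := fun c d => by
    rw [hYa d]
    simp [hΦa]
  have hYinj : Function.Injective Y := hli.fintypeLinearCombination_injective
  have hYpos : ∀ c, c ≠ 0 → 0 < bil ω (Y c) (J (Y c)) := fun c hc =>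
    hJ.pos _ fun h0 => hc (hYinj (by rw [h0, map_zero]))
  have hinj : Function.Injective Φ := by
    rw [← LinearMap.ker_eq_bot, LinearMap.ker_eq_bot']
    intro c hc
    by_contra hc0
    have := hYpos c hc0
    rw [hYJ, hc] at this
    simp at this
  obtain ⟨y, hy⟩ := LinearMap.injective_iff_surjective.1 hinj (Pi.single i 1)
  have hy0 : y ≠ 0 := by
    rintro rfl
    have := congrFun hy i
    simp at this
  have hyi := hYpos y hy0
  rw [hYJ, hy] at hyi
  simp only [Pi.single_apply, mul_ite, mul_one, mul_zero, Finset.sum_ite_eq', Finset.mem_univ,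
    if_true] at hyi
  refine ⟨fun j => bil ω (f i - J (Y y)) (f j), y, hyi, ?_⟩
  have h1 := h.expand hV (f i - J (Y y))
  have h2 : ∀ j, bil ω (e j) (f i - J (Y y)) = 0 := fun j => by
    rw [map_sub, ← hΦa, hy, h.bil_ef, Pi.single_apply]
    simp [eq_comm]
  simp only [h2, zero_smul, add_zero] at h1
  rw [← hYa y]
  exact sub_eq_iff_eq_add.1 h1

/-- The standard loop has negative phase for forms of type `(0, n)`. -/
theorem lift_le_of_conjugate_type (h : IsSymplecticFamily ω e f)
    (hV : Module.finrank ℝ V = 2 * n) (hJ : IsCompatible ω J) {Ω : V [⋀^Fin n]→ₗ[ℝ] ℂ}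
    (hΩ : Ω ∈ U n ω) (hΩJ : IsEigenform J (-Complex.I) Ω) {k : ℂ →ₗ[ℝ] ℂ}
    (hk : 0 < LinearMap.det k) (i : Fin n) {g : ℝ → ℝ} (hg : Continuous g)
    (hlift : ∀ θ : ℝ, ∃ r : ℝ, k.compAlternatingMap Ω (loopFrame e f i θ) =
      r * Complex.exp (Complex.I * g θ)) : g Real.pi ≤ g 0 := by
  have hli : LinearIndependent ℝ e := h.linearIndependent.comp Sum.inl Sum.inl_injective
  have he : Ω e ≠ 0 := ne_zero_of_mem_U hΩ hli h.bil_ee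
  -- Only the i-th argument moves along the loop. Since ψ ∘ J = -iψ and ψ kills the other e_j,
  -- ψ(f_i) = (x_i - i y_i) Ω(e), so the pair Ω(e), ψ(f_i) is negatively oriented.
  set ψ : V →ₗ[ℝ] ℂ := Ω.toMultilinearMap.toLinearMap e i with hψ
  have hψa : ∀ v, ψ v = Ω (Function.update e i v) := fun v => rfl
  have hψJ : ∀ v, ψ (J v) = -Complex.I * ψ v := fun v => by
    have := hΩJ (Function.update e i v) i
    rwa [Function.update_self, Function.update_idem] at this
  have hψe : ∀ j, ψ (e j) = if j = i then Ω e else 0 := by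
    intro j
    rw [hψa]
    split_ifs with hj
    · rw [hj, Function.update_eq_self]
    · exact Ω.map_eq_zero_of_eq _ (i := j) (j := i) (by simp [hj]) hj
  obtain ⟨x, y, hy, hf⟩ := h.exists_decomposition hV hJ i
  have hψf : ψ (f i) = (x i - y i * Complex.I) * Ω e := by
    rw [hf, map_add, hψJ, map_sum, map_sum]
    simp only [map_smul, hψe, smul_ite, smul_zero, Finset.sum_ite_eq', Finset.mem_univ, if_true,
      Complex.real_smul]
    ring
  have hψei : ψ (e i) = Ω e := by rw [hψe, if_pos rfl]
  refine lift_le_of_area_neg (a := k (Ω e)) (b := k (ψ (f i))) ?_ hg fun θ => ?_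
  · rw [area_map]
    refine mul_neg_of_pos_of_neg hk ?_
    have : area (Ω e) (ψ (f i)) = -(y i * Complex.normSq (Ω e)) := by
      rw [hψf, area, Complex.normSq_apply]
      simp
      ring
    rw [this, neg_lt_zero]
    exact mul_pos hy (Complex.normSq_pos.2 he)
  · obtain ⟨r, hr⟩ := hlift θ
    refine ⟨r, ?_⟩
    rw [← hr]
    change _ = k (ψ (Real.cos θ • e i + Real.sin θ • f i))
    rw [map_add, map_smul, map_smul, map_add, map_smul, map_smul, hψei, Complex.real_smul,
      Complex.real_smul]

end Positivity

/-- Positivity of the loop only decides which of J and -J is compatible: if it is -J, the normalized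
form has eigenvalue -i for it and the phase cannot increase. -/
theorem Uplus_subset_Uag {V : Type*} [AddCommGroup V] [Module ℝ V] [FiniteDimensional ℝ V]
    {ω : V [⋀^Fin 2]→ₗ[ℝ] ℝ} (hV : Module.finrank ℝ V = 2 * 2) : Uplus 2 ω ⊆ Uag 2 ω := by
  rintro Ω ⟨hΩ, e, f, h, i, g, hg, hlift, hlt⟩
  obtain ⟨k, hk, Ω', hΩ', rfl, J, hJ | hJ, hΩJ⟩ := exists_complexStructure h hV hΩ
  · exact ⟨k, hk, Ω', ⟨hΩ', J, hJ, hΩJ⟩, rfl⟩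
  · refine absurd (lift_le_of_conjugate_type h hV hJ hΩ' (fun v j => ?_) hk i hg hlift) hlt.not_ge
    have h1 := hΩJ v j
    rw [LinearMap.neg_apply, ← neg_one_smul ℝ, AlternatingMap.map_update_smul, h1]
    simp

end SymplecticTorus

theorem mainTheorem2 {V : Type*} [NormedAddCommGroup V] [NormedSpace ℝ V] [FiniteDimensional ℝ V]
    (n : ℕ) (hV : Module.finrank ℝ V = 2 * n)
    (Λ : Submodule ℤ V) [DiscreteTopology Λ] [IsZLattice ℝ Λ]
    (ω : V [⋀^Fin 2]→ₗ[ℝ] ℝ) (hω : SymplecticTorus.IsSymplectic ω)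
    (hrat : SymplecticTorus.IsRationalOn Λ ω) :
    SymplecticTorus.SystolicBound Λ hV ω (SymplecticTorus.Uag n ω) ∧
      (n = 2 → SymplecticTorus.SystolicBound Λ hV ω (SymplecticTorus.Uplus n ω)) := by
  refine ⟨SymplecticTorus.systolicBound_Uag hV hrat, ?_⟩
  rintro rfl
  obtain ⟨C, hC, h⟩ := SymplecticTorus.systolicBound_Uag hV hrat
  exact ⟨C, hC, fun Ω hΩ => h Ω (SymplecticTorus.Uplus_subset_Uag hV hΩ)⟩
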